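/- Let $p$ be an odd prime, $\mathbb F_q$ a finite field of characteristic $p$ and $n\ge 1$ an integer; put $\ell=\lfloor n/2\rfloor$ and let $\epsilon_n\in\{0,1\}$ be the parity of $n$. **Setting.** For $d$ not divisible by $p$ let $\mathcal F_d'$ be the set of polynomials $f=a_dX^d+\dots+a_0\in\mathbb F_q[X]$ with $a_d\neq 0$ and $a_{pk}=0$ for all $1\le k\le d/p$, and let $\langle\phi\rangle=|\mathcal F_d'|^{-1}\sum_{f\in\mathcal F_d'}\phi(f)$. For an additive character $\psi$ of $\mathbb F_p$ let $S_k(f,\psi)=\sum_{\alpha\in\mathbb F_{q^k}}\psi(\mathrm{tr}_k f(\alpha))$, where $\mathrm{tr}_k:\mathbb F_{q^k}\to\mathbb F_p$ is the absolute trace, and let $\psi^h(a)=\psi(ha)$. For $0<|\mathcal I|<1$ let $\mathcal I=[-|\mathcal I|/2,|\mathcal I|/2]$. For a positive integer $K$ let $$V_K(x)=-\sum_{k=1}^K\frac{w(k/(K+1))}{\pi k}\sin(2\pi kx),\quad w(t)=\pi t(1-t)\cot(\pi t)+t,\qquad B_K(x)=V_K(x)+\frac{1}{2(K+1)}\sum_{|k|\le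 K}\Bigl(1-\frac{|k|}{K+1}\Bigr)e^{2\pi ikx},$$ and let $I_K^{\pm}(x)=|\mathcal I|\pm B_K\bigl(\pm(x-|\mathcal I|/2)\bigr)\pm B_K\bigl(\pm(-|\mathcal I|/2-x)\bigr)$ be the Beurling--Selberg polynomials of degree $K$ for $\mathcal I$ (trigonometric polynomials with $I_K^-\le\chi_{\mathcal I}\le I_K^+$), with Fourier coefficients $\widehat I_K^{\pm}(k)=\int_{-1/2}^{1/2}I_K^\pm(x)e^{-2\pi ikx}\,dx$. Put $$S^{\pm}(K,f,\psi)=\sum_{k=1}^K\frac{\widehat I_K^{\pm}(k)S_k(f,\psi)+\widehat I_K^{\pm}(-k)S_k(f,\bar\psi)}{q^{k/2}},\qquad C=\sum_{k\ge 1,\ p\mid k}\frac{\sin(\pi k|\mathcal I|)}{\pi k}\,q^{-(1/2-1/p)k},$$ and $\delta_n(C)=1$ for $n$ even, $\delta_n(C)=C$ for $n$ odd. For integers $h_1,\dots,h_n$ let $\Delta(h_1,\dots,h_n)$ be the number of pairs $(e,M)$ where $e\in\{\pm1\}^n$ and $M$ is a set of $\ell$ pairwise disjoint two-element subsets of $\{1,\dots,n\}$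 such that $e_ih_i+e_jh_j\equiv0\pmod p$ for every $\{i,j\}\in M$. (Equivalently, $\Delta$ is $(2^\ell\,\ell!)^{-1}$ times the number of $(e,\sigma)\in\{\pm1\}^n\times\mathbb S_n$ with $e_{2r-1}h_{\sigma(2r-1)}+e_{2r}h_{\sigma(2r)}\equiv0\pmod p$ for $1\le r\le\ell$.) **Theorem.** Let $\beta_0<1$. Let $\psi$ be a non-trivial additive character of $\mathbb F_p$, let $0<h_1,\dots,h_n\le(p-1)/2$, fix a sign $\pm$, let $0<|\mathcal I|\le\beta_0$, let $p\nmid d$, and let $K$ be an integer with $\max\{1,1/|\mathcal I|\}<K<d/n$. Write $$T=\delta_n(C)\,\frac{\Delta(h_1,\dots,h_n)}{(2\pi^2)^\ell}\,\log^\ell(K|\mathcal I|).$$ 1. One has $$\Bigl\langle S^\pm(K,f,\psi^{h_1})\cdots S^\pm(K,f,\psi^{h_n})\Bigr\rangle=T+O\Bigl(|\mathcal I|^{\epsilon_n}\,\bigl(1+\log(K|\mathcal I|)\bigr)^{\ell-1}\Bigr),$$ with an implied constant that depends only on $p,q,n$ and $\beta_0$. 2. For every $c>0$: if moreover $K|\mathcal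 I|\ge2$, $\Delta(h_1,\dots,h_n)\ne0$ and $|\delta_n(C)|\ge c\,|\mathcal I|^{\epsilon_n}$, then $$\Bigl\langle S^\pm(K,f,\psi^{h_1})\cdots S^\pm(K,f,\psi^{h_n})\Bigr\rangle=T\,\Bigl(1+O\bigl(\log^{-1}(K|\mathcal I|)\bigr)\Bigr),$$ with an implied constant that depends only on $p,q,n,\beta_0$ and $c$. (For even $n$ the condition on $\delta_n(C)$ holds with $c=1$; for odd $n$ and fixed $\mathcal I$ it holds for some $c>0$ as soon as $C\neq0$.) -/

import Mathlib

open Polynomial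

noncomputable section

namespace ArtinSchreier

/-! ### Beurling-Selberg polynomials for the interval `[-β/2, β/2]` -/

/-- The Fejér kernel `∑_{|k| ≤ K} (1 - |k|/(K+1)) e(kx)` of degree `K`, in real form. -/
def fejer (K : ℕ) (x : ℝ) : ℝ :=
  1 + 2 * ∑ k ∈ Finset.Icc 1 K, (1 - (k : ℝ) / (K + 1)) * Real.cos (2 * Real.pi * k * x)

/-- Vaaler's weight `π t (1 - t) cot (π t) + t` for `0 < t < 1`. -/
def vaalerWeight (t : ℝ) : ℝ :=
  Real.pi * t * (1 - t) * (Real.cos (Real.pi * t) / Real.sin (Real.pi * t)) + t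

/-- Vaaler's polynomial of degree `K`, which approximates the sawtooth function
`x ↦ x - ⌊x⌋ - 1/2`, whose Fourier series is `-∑_{k ≥ 1} sin (2πkx) / (πk)`. -/
def vaaler (K : ℕ) (x : ℝ) : ℝ :=
  -∑ k ∈ Finset.Icc 1 K,
    vaalerWeight ((k : ℝ) / (K + 1)) / (Real.pi * k) * Real.sin (2 * Real.pi * k * x)

/-- Beurling's polynomial of degree `K`, a majorant of the sawtooth function. -/
def beurling (K : ℕ) (x : ℝ) : ℝ :=
  vaaler K x + fejer K x / (2 * (K + 1))

/-- The Beurling-Selberg polynomials of degree `K` for the interval `[-β/2, β/2]`: the majorant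
`β + B(x - β/2) + B(-β/2 - x)` for `s = 1`, and the minorant
`β - B(β/2 - x) - B(x + β/2)` for `s = -1`, with `B` Beurling's polynomial. -/
def selberg (s : ℤˣ) (K : ℕ) (β x : ℝ) : ℝ :=
  β + ((s : ℤ) : ℝ) * (beurling K (((s : ℤ) : ℝ) * (x - β / 2)) +
    beurling K (((s : ℤ) : ℝ) * (-(β / 2) - x)))

/-- The `k`-th Fourier coefficient of the Beurling-Selberg polynomial. -/
def selbergCoeff (s : ℤˣ) (K : ℕ) (β : ℝ) (k : ℤ) : ℂ :=
  ∫ x in (-(1 / 2) : ℝ)..(1 / 2),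
    (selberg s K β x : ℂ) * Complex.exp (-(2 * Real.pi * Complex.I * k * x))

/-! ### The family of polynomials and its exponential sums -/

/-- Polynomials of degree `d` all of whose coefficients in degrees `p, 2p, 3p, …` vanish. -/
def familySet (p : ℕ) (F : Type*) [Field F] (d : ℕ) : Set F[X] :=
  {f | f.degree = d ∧ ∀ k : ℕ, 1 ≤ k → f.coeff (p * k) = 0}

theorem familySet_finite (p : ℕ) (F : Type*) [Field F] [Finite F] (d : ℕ) :
    (familySet p F d).Finite := by
  have h : Finite (degreeLT F (d + 1)) := Finite.of_equiv _ (degreeLTEquiv F (d + 1)).toEquiv.symm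
  refine Set.Finite.subset (Set.toFinite (degreeLT F (d + 1) : Set F[X])) ?_
  intro f hf
  rw [SetLike.mem_coe, mem_degreeLT, hf.1]
  exact_mod_cast Nat.lt_succ_self d

/-- The finite family over which averages are taken. -/
def family (p : ℕ) (F : Type*) [Field F] [Finite F] (d : ℕ) : Finset F[X] :=
  (familySet_finite p F d).toFinset

/-- The average of `φ` over the family. -/
def average (p : ℕ) (F : Type*) [Field F] [Finite F] (d : ℕ) (φ : F[X] → ℂ) : ℂ :=
  (∑ f ∈ family p F d, φ f) / ((family p F d).card : ℂ)

section ExponentialSums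

variable (p : ℕ) [Fact p.Prime] (F : Type*) [Field F] [Finite F] [CharP F p]

/-- `S_k(f, ψ) = ∑_{α ∈ 𝔽_{q^k}} ψ(tr f(α))`, with the absolute trace `𝔽_{q^k} → 𝔽_p`. -/
def expSum (k : ℕ) [NeZero k] (f : F[X]) (ψ : AddChar (ZMod p) ℂ) : ℂ :=
  letI := Fintype.ofFinite (FiniteField.Extension F p k)
  ∑ α : FiniteField.Extension F p k,
    ψ (Algebra.trace (ZMod p) (FiniteField.Extension F p k) (aeval α f))

/-- `S^±(K, f, ψ) = ∑_{k=1}^K (Î(k) S_k(f, ψ) + Î(-k) S_k(f, ψ⁻¹)) / q^{k/2}` for the interval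
`[-β/2, β/2]`; here `ψ⁻¹` is the complex conjugate of `ψ`. -/
def selbergSum (s : ℤˣ) (K : ℕ) (β : ℝ) (f : F[X]) (ψ : AddChar (ZMod p) ℂ) : ℂ :=
  ∑ j ∈ Finset.range K,
    (selbergCoeff s K β ((j + 1 : ℕ) : ℤ) * expSum p F (j + 1) f ψ +
      selbergCoeff s K β (-((j + 1 : ℕ) : ℤ)) * expSum p F (j + 1) f ψ⁻¹) /
    (((Nat.card F : ℝ) ^ (((j + 1 : ℕ) : ℝ) / 2) : ℝ) : ℂ)

/-- The mixed moment `⟨S^±(K, f, ψ^{h_1}) ⋯ S^±(K, f, ψ^{h_n})⟩` over the family of degree `d`. -/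
def mixedMoment (s : ℤˣ) (K : ℕ) (β : ℝ) (d : ℕ) (ψ : AddChar (ZMod p) ℂ)
    {n : ℕ} (h : Fin n → ℕ) : ℂ :=
  average p F d fun f => ∏ i, selbergSum p F s K β f (ψ ^ h i)

end ExponentialSums

/-! ### The main term -/

/-- `C = ∑_{k ≥ 1, p ∣ k} sin (πkβ) / (πk) · q^{-(1/2 - 1/p) k}`. -/
def constC (p q : ℕ) (β : ℝ) : ℝ :=
  ∑' j : ℕ, Real.sin (Real.pi * ((j + 1 : ℕ) : ℝ) * β) / (Real.pi * ((j + 1 : ℕ) : ℝ)) *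
    (if p ∣ j + 1 then 1 else 0) *
    (q : ℝ) ^ (-((1 / 2 - 1 / (p : ℝ)) * ((j + 1 : ℕ) : ℝ)))

/-- `δ_n(C)`: it is `1` for even `n` and `C` for odd `n`. -/
def deltaC (n : ℕ) (C : ℝ) : ℝ := if Even n then 1 else C

/-- The number of pairs `(e, M)` of a sign vector `e ∈ {1, -1}^n` and a set `M` of `⌊n/2⌋`
pairwise disjoint two-element subsets of the index set such that
`e_i h_i + e_j h_j ≡ 0 (mod p)` for every `{i, j} ∈ M`. -/
def pairingCount (p : ℕ) {n : ℕ} (h : Fin n → ℕ) : ℕ :=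
  Nat.card {x : (Fin n → ℤˣ) × Finset (Finset (Fin n)) //
    x.2.card = n / 2 ∧ (x.2 : Set (Finset (Fin n))).PairwiseDisjoint id ∧
    ∀ B ∈ x.2, B.card = 2 ∧ (p : ℤ) ∣ ∑ i ∈ B, (x.1 i : ℤ) * (h i : ℤ)}

/-- The main term `δ_n(C) · Δ(h_1, …, h_n) / (2π²)^⌊n/2⌋ · log^⌊n/2⌋ (Kβ)`. -/
def mainTerm (p q : ℕ) (K : ℕ) (β : ℝ) {n : ℕ} (h : Fin n → ℕ) : ℝ :=
  deltaC n (constC p q β) * (pairingCount p h : ℝ) / (2 * Real.pi ^ 2) ^ (n / 2) *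
    Real.log (K * β) ^ (n / 2)

end ArtinSchreier

end

/-! Write `q` for the size of `F`. Grouping the points of the extension of degree `k` by minimal
polynomial turns `S_k(f, ψ)` into a sum over monic irreducible `P` with `deg P ∣ k`, and `f` enters
only through its residue trace at `P`. So every factor of the moment is a sum over signs `e` and
places `P` of a function of that trace, the sign `-1` accounting for the conjugate character.
Because `nK ≤ d`, the Chinese remainder theorem, together with `Tr(g^p) = Tr(g)` to avoid the
forbidden exponents, makes the traces at up to `n` distinct places independent and uniform over the
family (`average_prod_sum_places`). The moment is thus exactly a sum over sign vectors of mixed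
moments of sums of independent variables.

Put `Λ = 1 + log(Kβ)`. Three facts control these sums. The mean comes only from `p ∣ k`, is the same
for all indices and equals `C + O(β/Λ)`. The covariance for `i ≠ j` is `log(Kβ)/(2π²) + O(1)` if
`e_i h_i + e_j h_j = 0` in `ZMod p`, and `O(1)` otherwise: a place of degree `m` contributes about
`m² g(m)² q^{-m}`, there are about `q^m/m` such places, and `g(m)` is close to `sin(πmβ)/(πm)`. The
cubes of the sup norms sum to `O(β)`. The variance and norm bounds are collected in
`centeredFamily_placeDev`, the mean in `sum_expect_placeVar` and `abs_meanSum_sub_constC_le`.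

A Gaussian expansion (`exists_sumMoment_bound`, `exists_expect_prod_bound`) leaves only pairings as
main term, with one index taking the mean when `n` is odd. Three or more indices meeting at one
place, or two factors equal to the mean, give a factor `β` and lose at least one power of `Λ`,
whence the error `β^(n % 2) Λ^(⌊n/2⌋ - 1)`. Summed over `e`, the pairings give `Δ`. The moment is
real (`conj_mixedMoment`), so dividing by the main term yields a real relative error. -/

noncomputable section

namespace ArtinSchreier

open scoped BigOperators

/-! ### Exponential sums as sums over monic irreducible polynomials -/

section Places

variable (F : Type*) [Field F] [Finite F]

set_option linter.unusedSectionVars false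

theorem finite_monic_irreducible_natDegree_le (K : ℕ) :
    {P : F[X] | P.Monic ∧ Irreducible P ∧ P.natDegree ≤ K}.Finite := by
  have h : Finite (degreeLT F (K + 1)) := Finite.of_equiv _ (degreeLTEquiv F (K + 1)).toEquiv.symm
  refine Set.Finite.subset (Set.toFinite (degreeLT F (K + 1) : Set F[X])) ?_
  intro f hf
  rw [SetLike.mem_coe, mem_degreeLT]
  refine lt_of_le_of_lt degree_le_natDegree ?_
  exact_mod_cast Nat.lt_succ_of_le hf.2.2

/-- The monic irreducible polynomials of degree at most `K`. -/
def places (K : ℕ) : Finset F[X] := (finite_monic_irreducible_natDegree_le F K).toFinset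

variable {F}

theorem mem_places {K : ℕ} {P : F[X]} :
    P ∈ places F K ↔ P.Monic ∧ Irreducible P ∧ P.natDegree ≤ K := by
  simp [places]

variable (p : ℕ) [Fact p.Prime] [CharP F p]

/-- The absolute trace of the residue class of `f` modulo `P`. -/
def resTrace (P : F[X]) : F[X] →+ ZMod p :=
  letI := ZMod.algebra F p
  (Algebra.trace (ZMod p) F).toAddMonoidHom.comp
    ((Algebra.trace F (AdjoinRoot P)).toAddMonoidHom.comp (AdjoinRoot.mk P).toAddMonoidHom)

theorem resTrace_apply [Algebra (ZMod p) F] (P f : F[X]) : resTrace p P f =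
    Algebra.trace (ZMod p) F (Algebra.trace F (AdjoinRoot P) (AdjoinRoot.mk P f)) := by
  have : ‹Algebra (ZMod p) F› = ZMod.algebra F p := Subsingleton.elim _ _
  subst this
  rfl

/-- Transitivity of the trace through `F(α)`, which is the residue field of the minimal polynomial:
the value of `f` already lies there, so the top layer only multiplies by its degree. -/
theorem trace_aeval_eq_resTrace (k : ℕ) [NeZero k] (α : FiniteField.Extension F p k) (f : F[X]) :
    Algebra.trace (ZMod p) (FiniteField.Extension F p k) (aeval α f) =
      ((k / (minpoly F α).natDegree : ℕ) : ZMod p) * resTrace p (minpoly F α) f := by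
  let := ZMod.algebra F p
  have hint : IsIntegral F α := Algebra.IsIntegral.isIntegral α
  let e := IntermediateField.adjoinRootEquivAdjoin F hint
  have h1 : aeval α f = algebraMap (IntermediateField.adjoin F {α})
      (FiniteField.Extension F p k) (e (AdjoinRoot.mk _ f)) := by
    have : e (AdjoinRoot.mk _ f) = aeval (IntermediateField.AdjoinSimple.gen F α) f := by
      rw [← AdjoinRoot.aeval_eq, ← AlgEquiv.coe_toAlgHom, ← aeval_algHom_apply]
      simp [e, IntermediateField.adjoinRootEquivAdjoin_apply_root]
    rw [this, ← aeval_algebraMap_apply, IntermediateField.AdjoinSimple.algebraMap_gen]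
  have h2 : Module.finrank (IntermediateField.adjoin F {α}) (FiniteField.Extension F p k) =
      k / (minpoly F α).natDegree := by
    have h3 := Module.finrank_mul_finrank F (IntermediateField.adjoin F {α})
      (FiniteField.Extension F p k)
    rw [FiniteField.finrank_extension, IntermediateField.adjoin.finrank hint] at h3
    exact Nat.eq_div_of_mul_eq_right (minpoly.natDegree_pos hint).ne' h3
  rw [← Algebra.trace_trace (S := F), ← Algebra.trace_trace (R := F)
    (S := IntermediateField.adjoin F {α}), h1, Algebra.trace_algebraMap, h2, map_nsmul, map_nsmul, nsmul_eq_mul, resTrace_apply,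
    Algebra.trace_eq_of_algEquiv e]

/-- If `deg P ∣ k`, then `P` divides `X^(q^k) - X`, so it splits, and it is separable because `F` is
perfect. Conversely the degree of an element divides the degree of the extension. -/
theorem natCard_minpoly_eq (k : ℕ) [NeZero k] {P : F[X]} (hP : P.Monic) (hi : Irreducible P) :
    Nat.card {α : FiniteField.Extension F p k // minpoly F α = P} =
      if P.natDegree ∣ k then P.natDegree else 0 := by
  split_ifs with h
  · have hsplit : (P.map (algebraMap F (FiniteField.Extension F p k))).Splits := by
      refine Splits.of_dvd (IsSplittingField.splits (FiniteField.Extension F p k)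
        (X ^ Nat.card F ^ k - X)) ?_ (map_dvd (mapRingHom _)
          (hi.natDegree_dvd_iff_dvd_X_pow_card_pow_sub_X.1 h))
      exact (Polynomial.map_ne_zero_iff (algebraMap F _).injective).2
        (FiniteField.X_pow_card_pow_sub_X_ne_zero _ (NeZero.ne k) Finite.one_lt_card)
    rw [← card_rootSet_eq_natDegree (PerfectField.separable_of_irreducible hi) hsplit,
      ← Nat.card_eq_fintype_card]
    refine Nat.card_congr (Equiv.subtypeEquivRight fun α => ?_)
    rw [mem_rootSet]
    constructor
    · rintro rfl
      exact ⟨hi.ne_zero, minpoly.aeval _ _⟩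
    · rintro ⟨-, h0⟩
      exact (minpoly.eq_of_irreducible_of_monic hi h0 hP).symm
  · have : IsEmpty {α : FiniteField.Extension F p k // minpoly F α = P} := by
      refine ⟨fun ⟨α, hα⟩ => h ?_⟩
      rw [← hα]
      have := minpoly.degree_dvd (K := F) (Algebra.IsIntegral.isIntegral (R := F) α)
      rwa [FiniteField.finrank_extension] at this
    exact Nat.card_of_isEmpty

theorem minpoly_mem_places {k K : ℕ} [NeZero k] (hk : k ≤ K) (α : FiniteField.Extension F p k) :
    minpoly F α ∈ places F K := by
  have hint : IsIntegral F α := Algebra.IsIntegral.isIntegral α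
  refine mem_places.2 ⟨minpoly.monic hint, minpoly.irreducible hint, ?_⟩
  refine le_trans ?_ hk
  have := minpoly.natDegree_le (A := F) α
  rwa [FiniteField.finrank_extension] at this

theorem sum_minpoly {k K : ℕ} [NeZero k] (hk : k ≤ K) (Φ : F[X] → ℂ) :
    letI := Fintype.ofFinite (FiniteField.Extension F p k)
    ∑ α : FiniteField.Extension F p k, Φ (minpoly F α) =
      ∑ P ∈ places F K with P.natDegree ∣ k, (P.natDegree : ℂ) * Φ P := by
  classical
  let := Fintype.ofFinite (FiniteField.Extension F p k)
  rw [← Finset.sum_fiberwise_of_maps_to (t := places F K) (g := fun α => minpoly F α)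
    (fun α _ => minpoly_mem_places p hk α), Finset.sum_filter]
  refine Finset.sum_congr rfl fun P hP => ?_
  rw [Finset.sum_congr rfl (g := fun _ => Φ P)
    (fun α hα => by rw [(Finset.mem_filter.1 hα).2]), Finset.sum_const, nsmul_eq_mul]
  have hP' := mem_places.1 hP
  have := natCard_minpoly_eq p k hP'.1 hP'.2.1
  rw [Nat.card_eq_fintype_card, Fintype.card_subtype] at this
  rw [this]
  split_ifs <;> simp

/-- The exponential sum as a sum over places. -/
theorem expSum_eq_sum_places {k K : ℕ} [NeZero k] (hk : k ≤ K) (f : F[X])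
    (ψ : AddChar (ZMod p) ℂ) :
    expSum p F k f ψ = ∑ P ∈ places F K with P.natDegree ∣ k,
      (P.natDegree : ℂ) * ψ (((k / P.natDegree : ℕ) : ZMod p) * resTrace p P f) := by
  rw [← sum_minpoly p hk (fun P => ψ (((k / P.natDegree : ℕ) : ZMod p) * resTrace p P f))]
  unfold expSum
  exact Finset.sum_congr rfl fun α _ => by rw [trace_aeval_eq_resTrace]

/-- Gauss's count: the fibration of the extension by minimal polynomials, applied to the constant
function 1. -/
theorem sum_natDegree_places {k K : ℕ} (hk0 : 0 < k) (hk : k ≤ K) :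
    ∑ P ∈ places F K with P.natDegree ∣ k, P.natDegree = Nat.card F ^ k := by
  obtain ⟨p, hp⟩ := CharP.exists F
  have : Fact p.Prime := ⟨CharP.char_is_prime F p⟩
  have : NeZero k := ⟨hk0.ne'⟩
  let := Fintype.ofFinite (FiniteField.Extension F p k)
  have h := sum_minpoly p (F := F) hk (fun _ => 1)
  simp only [Finset.sum_const, mul_one, nsmul_eq_mul, Finset.card_univ,
    ← Nat.card_eq_fintype_card, FiniteField.natCard_extension] at h
  exact_mod_cast h.symm

end Places

/-! ### Independence of residue traces over the family -/

section Equidistribution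

/-- Translations that preserve `S` and realise every `w` make all fibres of `T` on `S` equally
large. Averaging over `w` before summing over `S` gives this without counting fibres. -/
theorem expect_comp_eq_of_translate {G W : Type*} [AddCommGroup G] [AddCommGroup W] [Fintype W]
    (S : Finset G) (hS : S.Nonempty) (T : G →+ W)
    (H : ∀ w, ∃ v, T v = w ∧ (∀ f ∈ S, f + v ∈ S) ∧ ∀ f ∈ S, f - v ∈ S) (Φ : W → ℂ) :
    (∑ f ∈ S, Φ (T f)) / (S.card : ℂ) = 𝔼 w, Φ w := by
  have h1 (w : W) : ∑ f ∈ S, Φ (T f + w) = ∑ f ∈ S, Φ (T f) := by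
    obtain ⟨v, rfl, h1, h2⟩ := H w
    refine Finset.sum_nbij' (· + v) (· - v) h1 h2 ?_ ?_ ?_ <;> simp
  have h2 : ∑ w, ∑ f ∈ S, Φ (T f + w) = S.card * ∑ w, Φ w := by
    rw [Finset.sum_comm, ← nsmul_eq_mul, ← Finset.sum_const]
    exact Finset.sum_congr rfl fun f _ => Equiv.sum_comp (Equiv.addLeft (T f)) Φ
  simp only [h1, Finset.sum_const, Finset.card_univ, nsmul_eq_mul] at h2
  rw [Fintype.expect_eq_sum_div_card, div_eq_div_iff, mul_comm, h2, mul_comm]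
  · exact_mod_cast hS.card_pos.ne'
  · exact_mod_cast Fintype.card_ne_zero

variable {F : Type*} [Field F] [Finite F] (p : ℕ) [Fact p.Prime] [CharP F p]

set_option linter.unusedSectionVars false

theorem resTrace_surjective {P : F[X]} (hP : Irreducible P) :
    Function.Surjective (resTrace p P) := by
  let := ZMod.algebra F p
  have : Fact (Irreducible P) := ⟨hP⟩
  have : FiniteDimensional F (AdjoinRoot P) :=
    (AdjoinRoot.powerBasis hP.ne_zero).finite
  intro w
  obtain ⟨x, rfl⟩ := Algebra.trace_surjective (ZMod p) F w
  obtain ⟨y, rfl⟩ := Algebra.trace_surjective F (AdjoinRoot P) x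
  obtain ⟨f, rfl⟩ := AdjoinRoot.mk_surjective y
  exact ⟨f, resTrace_apply p P f⟩

/-- Frobenius is an automorphism of the residue field over `ZMod p`, so it preserves the absolute
trace. -/
theorem resTrace_pow {P : F[X]} (hP : Irreducible P) (f : F[X]) :
    resTrace p P (f ^ p) = resTrace p P f := by
  let := ZMod.algebra F p
  have : Fact (Irreducible P) := ⟨hP⟩
  have : FiniteDimensional F (AdjoinRoot P) :=
    (AdjoinRoot.powerBasis hP.ne_zero).finite
  have : FiniteDimensional (ZMod p) (AdjoinRoot P) := Module.Finite.trans F _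
  rw [resTrace_apply, resTrace_apply, Algebra.trace_trace, Algebra.trace_trace, map_pow]
  have h := Algebra.trace_eq_of_algEquiv
    (FiniteField.frobeniusAlgEquivOfAlgebraic (ZMod p) (AdjoinRoot P)) (AdjoinRoot.mk P f)
  simpa [ZMod.card] using h

variable (F) in
/-- The polynomials of degree less than `d` by which the family of degree `d` may be shifted. -/
def shifts (d : ℕ) : AddSubgroup F[X] where
  carrier := {f | f.degree < d ∧ ∀ k : ℕ, 1 ≤ k → f.coeff (p * k) = 0}
  zero_mem' := by simp
  add_mem' := by
    rintro f g ⟨h1, h2⟩ ⟨h3, h4⟩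
    refine ⟨(degree_add_le f g).trans_lt (max_lt h1 h3), fun k hk => ?_⟩
    rw [coeff_add, h2 k hk, h4 k hk, add_zero]
  neg_mem' := by
    rintro f ⟨h1, h2⟩
    refine ⟨by rwa [degree_neg], fun k hk => ?_⟩
    rw [coeff_neg, h2 k hk, neg_zero]

theorem mem_family {d : ℕ} {f : F[X]} :
    f ∈ family p F d ↔ f.degree = d ∧ ∀ k : ℕ, 1 ≤ k → f.coeff (p * k) = 0 := by
  simp [family, familySet]

theorem add_mem_family {d : ℕ} {f v : F[X]} (hf : f ∈ family p F d) (hv : v ∈ shifts F p d) :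
    f + v ∈ family p F d := by
  rw [mem_family] at hf ⊢
  refine ⟨by rw [degree_add_eq_left_of_degree_lt (by rw [hf.1]; exact hv.1), hf.1], fun k hk => ?_⟩
  rw [coeff_add, hf.2 k hk, hv.2 k hk, add_zero]

theorem family_nonempty {d : ℕ} (hd : ¬ p ∣ d) : (family p F d).Nonempty := by
  refine ⟨X ^ d, (mem_family p).2 ⟨by simp, fun k _ => ?_⟩⟩
  rw [coeff_X_pow, if_neg]
  rintro rfl
  exact hd (dvd_mul_right p k)

/-- Artin-Schreier reduction: `c^p X^(pk)` and `c X^k` have equal residue traces, so a forbidden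
exponent can be divided by `p` until it is allowed. The exponent 0 is allowed, since only `k ≥ 1` is
excluded. -/
theorem exists_shift_monomial {d : ℕ} (j : ℕ) (hj : j < d) (b : F) :
    ∃ v ∈ shifts F p d, ∀ P : F[X], Irreducible P →
      resTrace p P v = resTrace p P (monomial j b) := by
  induction j using Nat.strong_induction_on generalizing b with
  | _ j ih =>
    by_cases hdvd : ∃ k, 1 ≤ k ∧ j = p * k
    · obtain ⟨k, hk, rfl⟩ := hdvd
      have hp : 1 < p := (Fact.out : p.Prime).one_lt
      have hlt : k < p * k := by nlinarith
      have : Function.Surjective (frobenius F p) :=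
        Finite.surjective_of_injective (frobenius_inj F p)
      obtain ⟨c, rfl⟩ := this b
      obtain ⟨v, hv, h⟩ := ih k hlt (hlt.trans hj) c
      refine ⟨v, hv, fun P hP => ?_⟩
      rw [h P hP, ← resTrace_pow p hP, monomial_pow, frobenius_def, mul_comm k p]
    · refine ⟨monomial j b, ⟨?_, fun k hk => ?_⟩, fun P _ => rfl⟩
      · exact (degree_monomial_le j b).trans_lt (by exact_mod_cast hj)
      · rw [coeff_monomial, if_neg]
        exact fun h => hdvd ⟨k, hk, h⟩

theorem exists_shift_of_degree_lt {d : ℕ} {f : F[X]} (hf : f.degree < d) :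
    ∃ v ∈ shifts F p d, ∀ P : F[X], Irreducible P → resTrace p P v = resTrace p P f := by
  choose! v hv h using fun j (hj : j < d) => exists_shift_monomial p (F := F) j hj (f.coeff j)
  refine ⟨∑ j ∈ Finset.range d, v j,
    sum_mem fun j hj => hv j (Finset.mem_range.1 hj), fun P hP => ?_⟩
  by_cases h0 : f = 0
  · rw [map_sum, Finset.sum_congr rfl fun j hj => h j (Finset.mem_range.1 hj) P hP]
    simp [h0]
  · conv_rhs => rw [f.as_sum_range' d (by rwa [natDegree_lt_iff_degree_lt h0])]
    rw [map_sum, map_sum]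
    exact Finset.sum_congr rfl fun j hj => h j (Finset.mem_range.1 hj) P hP

/-- The Chinese remainder theorem gives a solution modulo the product of the places. Its remainder
has degree below the total degree, hence below `d`, and can then be moved into `shifts`. -/
theorem exists_shift_resTrace_eq {d : ℕ} (Q : Finset F[X])
    (hQ : ∀ P ∈ Q, P.Monic ∧ Irreducible P) (hd : ∑ P ∈ Q, P.natDegree ≤ d) (w : F[X] → ZMod p) :
    ∃ v ∈ shifts F p d, ∀ P ∈ Q, resTrace p P v = w P := by
  choose! g hg using fun P (hP : P ∈ Q) => resTrace_surjective p (hQ P hP).2 (w P)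
  obtain ⟨r, hr⟩ := Ideal.exists_forall_sub_mem_ideal
    (I := fun P : Q => Ideal.span {P.1}) (by
      rintro ⟨P, hP⟩ ⟨P', hP'⟩ hne
      rw [Function.onFun, Ideal.isCoprime_span_singleton_iff]
      refine (Irreducible.coprime_iff_not_dvd (hQ P hP).2).2 fun hdvd => hne (Subtype.ext ?_)
      exact eq_of_monic_of_associated (hQ P hP).1 (hQ P' hP').1
        ((hQ P hP).2.associated_of_dvd (hQ P' hP').2 hdvd)) (fun P => g P.1)
  have key (P : F[X]) (f f' : F[X]) (h : P ∣ f - f') : resTrace p P f = resTrace p P f' := by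
    let := ZMod.algebra F p
    rw [resTrace_apply, resTrace_apply, AdjoinRoot.mk_eq_mk.2 h]
  have hM : (∏ P ∈ Q, P).Monic := monic_prod_of_monic _ _ fun P hP => (hQ P hP).1
  have hdeg : (r %ₘ ∏ P ∈ Q, P).degree < d := by
    refine (degree_modByMonic_lt r hM).trans_le ?_
    rw [degree_eq_natDegree hM.ne_zero, natDegree_prod_of_monic _ _ fun P hP => (hQ P hP).1]
    exact_mod_cast hd
  obtain ⟨v, hv, h⟩ := exists_shift_of_degree_lt p hdeg
  refine ⟨v, hv, fun P hP => ?_⟩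
  rw [h P (hQ P hP).2, ← hg P hP]
  refine key P _ _ ?_
  rw [modByMonic_eq_sub_mul_div]
  have h1 : P ∣ r - g P := Ideal.mem_span_singleton.1 (hr ⟨P, hP⟩)
  have h2 : P ∣ ∏ P ∈ Q, P := Finset.dvd_prod_of_mem (fun P => P) hP
  have : r - (∏ P ∈ Q, P) * (r /ₘ ∏ P ∈ Q, P) - g P =
    (r - g P) - (∏ P ∈ Q, P) * (r /ₘ ∏ P ∈ Q, P) := by ring
  rw [this]
  exact dvd_sub h1 (h2.mul_right _)

open Classical in
/-- Averages over the family of products of few functions of residue traces may be computed as if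
the residue traces at different places were independent and uniformly distributed. -/
theorem average_prod_sum_places {ι : Type*} [Fintype ι] {K d : ℕ} (hd : ¬ p ∣ d)
    (hK : Fintype.card ι * K ≤ d) (Φ : ι → places F K → ZMod p → ℂ) :
    average p F d (fun f => ∏ i, ∑ P, Φ i P (resTrace p P.1 f)) =
      𝔼 ω : places F K → ZMod p, ∏ i, ∑ P, Φ i P (ω P) := by
  unfold average
  simp only [Finset.prod_univ_sum]
  rw [Finset.sum_comm, Finset.sum_div, Finset.expect_sum_comm]
  refine Finset.sum_congr rfl fun g _ => ?_
  -- A term of the expanded product chooses a place for each index. Choices may coincide, so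
  -- independence is needed only for the distinct places in the image, whose total degree is at most
  -- `card ι * K`.
  let Q : Finset (places F K) := Finset.univ.image g
  have hgQ (i : ι) : g i ∈ Q := Finset.mem_image_of_mem g (Finset.mem_univ i)
  let Ψ : (Q → ZMod p) → ℂ := fun η => ∏ i, Φ i (g i) (η ⟨g i, hgQ i⟩)
  let T : F[X] →+ (Q → ZMod p) := AddMonoidHom.mk' (fun f P => resTrace p P.1.1 f)
    fun f f' => by ext; simp
  let R : (places F K → ZMod p) →+ (Q → ZMod p) := AddMonoidHom.mk' (fun ω P => ω P.1)
    fun f f' => by ext; simp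
  have h1 := expect_comp_eq_of_translate (family p F d) (family_nonempty p hd) T (by
    intro w
    obtain ⟨v, hv, h⟩ := exists_shift_resTrace_eq p (d := d) (Q.map (Function.Embedding.subtype _))
      (fun P hP => by
        obtain ⟨P', _, rfl⟩ := Finset.mem_map.1 hP
        have := mem_places.1 P'.2
        exact ⟨this.1, this.2.1⟩)
      (by
        rw [Finset.sum_map]
        refine (Finset.sum_le_card_nsmul _ _ K fun P _ => (mem_places.1 P.2).2.2).trans ?_
        refine le_trans ?_ hK
        rw [smul_eq_mul]
        exact Nat.mul_le_mul_right K Finset.card_image_le)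
      (fun P => if hP : ∃ h : P ∈ places F K, (⟨P, h⟩ : places F K) ∈ Q
        then w ⟨⟨P, hP.1⟩, hP.2⟩ else 0)
    refine ⟨v, ?_, fun f hf => add_mem_family p hf hv, fun f hf => ?_⟩
    · ext P
      have := h P.1.1 (Finset.mem_map_of_mem _ P.2)
      rw [dif_pos ⟨P.1.2, P.2⟩] at this
      exact this
    · rw [sub_eq_add_neg]
      exact add_mem_family p hf (neg_mem hv)) Ψ
  -- The family and the full product space push forward to the same uniform distribution on `Q →
  -- ZMod p`.
  have h2 := expect_comp_eq_of_translate Finset.univ Finset.univ_nonempty R (by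
    intro w
    refine ⟨fun P => if hP : P ∈ Q then w ⟨P, hP⟩ else 0, ?_, by simp, by simp⟩
    ext P
    simp [R]) Ψ
  rw [Finset.card_univ, ← Fintype.expect_eq_sum_div_card] at h2
  exact h1.trans h2.symm

end Equidistribution

/-! ### Counting matchings -/

section Matchings

variable {ι : Type*} [Fintype ι] [DecidableEq ι] (good : Finset ι → Prop)

open Classical in
/-- The perfect matchings of `A` by two-element sets satisfying the predicate `good`. -/
def matchings (A : Finset ι) : Finset (Finset (Finset ι)) :=
  {M | (∀ B ∈ M, B.card = 2 ∧ good B) ∧ (M : Set (Finset ι)).PairwiseDisjoint id ∧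
    M.biUnion id = A}

variable {good}

theorem mem_matchings {A : Finset ι} {M : Finset (Finset ι)} :
    M ∈ matchings good A ↔ (∀ B ∈ M, B.card = 2 ∧ good B) ∧
      (M : Set (Finset ι)).PairwiseDisjoint id ∧ M.biUnion id = A := by
  simp [matchings]

theorem card_eq_of_mem_matchings {A : Finset ι} {M : Finset (Finset ι)}
    (h : M ∈ matchings good A) : A.card = 2 * M.card := by
  obtain ⟨h1, h2, rfl⟩ := mem_matchings.1 h
  rw [Finset.card_biUnion h2, Finset.sum_congr rfl (f := fun B => (id B).card) (g := fun _ => 2)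
    fun B hB => (h1 B hB).1,
    Finset.sum_const,
    smul_eq_mul, mul_comm]

theorem card_matchings_of_odd {A : Finset ι} (h : A.card % 2 = 1) :
    (matchings good A).card = 0 := by
  rw [Finset.card_eq_zero, Finset.eq_empty_iff_forall_notMem]
  intro M hM
  have := card_eq_of_mem_matchings hM
  omega

theorem card_matchings_le (A : Finset ι) :
    (matchings good A).card ≤ Fintype.card (Finset (Finset ι)) :=
  Finset.card_le_univ _

theorem card_matchings_empty : (matchings good ∅).card = 1 := by
  rw [Finset.card_eq_one]
  refine ⟨∅, Finset.ext fun M => ?_⟩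
  rw [Finset.mem_singleton]
  constructor
  · intro h
    have := card_eq_of_mem_matchings h
    rw [← Finset.card_eq_zero]
    simpa using this
  · rintro rfl
    exact mem_matchings.2 ⟨by simp, by simp, by simp⟩

/-- Classify the matchings by the partner `j` of `i` and remove that pair. The same recursion drives
the moments below. -/
theorem card_matchings_insert [DecidablePred good] {i : ι} {A : Finset ι} (hi : i ∉ A) :
    (matchings good (insert i A)).card =
      ∑ j ∈ A, if good {i, j} then (matchings good (A.erase j)).card else 0 := by
  have key : matchings good (insert i A) = (A.filter fun j => good {i, j}).biUnion
      fun j => (matchings good (A.erase j)).image (insert {i, j}) := by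
    ext M
    simp only [Finset.mem_biUnion, Finset.mem_filter, Finset.mem_image]
    constructor
    · intro hM
      obtain ⟨h1, h2, h3⟩ := mem_matchings.1 hM
      have : i ∈ M.biUnion id := by rw [h3]; exact Finset.mem_insert_self _ _
      obtain ⟨B, hB, hiB⟩ := Finset.mem_biUnion.1 this
      rw [id] at hiB
      obtain ⟨j, hij, rfl⟩ : ∃ j, i ≠ j ∧ B = {i, j} := by
        obtain ⟨x, y, hxy, rfl⟩ := Finset.card_eq_two.1 (h1 B hB).1
        rcases Finset.mem_insert.1 hiB with rfl | h
        · exact ⟨y, hxy, rfl⟩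
        · rw [Finset.mem_singleton] at h
          subst h
          exact ⟨x, hxy.symm, Finset.pair_comm _ _⟩
      have hj : j ∈ A := by
        have : j ∈ M.biUnion id := Finset.mem_biUnion.2 ⟨_, hB, by simp⟩
        rw [h3, Finset.mem_insert] at this
        exact this.resolve_left hij.symm
      refine ⟨j, ⟨hj, (h1 _ hB).2⟩, M.erase {i, j}, mem_matchings.2 ⟨?_, ?_, ?_⟩,
        Finset.insert_erase hB⟩
      · exact fun B' hB' => h1 B' (Finset.mem_of_mem_erase hB')
      · exact h2.subset (by simp)
      · ext x
        simp only [Finset.mem_biUnion, Finset.mem_erase, id]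
        constructor
        · rintro ⟨B', ⟨hne, hB'⟩, hx⟩
          have hd := Finset.disjoint_left.1 (h2 hB' hB hne) hx
          simp only [id, Finset.mem_insert, Finset.mem_singleton, not_or] at hd
          have : x ∈ M.biUnion id := Finset.mem_biUnion.2 ⟨B', hB', hx⟩
          rw [h3, Finset.mem_insert] at this
          exact ⟨hd.2, this.resolve_left hd.1⟩
        · rintro ⟨hxj, hx⟩
          have : x ∈ M.biUnion id := by rw [h3]; exact Finset.mem_insert_of_mem hx
          obtain ⟨B', hB', hxB'⟩ := Finset.mem_biUnion.1 this
          refine ⟨B', ⟨?_, hB'⟩, hxB'⟩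
          rintro rfl
          simp only [id, Finset.mem_insert, Finset.mem_singleton] at hxB'
          rcases hxB' with rfl | rfl
          · exact hi hx
          · exact hxj rfl
    · rintro ⟨j, ⟨hj, hgood⟩, M, hM, rfl⟩
      obtain ⟨h1, h2, h3⟩ := mem_matchings.1 hM
      have hij : i ≠ j := by rintro rfl; exact hi hj
      refine mem_matchings.2 ⟨?_, ?_, ?_⟩
      · intro B hB
        rcases Finset.mem_insert.1 hB with rfl | hB
        · exact ⟨Finset.card_pair hij, hgood⟩
        · exact h1 B hB
      · rw [Finset.coe_insert, Set.pairwiseDisjoint_insert]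
        refine ⟨h2, fun B hB _ => ?_⟩
        have hsub : B ⊆ A.erase j := by
          rw [← h3]
          exact Finset.subset_biUnion_of_mem id hB
        rw [Finset.disjoint_left]
        intro x hx hxB
        have hxA := Finset.mem_erase.1 (hsub hxB)
        simp only [id, Finset.mem_insert, Finset.mem_singleton] at hx
        rcases hx with rfl | rfl
        · exact hi hxA.2
        · exact hxA.1 rfl
      · rw [Finset.biUnion_insert, h3, id, Finset.insert_union, Finset.singleton_union,
          Finset.insert_erase hj]
  have hnot (j j' : ι) (M : Finset (Finset ι)) (hM : M ∈ matchings good (A.erase j')) :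
      ({i, j} : Finset ι) ∉ M := by
    intro h
    have : i ∈ M.biUnion id := Finset.mem_biUnion.2 ⟨_, h, by simp⟩
    rw [(mem_matchings.1 hM).2.2] at this
    exact hi (Finset.mem_of_mem_erase this)
  rw [key, Finset.card_biUnion, Finset.sum_filter]
  · refine Finset.sum_congr rfl fun j _ => ?_
    split_ifs
    · refine Finset.card_image_of_injOn fun M hM M' hM' h => ?_
      rw [← Finset.erase_insert (hnot j j M hM), ← Finset.erase_insert (hnot j j M' hM')]
      exact congrArg (fun S => S.erase {i, j}) h
    · rfl
  · intro j hj j' hj' hne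
    rw [Function.onFun, Finset.disjoint_left]
    intro M hM hM'
    obtain ⟨M1, hM1, rfl⟩ := Finset.mem_image.1 hM
    obtain ⟨M2, hM2, h⟩ := Finset.mem_image.1 hM'
    have h1 : ({i, j} : Finset ι) ∈ insert {i, j'} M2 := by
      rw [h]; exact Finset.mem_insert_self _ _
    rcases Finset.mem_insert.1 h1 with h2 | h2
    · have h3 : j ∈ ({i, j'} : Finset ι) := by rw [← h2]; simp
      simp only [Finset.mem_insert, Finset.mem_singleton] at h3
      rcases h3 with rfl | rfl
      · exact hi (Finset.mem_filter.1 hj).1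
      · exact hne rfl
    · exact hnot j j' M2 hM2 h2

open Classical in
/-- Matchings missing at most one index are perfect matchings of everything or of everything but
one index. -/
theorem card_maximal_matchings [Nonempty ι] :
    (Finset.univ.filter fun M : Finset (Finset ι) => M.card = Fintype.card ι / 2 ∧
      (M : Set (Finset ι)).PairwiseDisjoint id ∧ ∀ B ∈ M, B.card = 2 ∧ good B).card =
    (matchings good Finset.univ).card + ∑ i, (matchings good (Finset.univ.erase i)).card := by
  have hpos : 0 < Fintype.card ι := Fintype.card_pos
  have hcard (M : Finset (Finset ι)) (h1 : ∀ B ∈ M, B.card = 2 ∧ good B)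
      (h2 : (M : Set (Finset ι)).PairwiseDisjoint id) : (M.biUnion id).card = 2 * M.card :=
    card_eq_of_mem_matchings (mem_matchings.2 ⟨h1, h2, rfl⟩)
  have hcE (i : ι) : (Finset.univ.erase i).card = Fintype.card ι - 1 := by
    rw [Finset.card_erase_of_mem (Finset.mem_univ i), Finset.card_univ]
  -- Parity decides which summand survives: `⌊card/2⌋` disjoint pairs cover everything for even
  -- cardinality and miss exactly one index for odd cardinality.
  rcases Nat.even_or_odd' (Fintype.card ι) with ⟨l, hl | hl⟩
  · rw [Finset.sum_eq_zero fun i _ => card_matchings_of_odd (by rw [hcE]; omega), add_zero]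
    congr 1
    ext M
    rw [mem_matchings, Finset.mem_filter]
    constructor
    · rintro ⟨-, h1, h2, h3⟩
      refine ⟨h3, h2, Finset.eq_univ_of_card _ ?_⟩
      rw [hcard M h3 h2]; omega
    · rintro ⟨h3, h2, h1⟩
      refine ⟨Finset.mem_univ _, ?_, h2, h3⟩
      have := hcard M h3 h2
      rw [h1, Finset.card_univ] at this
      omega
  · rw [card_matchings_of_odd (by rw [Finset.card_univ]; omega), zero_add,
      ← Finset.card_biUnion]
    · congr 1
      ext M
      rw [Finset.mem_biUnion, Finset.mem_filter]
      constructor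
      · rintro ⟨-, h1, h2, h3⟩
        have h4 := hcard M h3 h2
        have h5 : (M.biUnion id)ᶜ.card = 1 := by rw [Finset.card_compl]; omega
        obtain ⟨i, hi⟩ := Finset.card_eq_one.1 h5
        refine ⟨i, Finset.mem_univ i, mem_matchings.2 ⟨h3, h2, ?_⟩⟩
        rw [← compl_compl (M.biUnion id), hi]
        ext; simp
      · rintro ⟨i, -, hM⟩
        have h := card_eq_of_mem_matchings hM
        obtain ⟨h3, h2, h1⟩ := mem_matchings.1 hM
        rw [hcE] at h
        exact ⟨Finset.mem_univ _, by omega, h2, h3⟩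
    · intro i _ j _ hne
      rw [Function.onFun, Finset.disjoint_left]
      intro M hM hM'
      have h1 := (mem_matchings.1 hM).2.2
      rw [(mem_matchings.1 hM').2.2] at h1
      have : i ∈ Finset.univ.erase j := Finset.mem_erase.2 ⟨hne, Finset.mem_univ i⟩
      rw [h1] at this
      exact Finset.notMem_erase _ _ this

end Matchings

/-! ### Mixed moments of sums of independent variables -/

section Moments

variable {π T ι : Type*} [Fintype π] [DecidableEq π] [Fintype T] [Nonempty T] [DecidableEq ι]

/-- Independence of the coordinate `P` from the others, proved by the involution exchanging `ω P`
with a fresh sample `t`. -/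
theorem expect_mul_of_update_eq (P : π) (u : T → ℂ) (v : (π → T) → ℂ)
    (hv : ∀ ω t, v (Function.update ω P t) = v ω) :
    𝔼 ω : π → T, u (ω P) * v ω = (𝔼 t, u t) * 𝔼 ω, v ω := by
  have h : ∑ x : (π → T) × T, u (x.1 P) * v x.1 = ∑ x : (π → T) × T, u x.2 * v x.1 := by
    refine Finset.sum_nbij' (fun x => (Function.update x.1 P x.2, x.1 P))
      (fun x => (Function.update x.1 P x.2, x.1 P)) ?_ ?_ ?_ ?_ ?_ <;> simp [hv]
  rw [Fintype.sum_prod_type, Fintype.sum_prod_type] at h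
  simp only [Finset.sum_const, Finset.card_univ, nsmul_eq_mul, ← Finset.sum_mul] at h
  rw [← Finset.mul_sum, ← Finset.mul_sum] at h
  have hT : (Fintype.card T : ℂ) ≠ 0 := by exact_mod_cast Fintype.card_ne_zero
  rw [Fintype.expect_eq_sum_div_card, Fintype.expect_eq_sum_div_card,
    Fintype.expect_eq_sum_div_card, div_mul_div_comm, ← h, mul_div_mul_left _ _ hT]

/-- The mixed moment of the sums over `Q` of the random variables `Z P i`, where the variables
with different `P` are independent. -/
def sumMoment (Z : π → ι → T → ℂ) (A : Finset ι) (Q : Finset π) : ℂ :=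
  𝔼 ω : π → T, ∏ i ∈ A, ∑ P ∈ Q, Z P i (ω P)

/-- The mixed moment of the random variables `Z P i` for a fixed `P`. -/
def localMoment (Z : π → ι → T → ℂ) (P : π) (B : Finset ι) : ℂ :=
  𝔼 t : T, ∏ i ∈ B, Z P i t

/-- Let `P` be the place chosen by the factor `i` and `B` the set of other indices that choose the
same `P`. The remaining factors avoid `P`, so the expectation factors. -/
theorem sumMoment_insert (Z : π → ι → T → ℂ) {i : ι} {A : Finset ι} (hi : i ∉ A)
    (Q : Finset π) : sumMoment Z (insert i A) Q = ∑ B ∈ A.powerset, ∑ P ∈ Q,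
      localMoment Z P (insert i B) * sumMoment Z (A \ B) (Q.erase P) := by
  have h (ω : π → T) : ∏ j ∈ insert i A, ∑ P ∈ Q, Z P j (ω P) = ∑ B ∈ A.powerset, ∑ P ∈ Q,
      (∏ j ∈ insert i B, Z P j (ω P)) * ∏ j ∈ A \ B, ∑ P' ∈ Q.erase P, Z P' j (ω P') := by
    rw [Finset.prod_insert hi, Finset.sum_mul, Finset.sum_comm]
    refine Finset.sum_congr rfl fun P hP => ?_
    rw [Finset.prod_congr rfl fun j _ => (Finset.add_sum_erase Q (fun P => Z P j (ω P)) hP).symm,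
      Finset.prod_add, Finset.mul_sum]
    refine Finset.sum_congr rfl fun B hB => ?_
    rw [Finset.prod_insert fun hiB => hi (Finset.mem_powerset.1 hB hiB), mul_assoc]
  unfold sumMoment localMoment
  simp only [h]
  rw [Finset.expect_sum_comm]
  refine Finset.sum_congr rfl fun B _ => ?_
  rw [Finset.expect_sum_comm]
  refine Finset.sum_congr rfl fun P _ => ?_
  refine expect_mul_of_update_eq P (fun t => ∏ j ∈ insert i B, Z P j t)
    (fun ω => ∏ j ∈ A \ B, ∑ P' ∈ Q.erase P, Z P' j (ω P')) fun ω t => ?_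
  refine Finset.prod_congr rfl fun j _ => Finset.sum_congr rfl fun P' hP' => ?_
  rw [Function.update_of_ne (Finset.ne_of_mem_erase hP')]

theorem norm_expect_le {f : T → ℂ} {r : ℝ} (h : ∀ t, ‖f t‖ ≤ r) : ‖𝔼 t, f t‖ ≤ r := by
  have hT : (0 : ℝ) < Fintype.card T := by exact_mod_cast Fintype.card_pos
  rw [Fintype.expect_eq_sum_div_card, norm_div, Complex.norm_natCast, div_le_iff₀ hT]
  refine (norm_sum_le_of_le _ fun t _ => h t).trans ?_
  rw [Finset.sum_const, nsmul_eq_mul, Finset.card_univ, mul_comm]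

omit [Fintype π] [DecidableEq π] [DecidableEq ι] in
theorem norm_localMoment_le {Z : π → ι → T → ℂ} {u : π → ℝ} (h : ∀ P i t, ‖Z P i t‖ ≤ u P)
    (P : π) (B : Finset ι) : ‖localMoment Z P B‖ ≤ u P ^ B.card := by
  refine norm_expect_le fun t => ?_
  rw [norm_prod, ← Finset.prod_const]
  exact Finset.prod_le_prod (fun _ _ => norm_nonneg _) fun i _ => h P i t

/-- Quantitative hypotheses under which the mixed moments of sums of centred independent random
variables are governed by their covariances. -/
structure CenteredFamily [Fintype ι] (good : Finset ι → Prop) [DecidablePred good]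
    (Z : π → ι → T → ℂ) (u : π → ℝ) (c V Λ β : ℝ) : Prop where
  one_le_c : 1 ≤ c
  beta_pos : 0 < β
  beta_le : β ≤ 1
  one_le_lam : 1 ≤ Λ
  var_nonneg : 0 ≤ V
  var_le : V ≤ Λ
  centered : ∀ P i, 𝔼 t, Z P i t = 0
  norm_le : ∀ P i t, ‖Z P i t‖ ≤ u P
  u_nonneg : ∀ P, 0 ≤ u P
  u_le : ∀ P, u P ≤ c
  sum_sq_le : ∑ P, u P ^ 2 ≤ c * Λ
  sum_cube_le : ∑ P, u P ^ 3 ≤ c * β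
  covariance : ∀ i j, i ≠ j →
    ‖∑ P, localMoment Z P {i, j} - if good {i, j} then (V : ℂ) else 0‖ ≤ c

/-- The factor `β` for odd `A.card` costs nothing: a set of odd size has no perfect matching. -/
theorem matching_term_le [Fintype ι] {good : Finset ι → Prop} [DecidablePred good] {V Λ β : ℝ}
    (hβ : 0 < β) (hV : 0 ≤ V) (hVΛ : V ≤ Λ) (A : Finset ι) :
    ((matchings good A).card : ℝ) * V ^ (A.card / 2) ≤
      Fintype.card (Finset (Finset ι)) * (β ^ (A.card % 2) * Λ ^ (A.card / 2)) := by
  rcases Nat.mod_two_eq_zero_or_one A.card with h | h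
  · rw [h, pow_zero, one_mul]
    have h1 : ((matchings good A).card : ℝ) ≤ Fintype.card (Finset (Finset ι)) := by
      exact_mod_cast card_matchings_le A
    gcongr
  · rw [card_matchings_of_odd h, Nat.cast_zero, zero_mul]
    have : 0 ≤ Λ := hV.trans hVΛ
    positivity

theorem norm_matching_term_le [Fintype ι] {good : Finset ι → Prop} [DecidablePred good]
    {V Λ β : ℝ} (hβ : 0 < β) (hV : 0 ≤ V) (hVΛ : V ≤ Λ) (A : Finset ι) :
    ‖((matchings good A).card : ℂ) * (V : ℂ) ^ (A.card / 2)‖ ≤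
      Fintype.card (Finset (Finset ι)) * (β ^ (A.card % 2) * Λ ^ (A.card / 2)) := by
  refine le_trans (le_of_eq ?_) (matching_term_le (good := good) hβ hV hVΛ A)
  rw [norm_mul, norm_pow, Complex.norm_natCast, Complex.norm_real, Real.norm_of_nonneg hV]

/-- A single spare factor `β` pays for either parity. -/
theorem beta_mul_pow_le {β : ℝ} (h0 : 0 < β) (h1 : β ≤ 1) (a b : ℕ) :
    β * β ^ a ≤ β ^ (b % 2) := by
  have h2 : β * β ^ a ≤ β := mul_le_of_le_one_right h0.le (pow_le_one₀ h0.le h1)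
  rcases Nat.mod_two_eq_zero_or_one b with h | h
  · rw [h, pow_zero]; exact h2.trans h1
  · rw [h, pow_one]; exact h2

theorem pow_le_pow_div {Λ : ℝ} (hΛ : 1 ≤ Λ) {a b : ℕ} (h : a + 1 ≤ b) : Λ ^ a ≤ Λ ^ b / Λ := by
  rw [le_div_iff₀ (by linarith), ← pow_succ]
  exact pow_le_pow_right₀ hΛ h

end Moments

/-! ### One step of the moment recursion, by size of the block containing `i` -/

section MomentBounds

variable {π T ι : Type*} [Fintype π] [DecidableEq π] [Fintype T] [Nonempty T]
  [Fintype ι] [DecidableEq ι] {good : Finset ι → Prop} [DecidablePred good]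
  {Z : π → ι → T → ℂ} {u : π → ℝ} {c V Λ β : ℝ}

/-- The contribution of a block `insert i B` to the main term of the moment over `insert i A`. -/
def blockTerm (good : Finset ι → Prop) [DecidablePred good] (V : ℝ) (i : ι) (A B : Finset ι) : ℂ :=
  if B.card = 1 then (if good (insert i B) then
    ((matchings good (A \ B)).card : ℂ) * (V : ℂ) ^ ((A.card + 1) / 2) else 0) else 0

theorem sum_blockTerm {i : ι} {A : Finset ι} (hi : i ∉ A) :
    ∑ B ∈ A.powerset, blockTerm good V i A B =
      ((matchings good (insert i A)).card : ℂ) * (V : ℂ) ^ ((insert i A).card / 2) := by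
  unfold blockTerm
  rw [← Finset.sum_filter, ← Finset.powersetCard_eq_filter, Finset.powersetCard_one,
    Finset.sum_map, card_matchings_insert hi, Finset.card_insert_of_notMem hi, Nat.cast_sum,
    Finset.sum_mul]
  refine Finset.sum_congr rfl fun j _ => ?_
  simp only [Function.Embedding.coeFn_mk, Finset.sdiff_singleton_eq_erase]
  split_ifs <;> simp

omit [Nonempty T] in
theorem norm_sumMoment_le (h : CenteredFamily good Z u c V Λ β) {C : ℝ} (hC : 0 ≤ C)
    {A : Finset ι} {Q : Finset π}
    (hA : ‖sumMoment Z A Q - ((matchings good A).card : ℂ) * (V : ℂ) ^ (A.card / 2)‖ ≤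
      C * (β ^ (A.card % 2) * (Λ ^ (A.card / 2) / Λ))) :
    ‖sumMoment Z A Q‖ ≤
      (Fintype.card (Finset (Finset ι)) + C) * (β ^ (A.card % 2) * Λ ^ (A.card / 2)) := by
  have h1 := norm_matching_term_le (good := good) h.beta_pos h.var_nonneg h.var_le A
  have hΛ := h.one_le_lam
  have hβ := h.beta_pos
  have h2 : C * (β ^ (A.card % 2) * (Λ ^ (A.card / 2) / Λ)) ≤
      C * (β ^ (A.card % 2) * Λ ^ (A.card / 2)) := by
    gcongr
    exact div_le_self (by positivity) hΛ
  have h3 := norm_le_norm_sub_add (sumMoment Z A Q)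
    (((matchings good A).card : ℂ) * (V : ℂ) ^ (A.card / 2))
  linarith

/-- For the pair `{i, j}`, replace the moment of the remaining indices by its main term `H`. The
replacement costs the variance sum, at most `c * Λ`, times an error already smaller by `Λ`. The
local covariances then sum to `V` or 0 up to `c`, apart from the at most `r` removed places, each
worth at most `c ^ 2`. -/
theorem norm_block_singleton_le (h : CenteredFamily good Z u c V Λ β) {k r : ℕ} {C : ℝ}
    (hC : 0 ≤ C)
    (ih : ∀ (A : Finset ι) (R : Finset π), A.card ≤ k → R.card ≤ r + 1 →
      ‖sumMoment Z A (Finset.univ \ R) -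
        ((matchings good A).card : ℂ) * (V : ℂ) ^ (A.card / 2)‖ ≤
      C * (β ^ (A.card % 2) * (Λ ^ (A.card / 2) / Λ)))
    {i j : ι} {A : Finset ι} (hi : i ∉ A) (hA : A.card ≤ k) (hj : j ∈ A)
    (R : Finset π) (hR : R.card ≤ r) :
    ‖∑ P ∈ Finset.univ \ R, localMoment Z P {i, j} *
        sumMoment Z (A.erase j) ((Finset.univ \ R).erase P) - blockTerm good V i A {j}‖ ≤
      (c * C + Fintype.card (Finset (Finset ι)) * (c + r * c ^ 2)) *
        (β ^ ((A.card + 1) % 2) * (Λ ^ ((A.card + 1) / 2) / Λ)) := by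
  have hΛ := h.one_le_lam
  have hβ := h.beta_pos
  have hc := h.one_le_c
  have hij : i ≠ j := by rintro rfl; exact hi hj
  set a := A.card with ha
  have ha1 : 1 ≤ a := Finset.card_pos.2 ⟨j, hj⟩
  have hcard : (A.erase j).card = a - 1 := Finset.card_erase_of_mem hj
  have hmod : (a - 1) % 2 = (a + 1) % 2 := by omega
  have hdiv : (a + 1) / 2 = (a - 1) / 2 + 1 := by omega
  have hscale : Λ ^ ((a + 1) / 2) / Λ = Λ ^ ((a - 1) / 2) := by
    rw [hdiv, pow_succ, mul_div_cancel_right₀ _ (by linarith)]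
  have hu : ∀ P, ‖localMoment Z P {i, j}‖ ≤ u P ^ 2 := fun P => by
    have := norm_localMoment_le h.norm_le P {i, j}
    rwa [Finset.card_pair hij] at this
  set H : ℂ := ((matchings good (A.erase j)).card : ℂ) * (V : ℂ) ^ ((a - 1) / 2) with hH
  have hHle : ‖H‖ ≤ Fintype.card (Finset (Finset ι)) *
      (β ^ ((a + 1) % 2) * Λ ^ ((a - 1) / 2)) := by
    have := norm_matching_term_le (good := good) hβ h.var_nonneg h.var_le (A.erase j)
    rwa [hcard, hmod] at this
  have hblock : blockTerm good V i A {j} = H * (if good {i, j} then (V : ℂ) else 0) := by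
    unfold blockTerm
    rw [if_pos (Finset.card_singleton j), Finset.sdiff_singleton_eq_erase, ← ha, hdiv, hH]
    simp only [pow_succ, mul_ite, mul_zero, mul_assoc]
  have hsplit : ∑ P ∈ Finset.univ \ R, localMoment Z P {i, j} *
      sumMoment Z (A.erase j) ((Finset.univ \ R).erase P) - blockTerm good V i A {j} =
      ∑ P ∈ Finset.univ \ R, localMoment Z P {i, j} *
        (sumMoment Z (A.erase j) ((Finset.univ \ R).erase P) - H) +
      H * ((∑ P, localMoment Z P {i, j} - if good {i, j} then (V : ℂ) else 0) -
        ∑ P ∈ R, localMoment Z P {i, j}) := by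
    rw [hblock, ← Finset.sum_sdiff (Finset.subset_univ R)]
    simp only [mul_sub, Finset.sum_sub_distrib, ← Finset.sum_mul]
    ring
  have h1 : ‖∑ P ∈ Finset.univ \ R, localMoment Z P {i, j} *
      (sumMoment Z (A.erase j) ((Finset.univ \ R).erase P) - H)‖ ≤
      (c * Λ) * (C * (β ^ ((a + 1) % 2) * (Λ ^ ((a - 1) / 2) / Λ))) := by
    refine (norm_sum_le_of_le (f := _) (n := fun P => u P ^ 2 *
      (C * (β ^ ((a + 1) % 2) * (Λ ^ ((a - 1) / 2) / Λ)))) _ fun P _ => ?_).trans ?_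
    · rw [norm_mul]
      -- Using the place `P` removes it from the remaining moment, so the induction hypothesis must
      -- allow `r + 1` missing places.
      have := ih (A.erase j) (insert P R) (by omega)
        ((Finset.card_insert_le _ _).trans (by omega))
      rw [hcard, hmod, ← hH, Finset.sdiff_insert] at this
      exact mul_le_mul (hu P) this (norm_nonneg _) (sq_nonneg _)
    · rw [← Finset.sum_mul]
      refine mul_le_mul_of_nonneg_right ?_ (by positivity)
      exact (Finset.sum_le_univ_sum_of_nonneg fun P => sq_nonneg _).trans h.sum_sq_le
  have h2 : ‖∑ P ∈ R, localMoment Z P {i, j}‖ ≤ r * c ^ 2 := by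
    refine (norm_sum_le_of_le (f := _) (n := fun _ => c ^ 2) _ fun P _ => ?_).trans ?_
    · exact (hu P).trans (pow_le_pow_left₀ (h.u_nonneg P) (h.u_le P) 2)
    · rw [Finset.sum_const, nsmul_eq_mul]
      gcongr
  have h3 := norm_sub_le (∑ P, localMoment Z P {i, j} - if good {i, j} then (V : ℂ) else 0)
    (∑ P ∈ R, localMoment Z P {i, j})
  have h4 := h.covariance i j hij
  rw [hsplit, hscale]
  refine (norm_add_le _ _).trans ?_
  rw [norm_mul]
  have h5 := mul_le_mul hHle (h3.trans (add_le_add h4 h2)) (norm_nonneg _) (by positivity)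
  have h6 : (c * Λ) * (C * (β ^ ((a + 1) % 2) * (Λ ^ ((a - 1) / 2) / Λ))) =
      c * C * (β ^ ((a + 1) % 2) * Λ ^ ((a - 1) / 2)) := by
    field_simp
  rw [h6] at h1
  calc _ ≤ _ := add_le_add h1 h5
    _ = _ := by ring

/-- A block of at least three indices is summable over places by the cube bound, which gives a
factor `β`. It uses up three indices and so leaves at least one power of `Λ` fewer; the factor `β`
covers any change of parity. -/
theorem norm_block_large_le (h : CenteredFamily good Z u c V Λ β) {k r : ℕ} {C : ℝ}
    (hC : 0 ≤ C)
    (ih : ∀ (A : Finset ι) (R : Finset π), A.card ≤ k → R.card ≤ r + 1 →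
      ‖sumMoment Z A (Finset.univ \ R) -
        ((matchings good A).card : ℂ) * (V : ℂ) ^ (A.card / 2)‖ ≤
      C * (β ^ (A.card % 2) * (Λ ^ (A.card / 2) / Λ)))
    {i : ι} {A B : Finset ι} (hi : i ∉ A) (hA : A.card ≤ k) (hB : B ⊆ A) (hB2 : 2 ≤ B.card)
    (R : Finset π) (hR : R.card ≤ r) :
    ‖∑ P ∈ Finset.univ \ R, localMoment Z P (insert i B) *
        sumMoment Z (A \ B) ((Finset.univ \ R).erase P)‖ ≤
      (c ^ (Fintype.card ι + 1) * (Fintype.card (Finset (Finset ι)) + C)) *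
        (β ^ ((A.card + 1) % 2) * (Λ ^ ((A.card + 1) / 2) / Λ)) := by
  have hΛ := h.one_le_lam
  have hβ := h.beta_pos
  have hc := h.one_le_c
  set N : ℝ := (Fintype.card (Finset (Finset ι)) : ℝ) with hN
  have hN0 : 0 ≤ N := Nat.cast_nonneg _
  have hcardB : B.card ≤ A.card := Finset.card_le_card hB
  have hcard : (A \ B).card = A.card - B.card := Finset.card_sdiff_of_subset hB
  have hins : (insert i B).card = B.card + 1 :=
    Finset.card_insert_of_notMem fun hiB => hi (hB hiB)
  have hBι : B.card ≤ Fintype.card ι := Finset.card_le_univ B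
  obtain ⟨b, hb⟩ := Nat.exists_eq_add_of_le hB2
  have h1 (P : π) : ‖localMoment Z P (insert i B)‖ ≤ c ^ b * u P ^ 3 := by
    refine (norm_localMoment_le h.norm_le P _).trans ?_
    rw [hins, show B.card + 1 = b + 3 by omega, pow_add]
    have := h.u_nonneg P
    have := h.u_le P
    gcongr
  have h2 (P : π) : ‖sumMoment Z (A \ B) ((Finset.univ \ R).erase P)‖ ≤
      (N + C) * (β ^ ((A.card - B.card) % 2) * Λ ^ ((A.card - B.card) / 2)) := by
    have := norm_sumMoment_le h hC (ih (A \ B) (insert P R) (by omega)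
        ((Finset.card_insert_le _ _).trans (by omega)))
    rwa [hcard, Finset.sdiff_insert] at this
  refine (norm_sum_le_of_le (f := _) (n := fun P => (c ^ b * u P ^ 3) *
      ((N + C) * (β ^ ((A.card - B.card) % 2) * Λ ^ ((A.card - B.card) / 2)))) _
      fun P _ => ?_).trans ?_
  · rw [norm_mul]
    have := h.u_nonneg P
    exact mul_le_mul (h1 P) (h2 P) (norm_nonneg _) (by positivity)
  rw [← Finset.sum_mul, ← Finset.mul_sum]
  have h3 : ∑ P ∈ Finset.univ \ R, u P ^ 3 ≤ c * β :=
    (Finset.sum_le_univ_sum_of_nonneg fun P => pow_nonneg (h.u_nonneg P) 3).trans h.sum_cube_le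
  have h4 : β * β ^ ((A.card - B.card) % 2) ≤ β ^ ((A.card + 1) % 2) :=
    beta_mul_pow_le hβ h.beta_le _ _
  have h5 : Λ ^ ((A.card - B.card) / 2) ≤ Λ ^ ((A.card + 1) / 2) / Λ :=
    pow_le_pow_div hΛ (by omega)
  have h6 : c ^ b * c ≤ c ^ (Fintype.card ι + 1) := by
    rw [← pow_succ]
    exact pow_le_pow_right₀ hc (by omega)
  calc _ ≤ (c ^ b * (c * β)) *
        ((N + C) * (β ^ ((A.card - B.card) % 2) * Λ ^ ((A.card - B.card) / 2))) := by gcongr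
    _ = (c ^ b * c) * (N + C) *
        ((β * β ^ ((A.card - B.card) % 2)) * Λ ^ ((A.card - B.card) / 2)) := by ring
    _ ≤ _ := by gcongr

theorem norm_sumMoment_insert_sub_le (h : CenteredFamily good Z u c V Λ β) {k r : ℕ} {C : ℝ}
    (hC : 0 ≤ C)
    (ih : ∀ (A : Finset ι) (R : Finset π), A.card ≤ k → R.card ≤ r + 1 →
      ‖sumMoment Z A (Finset.univ \ R) -
        ((matchings good A).card : ℂ) * (V : ℂ) ^ (A.card / 2)‖ ≤
      C * (β ^ (A.card % 2) * (Λ ^ (A.card / 2) / Λ)))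
    {i : ι} {A : Finset ι} (hi : i ∉ A) (hA : A.card ≤ k)
    (R : Finset π) (hR : R.card ≤ r) :
    ‖sumMoment Z (insert i A) (Finset.univ \ R) -
        ((matchings good (insert i A)).card : ℂ) * (V : ℂ) ^ ((insert i A).card / 2)‖ ≤
      (Fintype.card (Finset ι) * ((c * C + Fintype.card (Finset (Finset ι)) * (c + r * c ^ 2)) +
        c ^ (Fintype.card ι + 1) * (Fintype.card (Finset (Finset ι)) + C))) *
        (β ^ ((insert i A).card % 2) * (Λ ^ ((insert i A).card / 2) / Λ)) := by
  have hΛ := h.one_le_lam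
  have hβ := h.beta_pos
  have hc := h.one_le_c
  rw [sumMoment_insert Z hi, ← sum_blockTerm hi, ← Finset.sum_sub_distrib,
    Finset.card_insert_of_notMem hi]
  set E := β ^ ((A.card + 1) % 2) * (Λ ^ ((A.card + 1) / 2) / Λ) with hE
  have hE0 : 0 ≤ E := by positivity
  set D1 := c * C + Fintype.card (Finset (Finset ι)) * (c + r * c ^ 2) with hD1
  set D2 := c ^ (Fintype.card ι + 1) * (Fintype.card (Finset (Finset ι)) + C) with hD2
  have hD10 : 0 ≤ D1 := by positivity
  have hD20 : 0 ≤ D2 := by positivity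
  refine (norm_sum_le_of_le (f := _) (n := fun _ => (D1 + D2) * E) _ fun B hB => ?_).trans ?_
  -- The block `insert i B` vanishes by centring if `B` is empty, gives the main term if `B` is a
  -- singleton, and is an error term otherwise.
  · have hBA := Finset.mem_powerset.1 hB
    rcases Nat.lt_or_ge B.card 2 with h2 | h2
    · rcases Nat.lt_or_ge B.card 1 with h1 | h1
      · have hB0 : B = ∅ := Finset.card_eq_zero.1 (by omega)
        subst hB0
        have hz (P : π) : localMoment Z P (insert i ∅) = 0 := by
          simpa [localMoment] using h.centered P i
        simp only [hz, zero_mul, Finset.sum_const_zero, blockTerm, Finset.card_empty,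
          zero_ne_one, if_false, sub_zero, norm_zero]
        positivity
      · obtain ⟨j, rfl⟩ := Finset.card_eq_one.1 (show B.card = 1 by omega)
        rw [Finset.sdiff_singleton_eq_erase]
        refine (norm_block_singleton_le h hC ih hi hA (Finset.singleton_subset_iff.1 hBA)
          R hR).trans ?_
        exact mul_le_mul_of_nonneg_right (le_add_of_nonneg_right hD20) hE0
    · have hb0 : blockTerm good V i A B = 0 := if_neg (by omega)
      rw [hb0, sub_zero]
      refine (norm_block_large_le h hC ih hi hA hBA h2 R hR).trans ?_
      exact mul_le_mul_of_nonneg_right (le_add_of_nonneg_left hD10) hE0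
  · rw [Finset.sum_const, nsmul_eq_mul, ← mul_assoc]
    have : (A.powerset.card : ℝ) ≤ Fintype.card (Finset ι) := by
      exact_mod_cast Finset.card_le_univ _
    gcongr

end MomentBounds

-- Uniform asymptotics of the moments

universe v w

/-- The mixed moments of sums of centred independent variables, up to terms of lower order. -/
theorem exists_sumMoment_bound (ι : Type) [Fintype ι] [DecidableEq ι] (c : ℝ) (k r : ℕ) :
    ∃ C : ℝ, 0 ≤ C ∧ ∀ {π : Type v} {T : Type w} [Fintype π] [DecidableEq π] [Fintype T]
      [Nonempty T] (good : Finset ι → Prop) [DecidablePred good]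
      (Z : π → ι → T → ℂ) (u : π → ℝ) (V Λ β : ℝ),
      CenteredFamily good Z u c V Λ β → ∀ (A : Finset ι) (R : Finset π), A.card ≤ k → R.card ≤ r →
      ‖sumMoment Z A (Finset.univ \ R) -
        ((matchings good A).card : ℂ) * (V : ℂ) ^ (A.card / 2)‖ ≤
      C * (β ^ (A.card % 2) * (Λ ^ (A.card / 2) / Λ)) := by
  -- The number of removed places grows as the number of indices drops, hence the generalisation
  -- over `r`.
  induction k generalizing r with
  | zero =>
    refine ⟨0, le_rfl, ?_⟩
    intro π T _ _ _ _ good _ Z u V Λ β h A R hA _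
    have : A = ∅ := Finset.card_eq_zero.1 (by omega)
    subst this
    simp [sumMoment, card_matchings_empty]
  | succ k ih =>
    obtain ⟨C, hC, h1⟩ := ih (r + 1)
    set D := Fintype.card (Finset ι) * ((c * C + Fintype.card (Finset (Finset ι)) *
      (c + r * c ^ 2)) + c ^ (Fintype.card ι + 1) * (Fintype.card (Finset (Finset ι)) + C)) with hD
    -- The constant is fixed before `1 ≤ c` is available, so the absolute value secures its sign.
    refine ⟨|D|, abs_nonneg _, ?_⟩
    intro π T _ _ _ _ good _ Z u V Λ β h A R hA hR
    rcases A.eq_empty_or_nonempty with rfl | ⟨i, hi⟩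
    · have := h.one_le_lam
      have : 0 ≤ |D| * (β ^ ((∅ : Finset ι).card % 2) * (Λ ^ ((∅ : Finset ι).card / 2) / Λ)) := by
        have := h.beta_pos
        positivity
      simpa [sumMoment, card_matchings_empty] using this
    · rw [← Finset.insert_erase hi]
      refine (norm_sumMoment_insert_sub_le h hC (h1 good Z u V Λ β h) (Finset.notMem_erase i A)
        ?_ R hR).trans ?_
      · rw [Finset.card_erase_of_mem hi]; omega
      · refine mul_le_mul_of_nonneg_right (le_abs_self D) ?_
        have := h.one_le_lam
        have := h.beta_pos
        positivity

/-- The mixed moments of sums of independent variables with a small common mean. -/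
theorem exists_expect_prod_bound (ι : Type) [Fintype ι] [DecidableEq ι] (c : ℝ) :
    ∃ C : ℝ, 0 ≤ C ∧ ∀ {π : Type v} {T : Type w} [Fintype π] [DecidableEq π] [Fintype T]
      [Nonempty T] (good : Finset ι → Prop) [DecidablePred good]
      (Z : π → ι → T → ℂ) (u : π → ℝ) (V Λ β : ℝ),
      CenteredFamily good Z u c V Λ β → ∀ (μ : ℂ) (m : ℝ), ‖μ‖ ≤ c * β → ‖μ - m‖ ≤ c * (β / Λ) →
      ‖𝔼 ω : π → T, ∏ i, (μ + ∑ P, Z P i (ω P)) -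
        (((matchings good Finset.univ).card : ℂ) +
          m * ∑ i, ((matchings good (Finset.univ.erase i)).card : ℂ)) *
          (V : ℂ) ^ (Fintype.card ι / 2)‖ ≤
      C * (β ^ (Fintype.card ι % 2) * (Λ ^ (Fintype.card ι / 2) / Λ)) := by
  obtain ⟨C, hC, hbound⟩ := exists_sumMoment_bound.{v, w} ι c (Fintype.card ι) 0
  set N : ℝ := (Fintype.card (Finset (Finset ι)) : ℝ) with hN
  have hN0 : 0 ≤ N := Nat.cast_nonneg _
  set n := Fintype.card ι with hn
  set D := C + (|c| * C + |c| * N) + |c| ^ n * (N + C) with hD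
  refine ⟨Fintype.card (Finset ι) * D, by positivity, ?_⟩
  intro π T _ _ _ _ good _ Z u V Λ β h μ m hμ hμm
  have hΛ := h.one_le_lam
  have hβ := h.beta_pos
  have hc := h.one_le_c
  rw [abs_of_nonneg (by linarith)] at hD
  have hb (A : Finset ι) := hbound good Z u V Λ β h A ∅ (Finset.card_le_univ A) (by simp)
  simp only [Finset.sdiff_empty] at hb
  -- Here `S` is the set of factors from which the mean `μ` is taken. Only `S.card ≤ 1` can
  -- contribute to the main term.
  let main : Finset ι → ℂ := fun S => if S.card = 0 then
      ((matchings good Finset.univ).card : ℂ) * (V : ℂ) ^ (n / 2) else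
    if S.card = 1 then m * ((matchings good (Finset.univ \ S)).card : ℂ) * (V : ℂ) ^ (n / 2) else 0
  have hmain : ∑ S ∈ (Finset.univ : Finset ι).powerset, main S =
      (((matchings good Finset.univ).card : ℂ) +
          m * ∑ i, ((matchings good (Finset.univ.erase i)).card : ℂ)) * (V : ℂ) ^ (n / 2) := by
    have h0 (S : Finset ι) : main S = (if S.card = 0 then
        ((matchings good Finset.univ).card : ℂ) * (V : ℂ) ^ (n / 2) else 0) +
        if S.card = 1 then m * ((matchings good (Finset.univ \ S)).card : ℂ) *
          (V : ℂ) ^ (n / 2) else 0 := by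
      simp only [main]
      split_ifs <;> (simp; try omega)
    simp only [h0]
    rw [Finset.sum_add_distrib, ← Finset.sum_filter, ← Finset.sum_filter,
      ← Finset.powersetCard_eq_filter, ← Finset.powersetCard_eq_filter, Finset.powersetCard_one,
      Finset.sum_map, Finset.powersetCard_zero, Finset.sum_singleton, add_mul, Finset.mul_sum,
      Finset.sum_mul]
    simp [Finset.sdiff_singleton_eq_erase]
  have hexp : 𝔼 ω : π → T, ∏ i, (μ + ∑ P, Z P i (ω P)) =
      ∑ S ∈ (Finset.univ : Finset ι).powerset,
        μ ^ S.card * sumMoment Z (Finset.univ \ S) Finset.univ := by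
    simp only [Finset.prod_add, Finset.prod_const]
    rw [Finset.expect_sum_comm]
    refine Finset.sum_congr rfl fun S _ => ?_
    rw [sumMoment, Finset.mul_expect]
  rw [hexp, ← hmain, ← Finset.sum_sub_distrib]
  set E := β ^ (n % 2) * (Λ ^ (n / 2) / Λ) with hE
  have hE0 : 0 ≤ E := by positivity
  refine (norm_sum_le_of_le (f := _) (n := fun _ => D * E) _ fun S _ => ?_).trans ?_
  swap
  · rw [Finset.sum_const, nsmul_eq_mul, ← mul_assoc, Finset.powerset_univ, Finset.card_univ]
  have hSn : S.card ≤ n := Finset.card_le_univ S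
  have hcard : (Finset.univ \ S).card = n - S.card := by
    rw [Finset.card_sdiff_of_subset (Finset.subset_univ S), Finset.card_univ]
  have hx0 : 0 ≤ c * C + c * N := by positivity
  have hx1 : 0 ≤ c ^ n * (N + C) := by positivity
  rcases Nat.lt_or_ge S.card 2 with h2 | h2
  · rcases Nat.lt_or_ge S.card 1 with h1 | h1
    · have hS0 : S = ∅ := Finset.card_eq_zero.1 (by omega)
      subst hS0
      have := hb Finset.univ
      rw [Finset.card_univ, ← hn, ← hE] at this
      simp only [main, Finset.card_empty, pow_zero, one_mul, if_true, Finset.sdiff_empty]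
      refine this.trans (mul_le_mul_of_nonneg_right ?_ hE0)
      rw [hD]
      linarith
    · have hS1 : S.card = 1 := by omega
      have hS := hb (Finset.univ \ S)
      have hH := norm_matching_term_le (good := good) hβ h.var_nonneg h.var_le (Finset.univ \ S)
      rw [hcard, hS1] at hS hH
      set H : ℂ := ((matchings good (Finset.univ \ S)).card : ℂ) * (V : ℂ) ^ ((n - 1) / 2)
        with hHdef
      -- The exponents `n / 2` and `(n - 1) / 2` differ only for even `n`, and then the matching
      -- count is zero.
      have hHn : ((matchings good (Finset.univ \ S)).card : ℂ) * (V : ℂ) ^ (n / 2) = H := by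
        rcases Nat.mod_two_eq_zero_or_one n with hp | hp
        · rw [hHdef, card_matchings_of_odd (by rw [hcard]; omega)]
          simp
        · rw [hHdef]
          congr 2
          omega
      have hsplit : μ ^ S.card * sumMoment Z (Finset.univ \ S) Finset.univ - main S =
          μ * (sumMoment Z (Finset.univ \ S) Finset.univ - H) + (μ - m) * H := by
        simp only [main, hS1, one_ne_zero, if_false, if_true, pow_one, mul_assoc, hHn]
        ring
      rw [hsplit]
      refine (norm_add_le _ _).trans ?_
      rw [norm_mul, norm_mul]
      have e1 := mul_le_mul hμ hS (norm_nonneg _) (by positivity)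
      have e2 := mul_le_mul hμm hH (norm_nonneg _) (by positivity)
      have e3 : β * β ^ ((n - 1) % 2) ≤ β ^ (n % 2) := beta_mul_pow_le hβ h.beta_le _ _
      have e4 : Λ ^ ((n - 1) / 2) / Λ ≤ Λ ^ (n / 2) / Λ := by
        gcongr
        omega
      have e5 : (β * β ^ ((n - 1) % 2)) * (Λ ^ ((n - 1) / 2) / Λ) ≤ E :=
        mul_le_mul e3 e4 (by positivity) (by positivity)
      calc _ ≤ _ := add_le_add e1 e2
        _ = (c * C + c * N) * ((β * β ^ ((n - 1) % 2)) * (Λ ^ ((n - 1) / 2) / Λ)) := by ring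
        _ ≤ (c * C + c * N) * E := mul_le_mul_of_nonneg_left e5 hx0
        _ ≤ D * E := mul_le_mul_of_nonneg_right (by rw [hD]; linarith) hE0
  · have hm : main S = 0 := by
      simp only [main]
      rw [if_neg (by omega), if_neg (by omega)]
    have hS := norm_sumMoment_le h hC (hb (Finset.univ \ S))
    rw [hcard] at hS
    rw [hm, sub_zero, norm_mul, norm_pow]
    obtain ⟨s, hs⟩ := Nat.exists_eq_add_of_le h2
    -- One factor `β` is kept for the parity; the lost power of `Λ` comes from having at least two
    -- indices fewer.
    have e1 : ‖μ‖ ^ S.card ≤ c ^ n * β := by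
      refine (pow_le_pow_left₀ (norm_nonneg _) hμ _).trans ?_
      rw [mul_pow]
      refine mul_le_mul (pow_le_pow_right₀ hc hSn) ?_ (by positivity) (by positivity)
      rw [hs]
      exact pow_le_of_le_one hβ.le h.beta_le (by omega)
    have e3 : β * β ^ ((n - S.card) % 2) ≤ β ^ (n % 2) := beta_mul_pow_le hβ h.beta_le _ _
    have e4 : Λ ^ ((n - S.card) / 2) ≤ Λ ^ (n / 2) / Λ := pow_le_pow_div hΛ (by omega)
    have e5 : (β * β ^ ((n - S.card) % 2)) * Λ ^ ((n - S.card) / 2) ≤ E :=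
        mul_le_mul e3 e4 (by positivity) (by positivity)
    calc _ ≤ _ := mul_le_mul e1 hS (norm_nonneg _) (by positivity)
      _ = c ^ n * (N + C) * ((β * β ^ ((n - S.card) % 2)) * Λ ^ ((n - S.card) / 2)) := by ring
      _ ≤ c ^ n * (N + C) * E := mul_le_mul_of_nonneg_left e5 hx1
      _ ≤ D * E := by
        refine mul_le_mul_of_nonneg_right ?_ hE0
        rw [hD]
        linarith

/-! ### Fourier coefficients of the Beurling-Selberg polynomials -/

section SelbergCoefficients

/-- The closed form of the Fourier coefficients of the Beurling-Selberg polynomials. -/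
def selbergWeight (s : ℤˣ) (K : ℕ) (β : ℝ) (k : ℕ) : ℝ :=
  vaalerWeight ((k : ℝ) / (K + 1)) * (Real.sin (Real.pi * k * β) / (Real.pi * k)) +
    ((s : ℤ) : ℝ) * ((1 - (k : ℝ) / (K + 1)) * Real.cos (Real.pi * k * β) / (K + 1))

theorem vaaler_neg (K : ℕ) (x : ℝ) : vaaler K (-x) = -vaaler K x := by
  simp [vaaler]

theorem fejer_neg (K : ℕ) (x : ℝ) : fejer K (-x) = fejer K x := by
  simp [fejer]

theorem vaaler_add_vaaler (K : ℕ) (β x : ℝ) :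
    vaaler K (x - β / 2) + vaaler K (-(β / 2) - x) = ∑ k ∈ Finset.Icc 1 K,
      2 * (vaalerWeight ((k : ℝ) / (K + 1)) * (Real.sin (Real.pi * k * β) / (Real.pi * k))) *
        Real.cos (2 * Real.pi * k * x) := by
  unfold vaaler
  rw [← neg_add, ← Finset.sum_add_distrib, ← Finset.sum_neg_distrib]
  refine Finset.sum_congr rfl fun k _ => ?_
  rw [show 2 * Real.pi * k * (x - β / 2) = 2 * Real.pi * k * x - Real.pi * k * β by ring,
    show 2 * Real.pi * k * (-(β / 2) - x) = -(2 * Real.pi * k * x + Real.pi * k * β) by ring,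
    Real.sin_sub, Real.sin_neg, Real.sin_add]
  ring

theorem fejer_add_fejer (K : ℕ) (β x : ℝ) :
    (fejer K (x - β / 2) + fejer K (-(β / 2) - x)) / (2 * (K + 1)) = 1 / (K + 1) +
      ∑ k ∈ Finset.Icc 1 K, 2 * ((1 - (k : ℝ) / (K + 1)) * Real.cos (Real.pi * k * β) / (K + 1)) *
        Real.cos (2 * Real.pi * k * x) := by
  have hK : (K : ℝ) + 1 ≠ 0 := by positivity
  have h : fejer K (x - β / 2) + fejer K (-(β / 2) - x) = 2 + (2 * (K + 1)) *
      ∑ k ∈ Finset.Icc 1 K, 2 * ((1 - (k : ℝ) / (K + 1)) * Real.cos (Real.pi * k * β) / (K + 1)) *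
        Real.cos (2 * Real.pi * k * x) := by
    unfold fejer
    rw [add_add_add_comm, ← mul_add, ← Finset.sum_add_distrib, Finset.mul_sum, Finset.mul_sum,
      one_add_one_eq_two]
    congr 1
    refine Finset.sum_congr rfl fun k _ => ?_
    rw [show 2 * Real.pi * k * (x - β / 2) = 2 * Real.pi * k * x - Real.pi * k * β by ring,
      show 2 * Real.pi * k * (-(β / 2) - x) = -(2 * Real.pi * k * x + Real.pi * k * β) by ring,
      Real.cos_sub, Real.cos_neg, Real.cos_add]
    field_simp
    ring
  rw [h, add_div, mul_div_cancel_left₀ _ (by positivity)]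
  congr 1
  field_simp

/-- `vaaler` is odd and `fejer` is even, so the sign `s` cancels in the Vaaler part and survives
only in the Fejér part. -/
theorem selberg_eq_sum_cos (s : ℤˣ) (K : ℕ) (β x : ℝ) :
    selberg s K β x = (β + ((s : ℤ) : ℝ) / (K + 1)) +
      ∑ k ∈ Finset.Icc 1 K, 2 * selbergWeight s K β k * Real.cos (2 * Real.pi * k * x) := by
  have h : selberg s K β x = β + (vaaler K (x - β / 2) + vaaler K (-(β / 2) - x)) +
      ((s : ℤ) : ℝ) * ((fejer K (x - β / 2) + fejer K (-(β / 2) - x)) / (2 * (K + 1))) := by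
    unfold selberg beurling
    rcases Int.units_eq_one_or s with rfl | rfl
    · simp only [Units.val_one, Int.cast_one, one_mul]
      ring
    · simp only [Units.val_neg, Units.val_one, Int.cast_neg, Int.cast_one, neg_mul, one_mul,
        vaaler_neg, fejer_neg]
      ring
  rw [h, vaaler_add_vaaler, fejer_add_fejer, mul_add, Finset.mul_sum]
  simp only [selbergWeight, mul_add, add_mul, Finset.sum_add_distrib]
  have e (k : ℕ) : ((s : ℤ) : ℝ) * (2 * ((1 - (k : ℝ) / (K + 1)) *
      Real.cos (Real.pi * k * β) / (K + 1)) * Real.cos (2 * Real.pi * k * x)) =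
      2 * (((s : ℤ) : ℝ) * ((1 - (k : ℝ) / (K + 1)) * Real.cos (Real.pi * k * β) / (K + 1))) *
        Real.cos (2 * Real.pi * k * x) := by ring
  simp only [e]
  ring

theorem integral_exp_two_pi (m : ℤ) :
    ∫ x in (-(1 / 2) : ℝ)..(1 / 2), Complex.exp (2 * Real.pi * Complex.I * m * x) =
      if m = 0 then 1 else 0 := by
  split_ifs with h
  · subst h
    simp
    norm_num
  · have hc : (2 * Real.pi * Complex.I * m : ℂ) ≠ 0 := by
      have : (m : ℂ) ≠ 0 := by exact_mod_cast h
      have := Complex.ofReal_ne_zero.2 Real.pi_ne_zero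
      simp_all
    rw [integral_exp_mul_complex hc, div_eq_zero_iff]
    left
    rw [sub_eq_zero]
    refine Complex.exp_eq_exp_iff_exists_int.2 ⟨m, ?_⟩
    push_cast
    ring

theorem integral_cos_mul_exp (k : ℕ) (l : ℤ) :
    ∫ x in (-(1 / 2) : ℝ)..(1 / 2), ((Real.cos (2 * Real.pi * k * x) : ℝ) : ℂ) *
      Complex.exp (-(2 * Real.pi * Complex.I * l * x)) =
      ((if (k : ℤ) = l then 1 else 0) + if -(k : ℤ) = l then 1 else 0) / 2 := by
  have h (x : ℝ) : ((Real.cos (2 * Real.pi * k * x) : ℝ) : ℂ) *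
      Complex.exp (-(2 * Real.pi * Complex.I * l * x)) =
      (Complex.exp (2 * Real.pi * Complex.I * ((k - l : ℤ) : ℂ) * x) +
        Complex.exp (2 * Real.pi * Complex.I * ((-k - l : ℤ) : ℂ) * x)) / 2 := by
    rw [Complex.ofReal_cos, Complex.cos, div_mul_eq_mul_div, add_mul, ← Complex.exp_add,
      ← Complex.exp_add]
    congr 3 <;> push_cast <;> ring
  simp only [h]
  rw [intervalIntegral.integral_div, intervalIntegral.integral_add, integral_exp_two_pi,
    integral_exp_two_pi]
  · simp only [sub_eq_zero]
  all_goals exact Continuous.intervalIntegrable (by fun_prop) _ _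

/-- Orthogonality applied to an even real cosine polynomial, which has the same real coefficient at
`j` and `-j`. -/
theorem selbergCoeff_eq (s : ℤˣ) {K : ℕ} (β : ℝ) {j : ℕ} (hj : j ∈ Finset.Icc 1 K) {l : ℤ}
    (hl : l = j ∨ l = -j) : selbergCoeff s K β l = selbergWeight s K β j := by
  have hj1 := (Finset.mem_Icc.1 hj).1
  have hl0 : l ≠ 0 := by omega
  have h (x : ℝ) : (selberg s K β x : ℂ) * Complex.exp (-(2 * Real.pi * Complex.I * l * x)) =
      ((β + ((s : ℤ) : ℝ) / (K + 1) : ℝ) : ℂ) *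
        Complex.exp (2 * Real.pi * Complex.I * ((-l : ℤ) : ℂ) * x) +
      ∑ k ∈ Finset.Icc 1 K, (2 * selbergWeight s K β k : ℂ) *
        (((Real.cos (2 * Real.pi * k * x) : ℝ) : ℂ) *
          Complex.exp (-(2 * Real.pi * Complex.I * l * x))) := by
    have e : (2 * Real.pi * Complex.I * ((-l : ℤ) : ℂ) * x : ℂ) =
      -(2 * Real.pi * Complex.I * l * x) := by push_cast; ring
    rw [selberg_eq_sum_cos, e, Complex.ofReal_add, add_mul, Complex.ofReal_sum, Finset.sum_mul]
    congr 1
    refine Finset.sum_congr rfl fun k _ => ?_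
    push_cast
    ring
  unfold selbergCoeff
  simp only [h]
  rw [intervalIntegral.integral_add, intervalIntegral.integral_const_mul, integral_exp_two_pi,
    if_neg (by omega), mul_zero, zero_add, intervalIntegral.integral_finsetSum]
  · simp only [intervalIntegral.integral_const_mul, integral_cos_mul_exp]
    rw [Finset.sum_eq_single_of_mem j hj]
    · have e : ((if (j : ℤ) = l then 1 else 0) + if -(j : ℤ) = l then 1 else 0 : ℂ) = 1 := by
        rcases hl with rfl | rfl
        · rw [if_pos rfl, if_neg (by omega), add_zero]
        · rw [if_neg (by omega), if_pos rfl, zero_add]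
      rw [e]
      ring
    · intro k hk hkj
      have hk1 := (Finset.mem_Icc.1 hk).1
      rw [if_neg (by omega), if_neg (by omega)]
      simp
  · exact fun k _ => Continuous.intervalIntegrable (by fun_prop) _ _
  · exact Continuous.intervalIntegrable (by fun_prop) _ _
  · exact Continuous.intervalIntegrable (by fun_prop) _ _

/-- For `t ≤ 1/2` and `x = πt`, the difference is `(1 - t)(sin x - x cos x)/sin x`, with numerator
between 0 and `x³/2` and `sin x ≥ 2t`. For `t ≥ 1/2` the factor `1 - t` cancels the pole of the
cotangent. A bound linear in `t` suffices, as it is later divided by `k`. -/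
theorem abs_one_sub_vaalerWeight_le {t : ℝ} (h0 : 0 < t) (h1 : t < 1) :
    |1 - vaalerWeight t| ≤ 6 * t := by
  have hpi := Real.pi_pos
  have hpi3 := Real.pi_gt_three
  have hpi4 := Real.pi_lt_d2
  have hx0 : 0 < Real.pi * t := by positivity
  have hsin : 0 < Real.sin (Real.pi * t) := Real.sin_pos_of_pos_of_lt_pi hx0 (by nlinarith)
  rcases le_total t (1 / 2) with h | h
  · have e : 1 - vaalerWeight t = (1 - t) *
        ((Real.sin (Real.pi * t) - Real.pi * t * Real.cos (Real.pi * t)) /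
          Real.sin (Real.pi * t)) := by
      unfold vaalerWeight
      field_simp
      ring
    set x := Real.pi * t with hx
    have hx2 : x ≤ Real.pi / 2 := by nlinarith
    have hs : 2 / Real.pi * x ≤ Real.sin x := Real.mul_le_sin hx0.le hx2
    have hs' : 2 * t ≤ Real.sin x := by
      have : 2 / Real.pi * x = 2 * t := by rw [hx]; field_simp
      linarith
    have hlow : 0 ≤ Real.sin x - x * Real.cos x := by
      rcases hx2.eq_or_lt with h2 | h2
      · rw [h2, Real.cos_pi_div_two, Real.sin_pi_div_two]; norm_num
      · have := (Real.lt_tan hx0 h2).le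
        have hc := Real.cos_pos_of_mem_Ioo ⟨by linarith, h2⟩
        rw [Real.tan_eq_sin_div_cos, le_div_iff₀ hc] at this
        linarith
    have hup : Real.sin x - x * Real.cos x ≤ x ^ 3 / 2 := by
      have h3 := Real.sin_le hx0.le
      have h4 := Real.one_sub_sq_div_two_le_cos (x := x)
      nlinarith
    have hdiv : (Real.sin x - x * Real.cos x) / Real.sin x ≤ 6 * t := by
      rw [div_le_iff₀ hsin]
      have h5 : x ^ 3 / 2 ≤ 6 * t * (2 * t) := by
        have : x ^ 3 ≤ 24 * t ^ 2 := by
          have h6 : x ^ 3 = Real.pi ^ 3 * t * t ^ 2 := by rw [hx]; ring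
          have h7 : Real.pi ^ 3 ≤ 32 := by
            calc Real.pi ^ 3 ≤ 3.15 ^ 3 := by gcongr
              _ ≤ 32 := by norm_num
          rw [h6]
          have : Real.pi ^ 3 * t ≤ 24 := by nlinarith
          exact mul_le_mul_of_nonneg_right this (sq_nonneg t)
        nlinarith
      nlinarith
    rw [e, abs_of_nonneg (mul_nonneg (by linarith) (div_nonneg hlow hsin.le))]
    have := div_nonneg hlow hsin.le
    nlinarith
  · have hs : 2 * (1 - t) ≤ Real.sin (Real.pi * t) := by
      have h2 := Real.mul_le_sin (x := Real.pi * (1 - t)) (by nlinarith) (by nlinarith)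
      have h3 : 2 / Real.pi * (Real.pi * (1 - t)) = 2 * (1 - t) := by field_simp
      have h4 : Real.sin (Real.pi * (1 - t)) = Real.sin (Real.pi * t) := by
        rw [show Real.pi * (1 - t) = Real.pi - Real.pi * t by ring, Real.sin_pi_sub]
      linarith
    have e : 1 - vaalerWeight t = (1 - t) - Real.pi * t * Real.cos (Real.pi * t) *
        ((1 - t) / Real.sin (Real.pi * t)) := by
      unfold vaalerWeight
      field_simp
      ring
    have hq0 : 0 ≤ (1 - t) / Real.sin (Real.pi * t) := div_nonneg (by linarith) hsin.le
    have hq : (1 - t) / Real.sin (Real.pi * t) ≤ 1 / 2 := by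
      rw [div_le_iff₀ hsin]; linarith
    have hb : |Real.pi * t * Real.cos (Real.pi * t) * ((1 - t) / Real.sin (Real.pi * t))| ≤
        Real.pi * t * 1 * (1 / 2) := by
      rw [abs_mul, abs_mul, abs_of_pos hx0, abs_of_nonneg hq0]
      gcongr
      exact Real.abs_cos_le_one _
    rw [e]
    refine (abs_sub _ _).trans ?_
    rw [abs_of_nonneg (by linarith : 0 ≤ 1 - t)]
    nlinarith

theorem abs_sin_div_le_beta {β : ℝ} (hβ : 0 ≤ β) (k : ℕ) :
    |Real.sin (Real.pi * k * β) / (Real.pi * k)| ≤ β := by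
  rcases k.eq_zero_or_pos with rfl | hk
  · simpa using hβ
  have hk' : (0 : ℝ) < k := by exact_mod_cast hk
  have hpi := Real.pi_pos
  rw [abs_div, abs_of_pos (by positivity : 0 < Real.pi * k), div_le_iff₀ (by positivity)]
  refine Real.abs_sin_le_abs.trans (le_of_eq ?_)
  rw [abs_of_nonneg (by positivity)]
  ring

theorem abs_sin_div_le_inv (β : ℝ) (k : ℕ) :
    |Real.sin (Real.pi * k * β) / (Real.pi * k)| ≤ 1 / k := by
  rcases k.eq_zero_or_pos with rfl | hk
  · simp
  have hk' : (0 : ℝ) < k := by exact_mod_cast hk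
  have hpi := Real.pi_gt_three
  rw [abs_div, abs_of_pos (by positivity : 0 < Real.pi * k)]
  refine div_le_div₀ zero_le_one (Real.abs_sin_le_one _) hk' ?_
  nlinarith

/-- The Vaaler weight costs `6k/(K+1) · 1/(3k) = 2/(K+1)` and the Fejér term at most `1/(K+1)`. -/
theorem abs_selbergWeight_sub_le (s : ℤˣ) {K k : ℕ} (β : ℝ) (hk : k ∈ Finset.Icc 1 K) :
    |selbergWeight s K β k - Real.sin (Real.pi * k * β) / (Real.pi * k)| ≤ 3 / K := by
  obtain ⟨hk1, hkK⟩ := Finset.mem_Icc.1 hk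
  have hk0 : (0 : ℝ) < k := by exact_mod_cast hk1
  have hkK' : (k : ℝ) ≤ K := by exact_mod_cast hkK
  have hK1 : (0 : ℝ) < K + 1 := by linarith
  have ht0 : 0 < (k : ℝ) / (K + 1) := by positivity
  have ht1 : (k : ℝ) / (K + 1) < 1 := by rw [div_lt_one hK1]; linarith
  have hpi := Real.pi_gt_three
  have h1 := abs_one_sub_vaalerWeight_le ht0 ht1
  have hσ : |((s : ℤ) : ℝ)| = 1 := by
    rcases Int.units_eq_one_or s with rfl | rfl <;> simp
  have e : selbergWeight s K β k - Real.sin (Real.pi * k * β) / (Real.pi * k) =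
      -((1 - vaalerWeight ((k : ℝ) / (K + 1))) *
        (Real.sin (Real.pi * k * β) / (Real.pi * k))) +
      ((s : ℤ) : ℝ) * ((1 - (k : ℝ) / (K + 1)) * Real.cos (Real.pi * k * β) / (K + 1)) := by
    unfold selbergWeight
    ring
  rw [e]
  refine (abs_add_le _ _).trans ?_
  rw [abs_neg, abs_mul, abs_mul, hσ, one_mul, abs_div (_ * _), abs_mul, abs_of_pos hK1,
    abs_of_pos (by linarith : 0 < 1 - (k : ℝ) / (K + 1))]
  have h2 : |Real.sin (Real.pi * k * β) / (Real.pi * k)| ≤ 1 / (3 * k) := by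
    rw [abs_div, abs_of_pos (by positivity : 0 < Real.pi * k)]
    refine div_le_div₀ zero_le_one (Real.abs_sin_le_one _) (by positivity) ?_
    nlinarith
  have h3 : |1 - vaalerWeight ((k : ℝ) / (K + 1))| *
      |Real.sin (Real.pi * k * β) / (Real.pi * k)| ≤ 6 * ((k : ℝ) / (K + 1)) * (1 / (3 * k)) :=
    mul_le_mul h1 h2 (abs_nonneg _) (by positivity)
  have h4 : 6 * ((k : ℝ) / (K + 1)) * (1 / (3 * k)) = 2 / (K + 1) := by
    field_simp
    norm_num
  have h5 : (1 - (k : ℝ) / (K + 1)) * |Real.cos (Real.pi * k * β)| / (K + 1) ≤ 1 / (K + 1) := by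
    gcongr
    exact mul_le_one₀ (by linarith) (abs_nonneg _) (Real.abs_cos_le_one _)
  calc _ ≤ 2 / ((K : ℝ) + 1) + 1 / (K + 1) := by rw [← h4]; exact add_le_add h3 h5
    _ = 3 / (K + 1) := by ring
    _ ≤ 3 / K := by
      have : (0 : ℝ) < K := by linarith
      gcongr
      linarith

theorem abs_selbergWeight_le_inv (s : ℤˣ) {K k : ℕ} (β : ℝ) (hk : k ∈ Finset.Icc 1 K) :
    |selbergWeight s K β k| ≤ 4 / k := by
  obtain ⟨hk1, hkK⟩ := Finset.mem_Icc.1 hk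
  have hk0 : (0 : ℝ) < k := by exact_mod_cast hk1
  have hkK' : (k : ℝ) ≤ K := by exact_mod_cast hkK
  have h1 := abs_selbergWeight_sub_le s β hk
  have h2 := abs_sin_div_le_inv β k
  have h3 : (3 : ℝ) / K ≤ 3 / k := by gcongr
  have h4 := abs_sub_abs_le_abs_sub (selbergWeight s K β k)
    (Real.sin (Real.pi * k * β) / (Real.pi * k))
  have h5 : (4 : ℝ) / k = 3 / k + 1 / k := by ring
  linarith

theorem abs_selbergWeight_le_beta (s : ℤˣ) {K k : ℕ} {β : ℝ} (hβ : 0 < β) (hK : 1 / β < K)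
    (hk : k ∈ Finset.Icc 1 K) : |selbergWeight s K β k| ≤ 4 * β := by
  have hK0 : (0 : ℝ) < K := lt_trans (by positivity) hK
  have h1 := abs_selbergWeight_sub_le s β hk
  have h2 := abs_sin_div_le_beta hβ.le k
  have h3 : (3 : ℝ) / K ≤ 3 * β := by
    rw [div_lt_iff₀ hβ] at hK
    rw [div_le_iff₀ hK0]
    linarith
  have h4 := abs_sub_abs_le_abs_sub (selbergWeight s K β k)
    (Real.sin (Real.pi * k * β) / (Real.pi * k))
  linarith

end SelbergCoefficients

/-! ### The logarithm in the variance -/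

section LogarithmicSums

/-- Abel summation against the monotone weight `1/m`. Subtracting the boundary term `G N / (N + 1)`
gives a statement that passes through induction on `N`. -/
theorem abs_sum_telescope_div_le {G : ℕ → ℝ} (hG : ∀ m, |G m| ≤ 1) {J N : ℕ} (h : J ≤ N) :
    |∑ m ∈ Finset.Ioc J N, (G m - G (m - 1)) / m| ≤ 2 / (J + 1) := by
  have key : |∑ m ∈ Finset.Ioc J N, (G m - G (m - 1)) / m - G N / (N + 1)| ≤
      2 / (J + 1) - 1 / (N + 1) := by
    induction N, h using Nat.le_induction with
    | base =>
      have h1 : (0 : ℝ) < J + 1 := by positivity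
      rw [Finset.Ioc_self, Finset.sum_empty, zero_sub, abs_neg, abs_div, abs_of_pos h1]
      have h2 : |G J| / (J + 1) ≤ 1 / (J + 1) := by gcongr; exact hG J
      have h3 : (2 : ℝ) / (J + 1) = 1 / (J + 1) + 1 / (J + 1) := by ring
      linarith
    | succ N hN ih =>
      have e : ∑ m ∈ Finset.Ioc J (N + 1), (G m - G (m - 1)) / m - G (N + 1) / ((N + 1 : ℕ) + 1) =
          (∑ m ∈ Finset.Ioc J N, (G m - G (m - 1)) / m - G N / (N + 1)) +
          G (N + 1) * (1 / ((N : ℝ) + 1) - 1 / ((N + 1 : ℕ) + 1)) := by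
        rw [Finset.sum_Ioc_succ_top (by omega), Nat.add_sub_cancel]
        push_cast
        ring
      have h0 : 0 ≤ 1 / ((N : ℝ) + 1) - 1 / ((N + 1 : ℕ) + 1) := by
        rw [sub_nonneg]
        gcongr
        linarith
      rw [e]
      refine (abs_add_le _ _).trans ?_
      rw [abs_mul, abs_of_nonneg h0]
      have := mul_le_of_le_one_left h0 (hG (N + 1))
      linarith
  have h1 : (0 : ℝ) < N + 1 := by positivity
  have h2 : |G N / (N + 1)| ≤ 1 / (N + 1) := by
    rw [abs_div, abs_of_pos h1]; gcongr; exact hG N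
  have h3 := abs_sub_abs_le_abs_sub (∑ m ∈ Finset.Ioc J N, (G m - G (m - 1)) / m) (G N / (N + 1))
  linarith

variable {β : ℝ} {K : ℕ}

/-- Use `log(n+1) ≤ H_n ≤ 1 + log n` at both ends. Rounding is harmless because `log(1/β)` lies
between `log J` and `log(J+1)`. -/
theorem abs_sum_inv_Ioc_sub_log_le (hβ : 0 < β) (hβ1 : β ≤ 1) (hK : 1 / β < K) :
    |∑ m ∈ Finset.Ioc ⌊1 / β⌋₊ K, (1 : ℝ) / m - Real.log (K * β)| ≤ 1 := by
  have hb0 : 0 < 1 / β := by positivity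
  have hK0 : (0 : ℝ) < K := hb0.trans hK
  set J := ⌊1 / β⌋₊ with hJ
  have hJ1 : 1 ≤ J := Nat.le_floor (by rw [Nat.cast_one, le_div_iff₀ hβ]; linarith)
  have hJle : (J : ℝ) ≤ 1 / β := Nat.floor_le hb0.le
  have hJlt : 1 / β < (J : ℝ) + 1 := Nat.lt_floor_add_one _
  have hJK : J ≤ K := by exact_mod_cast (hJle.trans hK.le)
  have hJ0 : (0 : ℝ) < J := by exact_mod_cast hJ1
  have hIcc (n : ℕ) : ∑ m ∈ Finset.Ioc 0 n, (1 : ℝ) / m = harmonic n := by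
    rw [harmonic_eq_sum_Icc]
    push_cast
    refine Finset.sum_congr (by ext; simp; omega) fun m _ => one_div _
  have hdiff : ∑ m ∈ Finset.Ioc J K, (1 : ℝ) / m = harmonic K - harmonic J := by
    rw [← hIcc, ← hIcc, ← Finset.sum_Ioc_consecutive _ (Nat.zero_le J) hJK]
    ring
  have h1 := harmonic_le_one_add_log K
  have h2 := harmonic_le_one_add_log J
  have h3 := log_add_one_le_harmonic K
  have h4 := log_add_one_le_harmonic J
  have hlog : Real.log (K * β) = Real.log K - Real.log (1 / β) := by
    rw [← Real.log_div hK0.ne' hb0.ne', div_div_eq_mul_div, div_one]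
  have h5 : Real.log J ≤ Real.log (1 / β) := Real.log_le_log hJ0 hJle
  have h6 : Real.log (1 / β) ≤ Real.log ((J + 1 : ℕ) : ℝ) :=
    Real.log_le_log hb0 (by push_cast; exact hJlt.le)
  have h7 : Real.log K ≤ Real.log ((K + 1 : ℕ) : ℝ) :=
    Real.log_le_log hK0 (by push_cast; linarith)
  rw [hdiff, hlog, abs_le]
  constructor <;> linarith

/-- There are at most `1/β` terms, each at most `c * β`. The range below `1/β` therefore never
produces a logarithm. -/
theorem sum_Ioc_floor_le (hβ : 0 < β) {f : ℕ → ℝ} {c : ℝ} (hc : 0 ≤ c)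
    (hf : ∀ m, 0 < m → f m ≤ c * (β ^ 2 * m)) :
    ∑ m ∈ Finset.Ioc 0 ⌊1 / β⌋₊, f m ≤ c := by
  have hb0 : 0 < 1 / β := by positivity
  have hJle : (⌊1 / β⌋₊ : ℝ) ≤ 1 / β := Nat.floor_le hb0.le
  have hJβ : (⌊1 / β⌋₊ : ℝ) * β ≤ 1 := by rwa [le_div_iff₀ hβ] at hJle
  have h (m : ℕ) (hm : m ∈ Finset.Ioc 0 ⌊1 / β⌋₊) : f m ≤ c * β := by
    obtain ⟨h1, h2⟩ := Finset.mem_Ioc.1 hm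
    refine (hf m h1).trans (mul_le_mul_of_nonneg_left ?_ hc)
    have : (m : ℝ) ≤ ⌊1 / β⌋₊ := by exact_mod_cast h2
    nlinarith
  refine (Finset.sum_le_card_nsmul _ _ _ h).trans ?_
  rw [Nat.card_Ioc, nsmul_eq_mul, Nat.sub_zero]
  nlinarith

theorem sum_min_sq_div_le (hβ : 0 < β) (hβ1 : β ≤ 1) (hK : 1 / β < K) :
    ∑ m ∈ Finset.Icc 1 K, min 1 (m * β) ^ 2 / m ≤ 2 * (1 + Real.log (K * β)) := by
  have hb0 : 0 < 1 / β := by positivity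
  have hK0 : (0 : ℝ) < K := hb0.trans hK
  have hJle : (⌊1 / β⌋₊ : ℝ) ≤ 1 / β := Nat.floor_le hb0.le
  have hJK : ⌊1 / β⌋₊ ≤ K := by exact_mod_cast (hJle.trans hK.le)
  have hL : 0 ≤ Real.log (K * β) := Real.log_nonneg (by
    rw [div_lt_iff₀ hβ] at hK; exact hK.le)
  have h1 : ∑ m ∈ Finset.Ioc 0 ⌊1 / β⌋₊, min 1 ((m : ℝ) * β) ^ 2 / m ≤ 1 := by
    refine sum_Ioc_floor_le hβ zero_le_one fun m hm => ?_
    have hm' : (0 : ℝ) < m := by exact_mod_cast hm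
    rw [div_le_iff₀ hm', one_mul]
    calc min 1 ((m : ℝ) * β) ^ 2 ≤ (m * β) ^ 2 := by gcongr; exact min_le_right _ _
      _ = _ := by ring
  have h2 : ∑ m ∈ Finset.Ioc ⌊1 / β⌋₊ K, min 1 ((m : ℝ) * β) ^ 2 / m ≤
      ∑ m ∈ Finset.Ioc ⌊1 / β⌋₊ K, (1 : ℝ) / m := by
    refine Finset.sum_le_sum fun m _ => ?_
    gcongr
    exact pow_le_one₀ (by positivity) (min_le_left _ _)
  have h3 := (abs_le.1 (abs_sum_inv_Ioc_sub_log_le hβ hβ1 hK)).2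
  have e : Finset.Icc 1 K = Finset.Ioc 0 K := by ext; simp; omega
  rw [e, ← Finset.sum_Ioc_consecutive _ (Nat.zero_le _) hJK]
  linarith

/-- The bound `β ≤ β₀ < 1` keeps `sin(πβ)` comparable with `β`. Near `β = 1` the cosine sum below
would have no cancellation. -/
theorem sin_pi_mul_ge {β₀ : ℝ} (hβ : 0 < β) (hβ0 : β ≤ β₀) (hβ₀ : β₀ < 1) :
    2 * (1 - β₀) * β ≤ Real.sin (Real.pi * β) := by
  have hpi := Real.pi_pos
  rcases le_total β (1 / 2) with h | h
  · have h2 := Real.mul_le_sin (x := Real.pi * β) (by positivity) (by nlinarith)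
    have h3 : 2 / Real.pi * (Real.pi * β) = 2 * β := by field_simp
    nlinarith
  · have h2 := Real.mul_le_sin (x := Real.pi * (1 - β)) (by nlinarith) (by nlinarith)
    have h3 : 2 / Real.pi * (Real.pi * (1 - β)) = 2 * (1 - β) := by field_simp
    have h4 : Real.sin (Real.pi * (1 - β)) = Real.sin (Real.pi * β) := by
      rw [show Real.pi * (1 - β) = Real.pi - Real.pi * β by ring, Real.sin_pi_sub]
    nlinarith

/-- After multiplication by `2 sin(πβ)` each cosine is a difference of consecutive sines. Starting
at `1/β` makes the telescoped bound at most `2β`, which cancels against `sin(πβ)`. -/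
theorem abs_sum_cos_div_le {β₀ : ℝ} (hβ : 0 < β) (hβ0 : β ≤ β₀) (hβ₀ : β₀ < 1) (hK : 1 / β < K) :
    |∑ m ∈ Finset.Ioc ⌊1 / β⌋₊ K, Real.cos (2 * Real.pi * m * β) / m| ≤ 1 / (1 - β₀) := by
  have hb0 : 0 < 1 / β := by positivity
  have hJle : (⌊1 / β⌋₊ : ℝ) ≤ 1 / β := Nat.floor_le hb0.le
  have hJlt : 1 / β < (⌊1 / β⌋₊ : ℝ) + 1 := Nat.lt_floor_add_one _
  have hJK : ⌊1 / β⌋₊ ≤ K := by exact_mod_cast (hJle.trans hK.le)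
  have hs := sin_pi_mul_ge hβ hβ0 hβ₀
  have hs0 : 0 < Real.sin (Real.pi * β) :=
    lt_of_lt_of_le (mul_pos (mul_pos two_pos (by linarith)) hβ) hs
  have h := abs_sum_telescope_div_le (G := fun m => Real.sin ((2 * m + 1) * (Real.pi * β)))
    (fun m => Real.abs_sin_le_one _) hJK
  have e : ∑ m ∈ Finset.Ioc ⌊1 / β⌋₊ K, (Real.sin ((2 * (m : ℝ) + 1) * (Real.pi * β)) -
      Real.sin ((2 * ((m - 1 : ℕ) : ℝ) + 1) * (Real.pi * β))) / m = 2 * Real.sin (Real.pi * β) *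
      ∑ m ∈ Finset.Ioc ⌊1 / β⌋₊ K, Real.cos (2 * Real.pi * m * β) / m := by
    rw [Finset.mul_sum]
    refine Finset.sum_congr rfl fun m hm => ?_
    have hm1 : 1 ≤ m := by have := (Finset.mem_Ioc.1 hm).1; omega
    rw [Nat.cast_sub hm1, Nat.cast_one,
      show (2 * (m : ℝ) + 1) * (Real.pi * β) = 2 * Real.pi * m * β + Real.pi * β by ring,
      show (2 * ((m : ℝ) - 1) + 1) * (Real.pi * β) = 2 * Real.pi * m * β - Real.pi * β by ring,
      Real.sin_add, Real.sin_sub]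
    ring
  rw [e, abs_mul, abs_of_pos (by positivity)] at h
  have h2 : (2 : ℝ) / (⌊1 / β⌋₊ + 1) ≤ 2 * β := by
    rw [div_le_iff₀ (by positivity)]
    rw [div_lt_iff₀ hβ] at hJlt
    linarith
  have h3 : 0 < 1 - β₀ := by linarith
  set S := |∑ m ∈ Finset.Ioc ⌊1 / β⌋₊ K, Real.cos (2 * Real.pi * m * β) / m| with hS
  have hS0 : 0 ≤ S := abs_nonneg _
  rw [le_div_iff₀ h3]
  have h4 : (2 * (1 - β₀) * β) * S ≤ Real.sin (Real.pi * β) * S :=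
    mul_le_mul_of_nonneg_right hs hS0
  have h5 : β * (S * (1 - β₀)) ≤ β * 1 := by nlinarith
  exact le_of_mul_le_mul_left h5 hβ

/-- Beyond `1/β`, `sin² = (1 - cos)/2` separates half a logarithm from an oscillating sum. Below it,
`sin² x ≤ x²` and `π² ≤ 10` bound the sum by 10. -/
theorem abs_sum_sin_sq_div_sub_log_le {β₀ : ℝ} (hβ : 0 < β) (hβ0 : β ≤ β₀) (hβ₀ : β₀ < 1)
    (hK : 1 / β < K) :
    |∑ m ∈ Finset.Icc 1 K, Real.sin (Real.pi * m * β) ^ 2 / m - Real.log (K * β) / 2| ≤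
      11 + 1 / (1 - β₀) := by
  have hb0 : 0 < 1 / β := by positivity
  have hJle : (⌊1 / β⌋₊ : ℝ) ≤ 1 / β := Nat.floor_le hb0.le
  have hJK : ⌊1 / β⌋₊ ≤ K := by exact_mod_cast (hJle.trans hK.le)
  have h1 : ∑ m ∈ Finset.Ioc 0 ⌊1 / β⌋₊, Real.sin (Real.pi * m * β) ^ 2 / m ≤ 10 := by
    refine sum_Ioc_floor_le hβ (by norm_num) fun m hm => ?_
    have hm' : (0 : ℝ) < m := by exact_mod_cast hm
    rw [div_le_iff₀ hm']
    have h2 : Real.sin (Real.pi * m * β) ^ 2 ≤ (Real.pi * m * β) ^ 2 :=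
      sq_le_sq.2 Real.abs_sin_le_abs
    have h3 : Real.pi ^ 2 ≤ 10 := by
      have := Real.pi_lt_d2
      have := Real.pi_pos
      nlinarith
    refine h2.trans ?_
    have : (Real.pi * m * β) ^ 2 = Real.pi ^ 2 * (m * β) ^ 2 := by ring
    rw [this]
    calc _ ≤ 10 * (m * β) ^ 2 := mul_le_mul_of_nonneg_right h3 (sq_nonneg _)
      _ = _ := by ring
  have h1' : 0 ≤ ∑ m ∈ Finset.Ioc 0 ⌊1 / β⌋₊, Real.sin (Real.pi * m * β) ^ 2 / m :=
    Finset.sum_nonneg fun m _ => by positivity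
  have h2 : ∑ m ∈ Finset.Ioc ⌊1 / β⌋₊ K, Real.sin (Real.pi * m * β) ^ 2 / m =
      (∑ m ∈ Finset.Ioc ⌊1 / β⌋₊ K, (1 : ℝ) / m) / 2 -
      (∑ m ∈ Finset.Ioc ⌊1 / β⌋₊ K, Real.cos (2 * Real.pi * m * β) / m) / 2 := by
    rw [Finset.sum_div, Finset.sum_div, ← Finset.sum_sub_distrib]
    refine Finset.sum_congr rfl fun m _ => ?_
    rw [show 2 * Real.pi * m * β = 2 * (Real.pi * m * β) by ring, Real.cos_two_mul, Real.cos_sq']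
    ring
  have h3 := abs_le.1 (abs_sum_inv_Ioc_sub_log_le hβ (hβ0.trans hβ₀.le) hK)
  have h4 := abs_le.1 (abs_sum_cos_div_le hβ hβ0 hβ₀ hK)
  have e : Finset.Icc 1 K = Finset.Ioc 0 K := by ext; simp; omega
  have h5 : 0 < 1 / (1 - β₀) := one_div_pos.2 (by linarith)
  rw [e, ← Finset.sum_Ioc_consecutive _ (Nat.zero_le _) hJK, h2, abs_le]
  constructor <;> linarith

/-- Replacing the weight by `sin(πmβ)/(πm)` changes each of the `K` terms by at most `m · (3/K) ·
(5/m) = 15/K`. This accounts for `26 = 15 + 11`. -/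
theorem abs_sum_mul_selbergWeight_sq_sub_le {β₀ : ℝ} (s : ℤˣ) (hβ : 0 < β) (hβ0 : β ≤ β₀)
    (hβ₀ : β₀ < 1) (hK : 1 / β < K) :
    |∑ m ∈ Finset.Icc 1 K, m * selbergWeight s K β m ^ 2 -
      Real.log (K * β) / (2 * Real.pi ^ 2)| ≤ 26 + 1 / (1 - β₀) := by
  have hb0 : 0 < 1 / β := by positivity
  have hK0 : (0 : ℝ) < K := hb0.trans hK
  have hpi := Real.pi_gt_three
  have hpi2 : 1 ≤ Real.pi ^ 2 := by nlinarith
  have h1 := abs_sum_sin_sq_div_sub_log_le hβ hβ0 hβ₀ hK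
  have h2 : |∑ m ∈ Finset.Icc 1 K, (m * selbergWeight s K β m ^ 2 -
      m * (Real.sin (Real.pi * m * β) / (Real.pi * m)) ^ 2)| ≤ 15 := by
    refine (Finset.abs_sum_le_sum_abs _ _).trans ?_
    refine (Finset.sum_le_card_nsmul _ _ (15 / (K : ℝ)) fun m hm => ?_).trans ?_
    · have hm0 : (0 : ℝ) < m := by exact_mod_cast (Finset.mem_Icc.1 hm).1
      set t := Real.sin (Real.pi * m * β) / (Real.pi * m) with ht
      set g := selbergWeight s K β m with hg
      have e : m * g ^ 2 - m * t ^ 2 = m * ((g - t) * (g + t)) := by ring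
      have h3 : |g - t| ≤ 3 / K := abs_selbergWeight_sub_le s β hm
      have h4 : |g + t| ≤ 5 / m := by
        have := abs_selbergWeight_le_inv s β hm
        have := abs_sin_div_le_inv β m
        have := abs_add_le g t
        have : (5 : ℝ) / m = 4 / m + 1 / m := by ring
        linarith
      rw [e, abs_mul, abs_mul, abs_of_pos hm0]
      calc (m : ℝ) * (|g - t| * |g + t|) ≤ m * (3 / K * (5 / m)) := by gcongr
        _ = 15 / K := by field_simp; norm_num
    · rw [Nat.card_Icc, Nat.add_sub_cancel, nsmul_eq_mul]
      exact (mul_div_cancel₀ _ hK0.ne').le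
  rw [Finset.sum_sub_distrib] at h2
  have h3 : ∑ m ∈ Finset.Icc 1 K, (m : ℝ) * (Real.sin (Real.pi * m * β) / (Real.pi * m)) ^ 2 =
      (∑ m ∈ Finset.Icc 1 K, Real.sin (Real.pi * m * β) ^ 2 / m) / Real.pi ^ 2 := by
    rw [Finset.sum_div]
    refine Finset.sum_congr rfl fun m hm => ?_
    have hm0 : (0 : ℝ) < m := by exact_mod_cast (Finset.mem_Icc.1 hm).1
    have := Real.pi_ne_zero
    field_simp
  rw [h3] at h2
  have h4 : |(∑ m ∈ Finset.Icc 1 K, Real.sin (Real.pi * m * β) ^ 2 / m) / Real.pi ^ 2 -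
      Real.log (K * β) / (2 * Real.pi ^ 2)| ≤ 11 + 1 / (1 - β₀) := by
    rw [← div_div, ← sub_div, abs_div, abs_of_pos (by positivity : 0 < Real.pi ^ 2)]
    exact (div_le_self (abs_nonneg _) hpi2).trans h1
  rw [abs_le] at h2 h4 ⊢
  constructor <;> linarith

end LogarithmicSums

/-! ### Counting places by degree -/

section PlaceSums

theorem sum_pow_le_of_forall_le {y : ℝ} (h0 : 0 ≤ y) (h1 : y < 1) {S : Finset ℕ} {a : ℕ}
    (hS : ∀ k ∈ S, a ≤ k) : ∑ k ∈ S, y ^ k ≤ y ^ a / (1 - y) := by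
  obtain ⟨N, hN⟩ := S.exists_nat_subset_range
  refine le_trans (Finset.sum_le_sum_of_subset_of_nonneg (t := Finset.Ico a N) ?_
    fun _ _ _ => by positivity) (geom_sum_Ico_le_of_lt_one h0 h1)
  exact fun k hk => Finset.mem_Ico.2 ⟨hS k hk, Finset.mem_range.1 (hN hk)⟩

theorem sum_mul_pow_le {y : ℝ} (h0 : 0 ≤ y) (h1 : y < 1) (S : Finset ℕ) :
    ∑ k ∈ S, k * y ^ k ≤ 1 / (1 - y) ^ 2 := by
  have h := hasSum_coe_mul_geometric_of_norm_lt_one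
    (show ‖y‖ < 1 by rwa [Real.norm_of_nonneg h0])
  refine (sum_le_hasSum S (fun _ _ => by positivity) h).trans ?_
  gcongr

variable (F : Type*) [Field F] [Finite F]

/-- The number of monic irreducible polynomials of degree `m`, for `m ≤ K`. -/
def placeCount (K m : ℕ) : ℕ := ((places F K).filter fun P => P.natDegree = m).card

/-- The inverse square root of the cardinality of `F`. -/
def sqrtInv : ℝ := (Real.sqrt (Nat.card F))⁻¹

theorem sqrtInv_pos : 0 < sqrtInv F := by
  have : (0 : ℝ) < Nat.card F := by exact_mod_cast Nat.card_pos
  unfold sqrtInv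
  positivity

theorem sqrtInv_lt_one : sqrtInv F < 1 := by
  have : (1 : ℝ) < Nat.card F := by exact_mod_cast Finite.one_lt_card
  exact inv_lt_one_of_one_lt₀ (Real.lt_sqrt_of_sq_lt (by simpa using this))

theorem card_pow_mul_sqrtInv_pow (m : ℕ) : (Nat.card F : ℝ) ^ m * sqrtInv F ^ (2 * m) = 1 := by
  have : (0 : ℝ) < Nat.card F := by exact_mod_cast Nat.card_pos
  rw [pow_mul, ← mul_pow, sqrtInv, inv_pow, Real.sq_sqrt this.le, mul_inv_cancel₀ this.ne', one_pow]

variable {F}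

theorem natDegree_mem_Icc {K : ℕ} {P : F[X]} (hP : P ∈ places F K) :
    P.natDegree ∈ Finset.Icc 1 K := by
  have := mem_places.1 hP
  exact Finset.mem_Icc.2 ⟨this.2.1.natDegree_pos, this.2.2⟩

theorem sum_places_eq {R : Type*} [Semiring R] {K : ℕ} (f : ℕ → R) :
    ∑ P ∈ places F K, f P.natDegree = ∑ m ∈ Finset.Icc 1 K, placeCount F K m * f m := by
  rw [← Finset.sum_fiberwise_of_maps_to fun P hP => natDegree_mem_Icc hP]
  refine Finset.sum_congr rfl fun m _ => ?_
  rw [Finset.sum_congr rfl fun P hP => by rw [(Finset.mem_filter.1 hP).2], Finset.sum_const,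
    nsmul_eq_mul, placeCount]

theorem mul_placeCount_le {K m : ℕ} (hm : m ∈ Finset.Icc 1 K) :
    m * placeCount F K m ≤ Nat.card F ^ m := by
  obtain ⟨hm1, hmK⟩ := Finset.mem_Icc.1 hm
  rw [← sum_natDegree_places hm1 hmK, placeCount, mul_comm, ← smul_eq_mul, ← Finset.sum_const]
  rw [Finset.sum_congr rfl fun P hP => ((Finset.mem_filter.1 hP).2).symm]
  refine Finset.sum_le_sum_of_subset fun P hP => ?_
  rw [Finset.mem_filter] at hP ⊢
  exact ⟨hP.1, hP.2.dvd⟩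

/-- In Gauss's count a divisor of `m` other than `m` is at most `m / 2`. The degrees up to `m / 2`
together contribute at most a geometric sum, which is below twice its last term. -/
theorem card_pow_le_mul_placeCount {K m : ℕ} (hm : m ∈ Finset.Icc 1 K) :
    Nat.card F ^ m ≤ m * placeCount F K m + 2 * Nat.card F ^ (m / 2) := by
  obtain ⟨hm1, hmK⟩ := Finset.mem_Icc.1 hm
  have hq : 2 ≤ Nat.card F := Finite.one_lt_card
  have h1 : Nat.card F ^ m ≤ ∑ P ∈ places F K, ((if P.natDegree = m then P.natDegree else 0) +
      if P.natDegree ≤ m / 2 then P.natDegree else 0) := by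
    rw [← sum_natDegree_places hm1 hmK, Finset.sum_filter]
    refine Finset.sum_le_sum fun P hP => ?_
    split_ifs with hd h2 h3 h3
    all_goals try omega
    obtain ⟨c, hc⟩ := hd
    exfalso
    rcases Nat.lt_or_ge c 2 with h | h
    · interval_cases c <;> omega
    · refine h3 ((Nat.le_div_iff_mul_le two_pos).2 ?_)
      rw [hc]
      exact Nat.mul_le_mul_left _ h
  have h2 : ∑ P ∈ places F K, (if P.natDegree = m then P.natDegree else 0) =
      m * placeCount F K m := by
    rw [← Finset.sum_filter, Finset.sum_congr rfl fun P hP => (Finset.mem_filter.1 hP).2,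
      Finset.sum_const, smul_eq_mul, mul_comm, placeCount]
  have h3 : ∑ P ∈ places F K, (if P.natDegree ≤ m / 2 then P.natDegree else 0) ≤
      2 * Nat.card F ^ (m / 2) := by
    rw [sum_places_eq (fun d => if d ≤ m / 2 then d else 0)]
    simp only [Nat.cast_id]
    have h4 : ∑ d ∈ Finset.range (m / 2), Nat.card F ^ d < Nat.card F ^ (m / 2) :=
      Nat.geomSum_lt hq fun k hk => Finset.mem_range.1 hk
    have h5 : ∑ d ∈ Finset.Icc 1 K, placeCount F K d * (if d ≤ m / 2 then d else 0) ≤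
        ∑ d ∈ Finset.range (m / 2 + 1), Nat.card F ^ d := by
      refine le_trans (Finset.sum_le_sum (g := fun d => if d ≤ m / 2 then Nat.card F ^ d else 0)
        fun d hd => ?_) ?_
      · split_ifs
        · rw [mul_comm]
          exact mul_placeCount_le hd
        · simp
      · rw [← Finset.sum_filter]
        refine Finset.sum_le_sum_of_subset fun d hd => ?_
        rw [Finset.mem_range]
        have := (Finset.mem_filter.1 hd).2
        omega
    rw [Finset.sum_range_succ] at h5
    omega
  rw [Finset.sum_add_distrib, h2] at h1
  omega

/-- At most `q^m / m` places have degree `m`, so the weight `q^{-m}` turns a sum over places into a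
harmonically weighted sum over degrees. -/
theorem sum_places_mul_le {K : ℕ} {f : ℕ → ℝ} (hf : ∀ m ∈ Finset.Icc 1 K, 0 ≤ f m) :
    ∑ P ∈ places F K, f P.natDegree * sqrtInv F ^ (2 * P.natDegree) ≤
      ∑ m ∈ Finset.Icc 1 K, f m / m := by
  rw [sum_places_eq (fun m => f m * sqrtInv F ^ (2 * m))]
  refine Finset.sum_le_sum fun m hm => ?_
  have hm0 : (0 : ℝ) < m := by exact_mod_cast (Finset.mem_Icc.1 hm).1
  have h1 : (m : ℝ) * placeCount F K m ≤ (Nat.card F : ℝ) ^ m := by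
    exact_mod_cast mul_placeCount_le (F := F) hm
  have h2 := card_pow_mul_sqrtInv_pow F m
  have hy := sqrtInv_pos F
  rw [le_div_iff₀ hm0]
  calc _ = f m * ((m * placeCount F K m) * sqrtInv F ^ (2 * m)) := by ring
    _ ≤ f m * ((Nat.card F : ℝ) ^ m * sqrtInv F ^ (2 * m)) := by
      have := hf m hm
      gcongr
    _ = f m := by rw [h2, mul_one]

theorem abs_mul_placeCount_sub_one_le {K m : ℕ} (hm : m ∈ Finset.Icc 1 K) :
    |m * placeCount F K m * sqrtInv F ^ (2 * m) - 1| ≤ 2 * sqrtInv F ^ m := by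
  have h1 : (m : ℝ) * placeCount F K m ≤ (Nat.card F : ℝ) ^ m := by
    exact_mod_cast mul_placeCount_le (F := F) hm
  have h2 : (Nat.card F : ℝ) ^ m ≤ m * placeCount F K m + 2 * (Nat.card F : ℝ) ^ (m / 2) := by
    exact_mod_cast card_pow_le_mul_placeCount (F := F) hm
  have h3 := card_pow_mul_sqrtInv_pow F m
  have h4 := card_pow_mul_sqrtInv_pow F (m / 2)
  have hy := sqrtInv_pos F
  have hy1 := sqrtInv_lt_one F
  have h5 : (Nat.card F : ℝ) ^ (m / 2) * sqrtInv F ^ (2 * m) ≤ sqrtInv F ^ m := by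
    have e : sqrtInv F ^ (2 * m) =
        sqrtInv F ^ (2 * (m / 2)) * sqrtInv F ^ (2 * m - 2 * (m / 2)) := by
      rw [← pow_add]
      congr 1
      omega
    rw [e, ← mul_assoc, h4, one_mul]
    exact pow_le_pow_of_le_one hy.le hy1.le (by omega)
  have hp : 0 ≤ sqrtInv F ^ (2 * m) := by positivity
  have h6 := mul_le_mul_of_nonneg_right h1 hp
  have h7 := mul_le_mul_of_nonneg_right h2 hp
  rw [abs_le]
  constructor
  · nlinarith
  · have : 0 ≤ sqrtInv F ^ m := by positivity
    linarith

end PlaceSums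

/-! ### The random variable attached to one place -/

section PlaceVariables

variable {p : ℕ} [Fact p.Prime] {ψ : AddChar (ZMod p) ℂ}

theorem expect_addChar_mul (hψ : ψ ≠ 1) (b : ZMod p) :
    𝔼 t, ψ (b * t) = if b = 0 then 1 else 0 := by
  have hp : (p : ℂ) ≠ 0 := by exact_mod_cast (Fact.out : p.Prime).ne_zero
  have h := AddChar.sum_mulShift b (AddChar.IsPrimitive.of_ne_one hψ)
  rw [Fintype.expect_eq_sum_div_card]
  simp only [mul_comm b, h, ZMod.card]
  split_ifs <;> simp [hp]

/-- The contribution of a place of degree `m` to a weighted sum of exponential sums, as a function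
of the residue trace `t`. -/
def placeVar (ψ : AddChar (ZMod p) ℂ) (K : ℕ) (g : ℕ → ℝ) (y : ℝ) (m : ℕ) (a t : ZMod p) : ℂ :=
  ∑ k ∈ Finset.Icc 1 K with m ∣ k, ((m * (g k * y ^ k) : ℝ) : ℂ) * ψ (a * ((k / m : ℕ) * t))

/-- The part of `placeVar` coming from multiples of `m` other than `m` itself. -/
def placeTail (ψ : AddChar (ZMod p) ℂ) (K : ℕ) (g : ℕ → ℝ) (y : ℝ) (m : ℕ) (a t : ZMod p) : ℂ :=
  ∑ k ∈ (Finset.Icc 1 K).filter (m ∣ ·) \ {m},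
    ((m * (g k * y ^ k) : ℝ) : ℂ) * ψ (a * ((k / m : ℕ) * t))

variable {K : ℕ} {g : ℕ → ℝ} {y β : ℝ} {m : ℕ}

theorem placeVar_eq_add_tail (hm : m ∈ Finset.Icc 1 K) (a t : ZMod p) :
    placeVar ψ K g y m a t = ((m * (g m * y ^ m) : ℝ) : ℂ) * ψ (a * t) +
      placeTail ψ K g y m a t := by
  have hm1 := (Finset.mem_Icc.1 hm).1
  unfold placeVar placeTail
  rw [Finset.sdiff_singleton_eq_erase, ← Finset.add_sum_erase _ _
    (Finset.mem_filter.2 ⟨hm, dvd_rfl⟩), Nat.div_self hm1, Nat.cast_one, one_mul]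

/-- Since `m ≤ k`, the product `m |g k|` is at most `4 min(1, mβ)`. What remains is a geometric
series starting at `y ^ m`. -/
theorem norm_placeVar_le (hy0 : 0 < y) (hy1 : y < 1) (hβ : 0 < β)
    (hg1 : ∀ k ∈ Finset.Icc 1 K, |g k| ≤ 4 / k) (hg2 : ∀ k ∈ Finset.Icc 1 K, |g k| ≤ 4 * β)
    (hm : m ∈ Finset.Icc 1 K) (a t : ZMod p) :
    ‖placeVar ψ K g y m a t‖ ≤ 4 / (1 - y) * (y ^ m * min 1 (m * β)) := by
  have hm0 : (0 : ℝ) < m := by exact_mod_cast (Finset.mem_Icc.1 hm).1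
  have hmin : 0 ≤ min 1 (m * β) := by positivity
  refine (norm_sum_le_of_le (f := _) (n := fun k => 4 * min 1 (m * β) * y ^ k) _
    fun k hk => ?_).trans ?_
  · obtain ⟨hkK, hmk⟩ := Finset.mem_filter.1 hk
    have hk1 := (Finset.mem_Icc.1 hkK).1
    have hk0 : (0 : ℝ) < k := by exact_mod_cast hk1
    have hle : (m : ℝ) ≤ k := by exact_mod_cast Nat.le_of_dvd hk1 hmk
    rw [norm_mul, AddChar.norm_apply, mul_one, Complex.norm_real, Real.norm_eq_abs, abs_mul, abs_mul,
      abs_of_pos hm0, abs_of_pos (pow_pos hy0 k), ← mul_assoc]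
    refine mul_le_mul_of_nonneg_right ?_ (by positivity)
    rw [mul_min_of_nonneg _ _ (by norm_num : (0 : ℝ) ≤ 4)]
    refine le_min ?_ ?_
    · calc (m : ℝ) * |g k| ≤ k * (4 / k) := by
            have := hg1 k hkK
            gcongr
        _ = 4 * 1 := by field_simp
    · calc (m : ℝ) * |g k| ≤ m * (4 * β) := by
            have := hg2 k hkK
            gcongr
        _ = 4 * (m * β) := by ring
  · rw [← Finset.mul_sum]
    have h := sum_pow_le_of_forall_le hy0.le hy1 (S := (Finset.Icc 1 K).filter (m ∣ ·)) (a := m)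
      fun k hk => by
        obtain ⟨hkK, hmk⟩ := Finset.mem_filter.1 hk
        exact Nat.le_of_dvd (Finset.mem_Icc.1 hkK).1 hmk
    calc _ ≤ 4 * min 1 (m * β) * (y ^ m / (1 - y)) := by gcongr
      _ = _ := by ring

theorem norm_placeTail_le (hy0 : 0 < y) (hy1 : y < 1) (hβ : 0 < β)
    (hg2 : ∀ k ∈ Finset.Icc 1 K, |g k| ≤ 4 * β) (hm : m ∈ Finset.Icc 1 K) (a t : ZMod p) :
    ‖placeTail ψ K g y m a t‖ ≤ 4 / (1 - y) * (m * β * y ^ (2 * m)) := by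
  have hm0 : (0 : ℝ) < m := by exact_mod_cast (Finset.mem_Icc.1 hm).1
  refine (norm_sum_le_of_le (f := _) (n := fun k => 4 * (m * β) * y ^ k) _
    fun k hk => ?_).trans ?_
  · obtain ⟨hkK, hmk⟩ := Finset.mem_filter.1 (Finset.mem_sdiff.1 hk).1
    rw [norm_mul, AddChar.norm_apply, mul_one, Complex.norm_real, Real.norm_eq_abs, abs_mul, abs_mul,
      abs_of_pos hm0, abs_of_pos (pow_pos hy0 k), ← mul_assoc]
    refine mul_le_mul_of_nonneg_right ?_ (by positivity)
    calc (m : ℝ) * |g k| ≤ m * (4 * β) := by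
            have := hg2 k hkK
            gcongr
        _ = 4 * (m * β) := by ring
  · rw [← Finset.mul_sum]
    have h := sum_pow_le_of_forall_le hy0.le hy1 (S := (Finset.Icc 1 K).filter (m ∣ ·) \ {m})
      (a := 2 * m) fun k hk => by
        obtain ⟨hk1, hk2⟩ := Finset.mem_sdiff.1 hk
        obtain ⟨hkK, ⟨c, rfl⟩⟩ := Finset.mem_filter.1 hk1
        have hpos := (Finset.mem_Icc.1 hkK).1
        have hc : 2 ≤ c := by
          by_contra hlt
          have : c = 0 ∨ c = 1 := by omega
          rcases this with rfl | rfl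
          · omega
          · simp at hk2
        rw [mul_comm]
        exact Nat.mul_le_mul_left m hc
    calc _ ≤ 4 * (m * β) * (y ^ (2 * m) / (1 - y)) := by gcongr
      _ = _ := by ring

theorem expect_placeVar (hψ : ψ ≠ 1) {a : ZMod p} (ha : a ≠ 0) :
    𝔼 t, placeVar ψ K g y m a t = ∑ k ∈ Finset.Icc 1 K with m ∣ k,
      ((m * (g k * y ^ k) : ℝ) : ℂ) * if p ∣ k / m then 1 else 0 := by
  unfold placeVar
  rw [Finset.expect_sum_comm]
  refine Finset.sum_congr rfl fun k _ => ?_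
  simp only [← Finset.mul_expect, ← mul_assoc a]
  rw [expect_addChar_mul hψ]
  simp only [mul_eq_zero, ha, false_or, ZMod.natCast_eq_zero_iff]

/-- The centred version of `placeVar`. -/
def placeDev (ψ : AddChar (ZMod p) ℂ) (K : ℕ) (g : ℕ → ℝ) (y : ℝ) (m : ℕ) (a t : ZMod p) : ℂ :=
  placeVar ψ K g y m a t - 𝔼 t, placeVar ψ K g y m a t

theorem expect_placeDev (a : ZMod p) : 𝔼 t, placeDev ψ K g y m a t = 0 := by
  unfold placeDev
  rw [Finset.expect_sub_distrib, Fintype.expect_const, sub_self]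

theorem norm_placeDev_le (hy0 : 0 < y) (hy1 : y < 1) (hβ : 0 < β)
    (hg1 : ∀ k ∈ Finset.Icc 1 K, |g k| ≤ 4 / k) (hg2 : ∀ k ∈ Finset.Icc 1 K, |g k| ≤ 4 * β)
    (hm : m ∈ Finset.Icc 1 K) (a t : ZMod p) :
    ‖placeDev ψ K g y m a t‖ ≤ 8 / (1 - y) * (y ^ m * min 1 (m * β)) := by
  have h := norm_placeVar_le (ψ := ψ) hy0 hy1 hβ hg1 hg2 hm a
  refine (norm_sub_le _ _).trans ((add_le_add (h t) (norm_expect_le h)).trans (le_of_eq ?_))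
  ring

/-- The leading term is a non-trivial character and already has mean zero, so centring affects only
the tail. -/
theorem placeDev_eq (hψ : ψ ≠ 1) (hm : m ∈ Finset.Icc 1 K) {a : ZMod p} (ha : a ≠ 0)
    (t : ZMod p) : placeDev ψ K g y m a t = ((m * (g m * y ^ m) : ℝ) : ℂ) * ψ (a * t) +
      (placeTail ψ K g y m a t - 𝔼 t, placeTail ψ K g y m a t) := by
  unfold placeDev
  simp only [placeVar_eq_add_tail hm]
  rw [Finset.expect_add_distrib, ← Finset.mul_expect, expect_addChar_mul hψ, if_neg ha]
  ring

/-- The two leading terms multiply to the character `ψ((a + b)t)`, whose mean detects `a + b = 0`.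
Every other product contains a tail and hence at least `y ^ (3 * m)`. The constant is `128 = 32 + 32
+ 64`. -/
theorem norm_expect_placeDev_mul_sub_le (hψ : ψ ≠ 1) (hy0 : 0 < y) (hy1 : y < 1) (hβ : 0 < β)
    (hβ1 : β ≤ 1) (hg2 : ∀ k ∈ Finset.Icc 1 K, |g k| ≤ 4 * β)
    (hm : m ∈ Finset.Icc 1 K) {a b : ZMod p} (ha : a ≠ 0) (hb : b ≠ 0) :
    ‖𝔼 t, placeDev ψ K g y m a t * placeDev ψ K g y m b t -
      (if a + b = 0 then (((m * (g m * y ^ m)) ^ 2 : ℝ) : ℂ) else 0)‖ ≤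
      128 / (1 - y) ^ 2 * (m ^ 2 * y ^ (3 * m)) := by
  have hm0 : (0 : ℝ) < m := by exact_mod_cast (Finset.mem_Icc.1 hm).1
  have hy2 : 0 < 1 - y := by linarith
  set x : ℝ := m * (g m * y ^ m) with hx
  let R : ZMod p → ZMod p → ℂ := fun a t =>
    placeTail ψ K g y m a t - 𝔼 t, placeTail ψ K g y m a t
  have hxle : |x| ≤ 4 * (m * y ^ m) := by
    rw [hx, abs_mul, abs_mul, abs_of_pos hm0, abs_of_pos (pow_pos hy0 m)]
    have := hg2 m hm
    have h4 : |g m| ≤ 4 := by linarith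
    calc (m : ℝ) * (|g m| * y ^ m) ≤ m * (4 * y ^ m) := by gcongr
      _ = _ := by ring
  have hR (a t : ZMod p) : ‖R a t‖ ≤ 8 / (1 - y) * (m * y ^ (2 * m)) := by
    have h := norm_placeTail_le (ψ := ψ) hy0 hy1 hβ hg2 hm a
    have h2 : 4 / (1 - y) * (m * β * y ^ (2 * m)) ≤ 4 / (1 - y) * (m * 1 * y ^ (2 * m)) := by
      gcongr
    refine (norm_sub_le _ _).trans ((add_le_add ((h t).trans h2)
      (norm_expect_le fun t => (h t).trans h2)).trans (le_of_eq ?_))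
    ring
  have hmain : (if a + b = 0 then ((x ^ 2 : ℝ) : ℂ) else 0) =
      𝔼 t, (x : ℂ) * ψ (a * t) * ((x : ℂ) * ψ (b * t)) := by
    have e (t : ZMod p) : (x : ℂ) * ψ (a * t) * ((x : ℂ) * ψ (b * t)) =
        ((x ^ 2 : ℝ) : ℂ) * ψ ((a + b) * t) := by
      rw [add_mul, AddChar.map_add_eq_mul]
      push_cast
      ring
    simp only [e]
    rw [← Finset.mul_expect, expect_addChar_mul hψ]
    split_ifs <;> simp
  rw [hmain, ← Finset.expect_sub_distrib]
  refine norm_expect_le fun t => ?_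
  rw [placeDev_eq hψ hm ha, placeDev_eq hψ hm hb]
  change ‖((x : ℂ) * ψ (a * t) + R a t) * ((x : ℂ) * ψ (b * t) + R b t) -
    (x : ℂ) * ψ (a * t) * ((x : ℂ) * ψ (b * t))‖ ≤ _
  have e : ((x : ℂ) * ψ (a * t) + R a t) * ((x : ℂ) * ψ (b * t) + R b t) -
      (x : ℂ) * ψ (a * t) * ((x : ℂ) * ψ (b * t)) =
      (x : ℂ) * ψ (a * t) * R b t + R a t * ((x : ℂ) * ψ (b * t)) + R a t * R b t := by ring
  have hxψ (a : ZMod p) : ‖(x : ℂ) * ψ (a * t)‖ ≤ 4 * (m * y ^ m) := by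
    rwa [norm_mul, AddChar.norm_apply, mul_one, Complex.norm_real]
  rw [e]
  refine (norm_add₃_le).trans ?_
  rw [norm_mul, norm_mul _ (_ * _), norm_mul (R a t)]
  have h1 := mul_le_mul (hxψ a) (hR b t) (norm_nonneg _) (by positivity)
  have h2 := mul_le_mul (hR a t) (hxψ b) (norm_nonneg _) (by positivity)
  have h3 := mul_le_mul (hR a t) (hR b t) (norm_nonneg _) (by positivity)
  refine (add_le_add (add_le_add h1 h2) h3).trans ?_
  have h4 : 4 * (m * y ^ m) * (8 / (1 - y) * (m * y ^ (2 * m))) ≤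
      32 / (1 - y) ^ 2 * (m ^ 2 * y ^ (3 * m)) := by
    have : 8 / (1 - y) ≤ 8 / (1 - y) ^ 2 := by
      gcongr
      nlinarith
    calc _ = 4 * (8 / (1 - y)) * (m ^ 2 * y ^ (3 * m)) := by
          rw [show 3 * m = m + 2 * m by ring, pow_add]; ring
      _ ≤ 4 * (8 / (1 - y) ^ 2) * (m ^ 2 * y ^ (3 * m)) := by gcongr
      _ = _ := by ring
  have h5 : 8 / (1 - y) * (m * y ^ (2 * m)) * (8 / (1 - y) * (m * y ^ (2 * m))) ≤
      64 / (1 - y) ^ 2 * (m ^ 2 * y ^ (3 * m)) := by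
    have : y ^ (4 * m) ≤ y ^ (3 * m) := pow_le_pow_of_le_one hy0.le hy1.le (by omega)
    calc _ = 64 / (1 - y) ^ 2 * (m ^ 2 * y ^ (4 * m)) := by
          rw [show 4 * m = 2 * m + 2 * m by ring, pow_add]; field_simp; norm_num
      _ ≤ _ := by gcongr
  have h6 : 8 / (1 - y) * (m * y ^ (2 * m)) * (4 * (m * y ^ m)) =
    4 * (m * y ^ m) * (8 / (1 - y) * (m * y ^ (2 * m))) := mul_comm _ _
  rw [h6]
  calc _ ≤ _ := add_le_add (add_le_add h4 h4) h5
    _ = _ := by ring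

end PlaceVariables

/-! ### The mean and the constant `C` -/

section Mean

/-- The ratio `q^{-(1/2 - 1/p)}` of the series defining `constC`. -/
def meanRatio (p q : ℕ) : ℝ := (q : ℝ) ^ (-(1 / 2 - 1 / (p : ℝ)))

/-- The common mean of the sums over places. -/
def meanSum (p q K : ℕ) (g : ℕ → ℝ) : ℝ :=
  ∑ k ∈ Finset.Icc 1 K, g k * if p ∣ k then meanRatio p q ^ k else 0

theorem meanRatio_pos (p : ℕ) {q : ℕ} (hq : 1 < q) : 0 < meanRatio p q := by
  have : (0 : ℝ) < q := by exact_mod_cast (zero_lt_one.trans hq)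
  unfold meanRatio
  positivity

/-- Oddness of `p` makes `1/2 - 1/p` positive, so that the series for the mean converges
geometrically. -/
theorem meanRatio_lt_one {p q : ℕ} (hp : 2 < p) (hq : 1 < q) : meanRatio p q < 1 := by
  refine Real.rpow_lt_one_of_one_lt_of_neg (by exact_mod_cast hq) ?_
  have h2 : (2 : ℝ) < p := by exact_mod_cast hp
  have : 1 / (p : ℝ) < 1 / 2 := by gcongr
  linarith

theorem sqrtInv_pow_mul_card_pow (F : Type*) [Field F] [Finite F] (p : ℕ) (hp : 0 < p) (l : ℕ) :
    sqrtInv F ^ (p * l) * (Nat.card F : ℝ) ^ l = meanRatio p (Nat.card F) ^ (p * l) := by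
  have hq : (0 : ℝ) < Nat.card F := by exact_mod_cast Nat.card_pos
  have hp' : (p : ℝ) ≠ 0 := by exact_mod_cast hp.ne'
  rw [meanRatio, sqrtInv, Real.sqrt_eq_rpow, ← Real.rpow_neg hq.le, ← Real.rpow_natCast,
    ← Real.rpow_natCast, ← Real.rpow_natCast, ← Real.rpow_mul hq.le, ← Real.rpow_mul hq.le,
    ← Real.rpow_add hq]
  congr 1
  push_cast
  field_simp
  ring

variable {F : Type*} [Field F] [Finite F] {p : ℕ} [Fact p.Prime] {ψ : AddChar (ZMod p) ℂ}

/-- A term survives only if `p ∣ k / deg P`. For `k = p * l` this means `deg P ∣ l`, and these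
degrees sum to `q ^ l`, which explains the ratio `q^{-(1/2 - 1/p)}`. The result does not depend on
`a`. -/
theorem sum_expect_placeVar (hψ : ψ ≠ 1) (K : ℕ) (g : ℕ → ℝ) {a : ZMod p} (ha : a ≠ 0) :
    ∑ P : places F K, 𝔼 t, placeVar ψ K g (sqrtInv F) P.1.natDegree a t =
      (meanSum p (Nat.card F) K g : ℂ) := by
  have hp0 : 0 < p := (Fact.out : p.Prime).pos
  simp only [expect_placeVar hψ ha]
  rw [Finset.sum_coe_sort (places F K) (fun P => ∑ k ∈ Finset.Icc 1 K with P.natDegree ∣ k,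
      ((P.natDegree * (g k * sqrtInv F ^ k) : ℝ) : ℂ) * if p ∣ k / P.natDegree then 1 else 0)]
  simp only [Finset.sum_filter]
  rw [Finset.sum_comm, meanSum, Complex.ofReal_sum]
  refine Finset.sum_congr rfl fun k hk => ?_
  obtain ⟨hk1, hkK⟩ := Finset.mem_Icc.1 hk
  split_ifs with hpk
  · obtain ⟨l, rfl⟩ := hpk
    have hl : 0 < l := Nat.pos_of_mul_pos_left hk1
    have hlK : l ≤ K := (Nat.le_mul_of_pos_left l hp0).trans hkK
    have hiff (P : F[X]) (hP : P ∈ places F K) :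
        (P.natDegree ∣ p * l ∧ p ∣ p * l / P.natDegree) ↔ P.natDegree ∣ l := by
      have hm := (Finset.mem_Icc.1 (natDegree_mem_Icc hP)).1
      constructor
      · rintro ⟨⟨c, hc⟩, h⟩
        rw [hc, Nat.mul_div_cancel_left _ hm] at h
        obtain ⟨e, rfl⟩ := h
        refine ⟨e, Nat.eq_of_mul_eq_mul_left hp0 ?_⟩
        rw [hc]
        ring
      · rintro ⟨c, rfl⟩
        rw [mul_left_comm, Nat.mul_div_cancel_left _ hm]
        exact ⟨dvd_mul_right _ _, dvd_mul_right _ _⟩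
    have hterm (P : F[X]) (hP : P ∈ places F K) : (if P.natDegree ∣ p * l then
        ((P.natDegree * (g (p * l) * sqrtInv F ^ (p * l)) : ℝ) : ℂ) *
          (if p ∣ p * l / P.natDegree then 1 else 0) else 0) =
        ((g (p * l) * sqrtInv F ^ (p * l) : ℝ) : ℂ) *
          ((if P.natDegree ∣ l then P.natDegree else 0 : ℕ) : ℂ) := by
      simp only [← hiff P hP]
      by_cases h1 : P.natDegree ∣ p * l <;> by_cases h2 : p ∣ p * l / P.natDegree
      · rw [if_pos h1, if_pos h2, if_pos ⟨h1, h2⟩]; push_cast; ring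
      · rw [if_pos h1, if_neg h2, if_neg fun h => h2 h.2]; simp
      · rw [if_neg h1, if_neg fun h => h1 h.1]; simp
      · rw [if_neg h1, if_neg fun h => h1 h.1]; simp
    rw [Finset.sum_congr rfl hterm, ← Finset.mul_sum, ← Nat.cast_sum, ← Finset.sum_filter,
      sum_natDegree_places hl hlK, ← sqrtInv_pow_mul_card_pow F p hp0]
    push_cast
    ring
  · rw [mul_zero, Complex.ofReal_zero]
    refine Finset.sum_eq_zero fun P _ => ?_
    split_ifs with h1 h2
    · exact absurd (h2.trans (Nat.div_dvd_of_dvd h1)) hpk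
    all_goals simp

variable {q K : ℕ} {β : ℝ}

omit [Fact p.Prime] in
theorem abs_meanSum_le (hp : 2 < p) (hq : 1 < q) {g : ℕ → ℝ} (hβ : 0 < β)
    (hg : ∀ k ∈ Finset.Icc 1 K, |g k| ≤ 4 * β) :
    |meanSum p q K g| ≤ 4 / (1 - meanRatio p q) * β := by
  have hz0 := meanRatio_pos p hq
  have hz1 := meanRatio_lt_one hp hq
  refine (Finset.abs_sum_le_sum_abs _ _).trans ?_
  refine (Finset.sum_le_sum (g := fun k => 4 * β * meanRatio p q ^ k) fun k hk => ?_).trans ?_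
  · rw [abs_mul]
    refine mul_le_mul (hg k hk) ?_ (abs_nonneg _) (by positivity)
    split_ifs
    · rw [abs_of_pos (by positivity)]
    · rw [abs_zero]; positivity
  · rw [← Finset.mul_sum]
    have h := sum_pow_le_of_forall_le hz0.le hz1 (S := Finset.Icc 1 K) (a := 0)
      fun k _ => Nat.zero_le k
    rw [pow_zero] at h
    calc _ ≤ 4 * β * (1 / (1 - meanRatio p q)) := by gcongr
      _ = _ := by ring

omit [Fact p.Prime] in
theorem abs_meanSum_sub_constC_le (hp : 2 < p) (hq : 1 < q) (s : ℤˣ) (hβ : 0 < β)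
    (hK : 1 / β < K) :
    |meanSum p q K (selbergWeight s K β) - constC p q β| ≤
      3 / (1 - meanRatio p q) * (β / (1 + Real.log (K * β))) := by
  have hz0 := meanRatio_pos p hq
  have hz1 := meanRatio_lt_one hp hq
  have hK0 : (0 : ℝ) < K := lt_trans (by positivity) hK
  have hKβ : 1 < K * β := by rwa [div_lt_iff₀ hβ] at hK
  set z := meanRatio p q with hz
  let e : ℕ → ℝ := fun k => if p ∣ k then z ^ k else 0
  have he0 (k : ℕ) : 0 ≤ e k := by
    simp only [e]
    split_ifs <;> positivity
  have he1 (k : ℕ) : e k ≤ z ^ k := by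
    simp only [e]
    split_ifs
    · exact le_rfl
    · positivity
  let t : ℕ → ℝ := fun k => Real.sin (Real.pi * k * β) / (Real.pi * k)
  -- Extending the weight by zero merges truncation and approximation into one comparison of series:
  -- each coefficient is off by at most `3/K`, also for `k > K`.
  let g : ℕ → ℝ := fun k => if k ≤ K then selbergWeight s K β k else 0
  have hC : constC p q β = ∑' j : ℕ, t (j + 1) * e (j + 1) := by
    have hq0 : (0 : ℝ) ≤ q := Nat.cast_nonneg q
    unfold constC
    refine tsum_congr fun j => ?_
    have hpow : (q : ℝ) ^ (-((1 / 2 - 1 / (p : ℝ)) * ((j + 1 : ℕ) : ℝ))) = z ^ (j + 1) := by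
      rw [hz, meanRatio, ← Real.rpow_natCast, ← Real.rpow_mul hq0, neg_mul]
    rw [hpow, mul_assoc]
    simp only [t, e]
    split_ifs <;> simp
  have hM : HasSum (fun j => g (j + 1) * e (j + 1)) (meanSum p q K (selbergWeight s K β)) := by
    have h : meanSum p q K (selbergWeight s K β) =
        ∑ j ∈ Finset.range K, g (j + 1) * e (j + 1) := by
      unfold meanSum
      refine Finset.sum_nbij' (· - 1) (· + 1) ?_ ?_ ?_ ?_ ?_
      · intro k hk
        have := Finset.mem_Icc.1 hk
        exact Finset.mem_range.2 (by omega)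
      · intro j hj
        have := Finset.mem_range.1 hj
        exact Finset.mem_Icc.2 (by omega)
      · intro k hk
        have := Finset.mem_Icc.1 hk
        change k - 1 + 1 = k
        omega
      · intro j _
        rfl
      · intro k hk
        have h2 := Finset.mem_Icc.1 hk
        have h3 : k - 1 + 1 = k := by omega
        simp only [h3, g, e, if_pos h2.2]
        rfl
    rw [h]
    refine hasSum_sum_of_ne_finset_zero fun j hj => ?_
    have : ¬ j + 1 ≤ K := by simpa using hj
    simp only [g, if_neg this, zero_mul]
  have hgeo : Summable fun j : ℕ => z ^ (j + 1) :=
    (summable_nat_add_iff 1).2 (summable_geometric_of_lt_one hz0.le hz1)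
  have hts : Summable fun j => t (j + 1) * e (j + 1) := by
    refine Summable.of_norm_bounded (g := fun j => β * z ^ (j + 1)) (hgeo.mul_left β) fun j => ?_
    rw [norm_mul, Real.norm_eq_abs, Real.norm_of_nonneg (he0 _)]
    exact mul_le_mul (abs_sin_div_le_beta hβ.le _) (he1 _) (he0 _) hβ.le
  have hd (j : ℕ) : ‖g (j + 1) * e (j + 1) - t (j + 1) * e (j + 1)‖ ≤ 3 / K * z ^ (j + 1) := by
    rw [← sub_mul, norm_mul, Real.norm_eq_abs, Real.norm_of_nonneg (he0 _)]
    refine mul_le_mul ?_ (he1 _) (he0 _) (by positivity)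
    by_cases hj : j + 1 ≤ K
    · simp only [g, if_pos hj]
      exact abs_selbergWeight_sub_le s β (Finset.mem_Icc.2 ⟨by omega, hj⟩)
    · simp only [g, if_neg hj, zero_sub, abs_neg]
      refine (abs_sin_div_le_inv β (j + 1)).trans ?_
      have : (K : ℝ) ≤ (j + 1 : ℕ) := by exact_mod_cast (by omega : K ≤ j + 1)
      gcongr
      norm_num
  rw [hC, ← hM.tsum_eq, ← hM.summable.tsum_sub hts, ← Real.norm_eq_abs]
  refine (tsum_of_norm_bounded (hgeo.mul_left (3 / (K : ℝ))).hasSum hd).trans ?_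
  rw [tsum_mul_left]
  have hgs : ∑' j : ℕ, z ^ (j + 1) ≤ 1 / (1 - z) := by
    simp only [pow_succ]
    rw [tsum_mul_right, tsum_geometric_of_lt_one hz0.le hz1, one_div]
    exact mul_le_of_le_one_right (inv_nonneg.2 (by linarith)) hz1.le
  -- This is `1 + log x ≤ x` at `x = Kβ`.
  have hΛ : 1 / (K : ℝ) ≤ β / (1 + Real.log (K * β)) := by
    have h1 := Real.log_nonneg hKβ.le
    have h2 := Real.log_le_sub_one_of_pos (by linarith : 0 < K * β)
    rw [div_le_div_iff₀ hK0 (by linarith)]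
    linarith
  have h1z : 0 < 1 - z := by linarith
  calc 3 / (K : ℝ) * ∑' j : ℕ, z ^ (j + 1) ≤ 3 / K * (1 / (1 - z)) := by gcongr
    _ = 3 / (1 - z) * (1 / K) := by ring
    _ ≤ _ := by gcongr

end Mean

/-! ### Verification of the moment hypotheses -/

section Family

variable (F : Type*) [Field F] [Finite F]

/-- A constant for which the centred variables attached to places form a `CenteredFamily`. -/
def familyConst (p : ℕ) (β₀ : ℝ) : ℝ :=
  1 + 8 / (1 - sqrtInv F) + 2 * (8 / (1 - sqrtInv F)) ^ 2 +
    (8 / (1 - sqrtInv F)) ^ 3 / (1 - sqrtInv F) + 128 / (1 - sqrtInv F) ^ 4 +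
    32 / (1 - sqrtInv F) + (26 + 1 / (1 - β₀)) + 4 / (1 - meanRatio p (Nat.card F))

variable {F}
variable {p : ℕ} [Fact p.Prime] {ψ : AddChar (ZMod p) ℂ} {K : ℕ} {β β₀ : ℝ}

/-- Replacing the count of places by `q^m/m` costs at most `16 · 2y^m` in degree `m`, which is
summable. The rest is the logarithmic sum over degrees. -/
theorem abs_sum_places_sq_sub_le (s : ℤˣ) (hβ : 0 < β) (hβ0 : β ≤ β₀) (hβ₀ : β₀ < 1)
    (hK : 1 / β < K) :
    |∑ P ∈ places F K,
        (P.natDegree * (selbergWeight s K β P.natDegree * sqrtInv F ^ P.natDegree)) ^ 2 -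
      Real.log (K * β) / (2 * Real.pi ^ 2)| ≤
      32 / (1 - sqrtInv F) + (26 + 1 / (1 - β₀)) := by
  have hy0 := sqrtInv_pos F
  have hy1 := sqrtInv_lt_one F
  have h1 := abs_sum_mul_selbergWeight_sq_sub_le s hβ hβ0 hβ₀ hK
  have h2 : |∑ P ∈ places F K,
        (P.natDegree * (selbergWeight s K β P.natDegree * sqrtInv F ^ P.natDegree)) ^ 2 -
      ∑ m ∈ Finset.Icc 1 K, m * selbergWeight s K β m ^ 2| ≤ 32 / (1 - sqrtInv F) := by
    rw [sum_places_eq (fun m : ℕ => ((m : ℝ) * (selbergWeight s K β m * sqrtInv F ^ m)) ^ 2),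
      ← Finset.sum_sub_distrib]
    refine (Finset.abs_sum_le_sum_abs _ _).trans ?_
    refine (Finset.sum_le_sum (g := fun m => 32 * sqrtInv F ^ m) fun m hm => ?_).trans ?_
    · have hm0 : (0 : ℝ) < m := by exact_mod_cast (Finset.mem_Icc.1 hm).1
      have e : placeCount F K m * ((m : ℝ) * (selbergWeight s K β m * sqrtInv F ^ m)) ^ 2 -
          m * selbergWeight s K β m ^ 2 = (m * selbergWeight s K β m ^ 2) *
            (m * placeCount F K m * sqrtInv F ^ (2 * m) - 1) := by
        rw [mul_comm 2 m, pow_mul]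
        ring
      have h3 : (m : ℝ) * selbergWeight s K β m ^ 2 ≤ 16 := by
        have h4 := abs_selbergWeight_le_inv s β hm
        have h5 : selbergWeight s K β m ^ 2 ≤ (4 / m) ^ 2 := by
          rw [← sq_abs]
          gcongr
        have hm1 : (1 : ℝ) ≤ m := by exact_mod_cast (Finset.mem_Icc.1 hm).1
        calc (m : ℝ) * selbergWeight s K β m ^ 2 ≤ m * (4 / (m : ℝ)) ^ 2 := by gcongr
          _ = 16 / (m : ℝ) := by field_simp; norm_num
          _ ≤ 16 := div_le_self (by norm_num) hm1
      rw [e, abs_mul, abs_of_nonneg (by positivity)]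
      calc _ ≤ 16 * (2 * sqrtInv F ^ m) :=
            mul_le_mul h3 (abs_mul_placeCount_sub_one_le hm) (abs_nonneg _) (by norm_num)
        _ = _ := by ring
    · rw [← Finset.mul_sum]
      have h := sum_pow_le_of_forall_le hy0.le hy1 (S := Finset.Icc 1 K) (a := 0)
        fun k _ => Nat.zero_le k
      rw [pow_zero] at h
      have : 0 < 1 - sqrtInv F := by linarith
      calc _ ≤ 32 * (1 / (1 - sqrtInv F)) := by gcongr
        _ = _ := by ring
  rw [abs_le] at h1 h2 ⊢
  constructor <;> linarith

theorem centeredFamily_placeDev {ι : Type*} [Fintype ι] [DecidableEq ι] (hp : 2 < p)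
    (hψ : ψ ≠ 1) (s : ℤˣ) (hβ : 0 < β) (hβ0 : β ≤ β₀) (hβ₀ : β₀ < 1) (hK : 1 / β < K)
    {a : ι → ZMod p} (ha : ∀ i, a i ≠ 0) :
    CenteredFamily (fun B : Finset ι => ∑ i ∈ B, a i = 0)
      (fun (P : places F K) i t =>
        placeDev ψ K (selbergWeight s K β) (sqrtInv F) P.1.natDegree (a i) t)
      (fun P => 8 / (1 - sqrtInv F) *
        (sqrtInv F ^ P.1.natDegree * min 1 (P.1.natDegree * β)))
      (familyConst F p β₀) (Real.log (K * β) / (2 * Real.pi ^ 2)) (1 + Real.log (K * β)) β := by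
  have hy0 := sqrtInv_pos F
  have hy1 := sqrtInv_lt_one F
  have hz1 := meanRatio_lt_one hp (Finite.one_lt_card (α := F))
  have hβ1 : β ≤ 1 := hβ0.trans hβ₀.le
  have hKβ : 1 < K * β := by rwa [div_lt_iff₀ hβ] at hK
  have hlog := Real.log_nonneg hKβ.le
  have hg1 : ∀ k ∈ Finset.Icc 1 K, |selbergWeight s K β k| ≤ 4 / k :=
    fun k hk => abs_selbergWeight_le_inv s β hk
  have hg2 : ∀ k ∈ Finset.Icc 1 K, |selbergWeight s K β k| ≤ 4 * β :=
    fun k hk => abs_selbergWeight_le_beta s hβ hK hk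
  set y := sqrtInv F with hy
  have h1y : 0 < 1 - y := by linarith
  set c₁ := 8 / (1 - y) with hc₁
  have e0 : 0 < c₁ := by positivity
  have e1 : 0 < 2 * c₁ ^ 2 := by positivity
  have e2 : 0 < c₁ ^ 3 / (1 - y) := by positivity
  have e3 : 0 < 128 / (1 - y) ^ 4 := by positivity
  have e4 : 0 < 32 / (1 - y) := by positivity
  have e5 : 0 < 1 / (1 - β₀) := one_div_pos.2 (by linarith)
  have e6 : 0 < 4 / (1 - meanRatio p (Nat.card F)) := div_pos (by norm_num) (by linarith)
  have hc : familyConst F p β₀ = 1 + c₁ + 2 * c₁ ^ 2 + c₁ ^ 3 / (1 - y) + 128 / (1 - y) ^ 4 +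
    32 / (1 - y) + (26 + 1 / (1 - β₀)) + 4 / (1 - meanRatio p (Nat.card F)) := rfl
  have hmin (m : ℕ) : 0 ≤ min 1 ((m : ℝ) * β) := by positivity
  have hsum_mul : ∑ m ∈ Finset.Icc 1 K, (m : ℝ) * y ^ m ≤ 1 / (1 - y) ^ 2 :=
    sum_mul_pow_le hy0.le hy1 _
  refine ⟨by linarith, hβ, hβ1, by linarith, by positivity, ?_, fun P i => expect_placeDev _,
    fun P i t => norm_placeDev_le hy0 hy1 hβ hg1 hg2 (natDegree_mem_Icc P.2) _ _,
    fun P => mul_nonneg e0.le (mul_nonneg (by positivity) (hmin _)), fun P => ?_, ?_, ?_, ?_⟩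
  · have hpi := Real.pi_gt_three
    refine (div_le_self hlog ?_).trans (by linarith)
    nlinarith
  · have h1 : y ^ P.1.natDegree * min 1 (P.1.natDegree * β) ≤ 1 :=
      mul_le_one₀ (pow_le_one₀ hy0.le hy1.le) (hmin _) (min_le_left _ _)
    have h2 := mul_le_of_le_one_right e0.le h1
    linarith
  -- Squares: the count of places exactly balances `y ^ (2 * m)`, leaving a logarithmic sum.
  · rw [Finset.sum_coe_sort (places F K)
      (fun P => (c₁ * (y ^ P.natDegree * min 1 (P.natDegree * β))) ^ 2)]
    have h := sum_places_mul_le (F := F) (K := K) (f := fun m => c₁ ^ 2 * min 1 (m * β) ^ 2)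
      fun m _ => by positivity
    have h2 := sum_min_sq_div_le hβ hβ1 hK
    calc _ = ∑ P ∈ places F K, c₁ ^ 2 * min 1 (P.natDegree * β) ^ 2 * y ^ (2 * P.natDegree) :=
          Finset.sum_congr rfl fun P _ => by rw [mul_comm 2, pow_mul]; ring
      _ ≤ _ := h
      _ = c₁ ^ 2 * ∑ m ∈ Finset.Icc 1 K, min 1 (m * β) ^ 2 / m := by
          rw [Finset.mul_sum]
          exact Finset.sum_congr rfl fun m _ => by ring
      _ ≤ c₁ ^ 2 * (2 * (1 + Real.log (K * β))) := by gcongr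
      _ = (2 * c₁ ^ 2) * (1 + Real.log (K * β)) := by ring
      _ ≤ _ := by
          refine mul_le_mul_of_nonneg_right ?_ (by linarith)
          linarith
  -- Cubes: one factor `y ^ m` is left over, so the sum converges, and `min(1, mβ)³ ≤ mβ` supplies
  -- the factor `β`.
  · rw [Finset.sum_coe_sort (places F K)
      (fun P => (c₁ * (y ^ P.natDegree * min 1 (P.natDegree * β))) ^ 3)]
    have h := sum_places_mul_le (F := F) (K := K) (f := fun m => c₁ ^ 3 * (m * β * y ^ m))
      fun m _ => by positivity
    have h2 := sum_pow_le_of_forall_le hy0.le hy1 (S := Finset.Icc 1 K) (a := 0)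
        fun k _ => Nat.zero_le k
    rw [pow_zero] at h2
    calc _ ≤ ∑ P ∈ places F K, c₁ ^ 3 * (P.natDegree * β * y ^ P.natDegree) *
            y ^ (2 * P.natDegree) := by
          refine Finset.sum_le_sum fun P _ => ?_
          have h3 : min 1 (P.natDegree * β) ^ 3 ≤ P.natDegree * β :=
            (pow_le_of_le_one (hmin _) (min_le_left _ _) (by norm_num)).trans (min_le_right _ _)
          calc _ = c₁ ^ 3 * (y ^ P.natDegree * y ^ (2 * P.natDegree)) *
                min 1 (P.natDegree * β) ^ 3 := by rw [mul_comm 2, pow_mul]; ring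
            _ ≤ c₁ ^ 3 * (y ^ P.natDegree * y ^ (2 * P.natDegree)) * (P.natDegree * β) := by
                gcongr
            _ = _ := by ring
      _ ≤ _ := h
      _ = c₁ ^ 3 * β * ∑ m ∈ Finset.Icc 1 K, y ^ m := by
          rw [Finset.mul_sum]
          refine Finset.sum_congr rfl fun m hm => ?_
          have hm0 : (0 : ℝ) < m := by exact_mod_cast (Finset.mem_Icc.1 hm).1
          field_simp
      _ ≤ c₁ ^ 3 * β * (1 / (1 - y)) := by gcongr
      _ = (c₁ ^ 3 / (1 - y)) * β := by ring
      _ ≤ _ := by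
          refine mul_le_mul_of_nonneg_right ?_ hβ.le
          linarith
  · intro i j hij
    have hloc (P : places F K) : localMoment (fun (P : places F K) i t =>
        placeDev ψ K (selbergWeight s K β) y P.1.natDegree (a i) t) P {i, j} =
        𝔼 t, placeDev ψ K (selbergWeight s K β) y P.1.natDegree (a i) t *
          placeDev ψ K (selbergWeight s K β) y P.1.natDegree (a j) t := by
      unfold localMoment
      simp only [Finset.prod_pair hij]
    simp only [hloc, Finset.sum_pair hij]
    rw [Finset.sum_coe_sort (places F K) (fun P => 𝔼 t,
      placeDev ψ K (selbergWeight s K β) y P.natDegree (a i) t *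
          placeDev ψ K (selbergWeight s K β) y P.natDegree (a j) t)]
    have h1 : ‖∑ P ∈ places F K, (𝔼 t,
        placeDev ψ K (selbergWeight s K β) y P.natDegree (a i) t *
          placeDev ψ K (selbergWeight s K β) y P.natDegree (a j) t -
        if a i + a j = 0 then (((P.natDegree *
          (selbergWeight s K β P.natDegree * y ^ P.natDegree)) ^ 2 : ℝ) : ℂ) else 0)‖ ≤
        128 / (1 - y) ^ 4 := by
      refine (norm_sum_le_of_le _ fun P hP => norm_expect_placeDev_mul_sub_le hψ hy0 hy1 hβ hβ1
        hg2 (natDegree_mem_Icc hP) (ha i) (ha j)).trans ?_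
      have h := sum_places_mul_le (F := F) (K := K)
        (f := fun m => 128 / (1 - y) ^ 2 * (m ^ 2 * y ^ m)) fun m _ => by positivity
      calc _ = ∑ P ∈ places F K, 128 / (1 - y) ^ 2 * (P.natDegree ^ 2 * y ^ P.natDegree) *
              y ^ (2 * P.natDegree) := by
            refine Finset.sum_congr rfl fun P _ => ?_
            rw [show 3 * P.natDegree = P.natDegree + 2 * P.natDegree by ring, pow_add]
            ring
        _ ≤ _ := h
        _ = 128 / (1 - y) ^ 2 * ∑ m ∈ Finset.Icc 1 K, m * y ^ m := by
            rw [Finset.mul_sum]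
            refine Finset.sum_congr rfl fun m hm => ?_
            have hm0 : (0 : ℝ) < m := by exact_mod_cast (Finset.mem_Icc.1 hm).1
            field_simp
        _ ≤ 128 / (1 - y) ^ 2 * (1 / (1 - y) ^ 2) := by gcongr
        _ = _ := by field_simp
    have h2 := abs_sum_places_sq_sub_le (F := F) s hβ hβ0 hβ₀ hK
    rw [← hy] at h2
    rw [Finset.sum_sub_distrib] at h1
    have h3 : ‖(∑ P ∈ places F K, if a i + a j = 0 then (((P.natDegree *
          (selbergWeight s K β P.natDegree * y ^ P.natDegree)) ^ 2 : ℝ) : ℂ) else 0) -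
        (if a i + a j = 0 then ((Real.log (K * β) / (2 * Real.pi ^ 2) : ℝ) : ℂ) else 0)‖ ≤
        32 / (1 - y) + (26 + 1 / (1 - β₀)) := by
      split_ifs
      · rw [← Complex.ofReal_sum, ← Complex.ofReal_sub, Complex.norm_real, Real.norm_eq_abs]
        exact h2
      · simp only [Finset.sum_const_zero, sub_zero, norm_zero]
        linarith
    have h4 := norm_sub_le_norm_sub_add_norm_sub
      (∑ P ∈ places F K, 𝔼 t, placeDev ψ K (selbergWeight s K β) y P.natDegree (a i) t *
          placeDev ψ K (selbergWeight s K β) y P.natDegree (a j) t)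
      (∑ P ∈ places F K, if a i + a j = 0 then (((P.natDegree *
          (selbergWeight s K β P.natDegree * y ^ P.natDegree)) ^ 2 : ℝ) : ℂ) else 0)
      (if a i + a j = 0 then ((Real.log (K * β) / (2 * Real.pi ^ 2) : ℝ) : ℂ) else 0)
    linarith

end Family

/-! ### From the moment over the family to the main term -/

section Assembly

variable {p : ℕ} [Fact p.Prime] {F : Type*} [Field F] [Finite F] [CharP F p]

theorem sum_units_int {M : Type*} [AddCommMonoid M] (φ : ℤˣ → M) : ∑ e, φ e = φ 1 + φ (-1) := by
  rw [UnitsInt.univ, Finset.sum_pair (by decide)]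

theorem expSum_pow_eq {j K : ℕ} (hj : j + 1 ≤ K) (f : F[X]) (ψ : AddChar (ZMod p) ℂ) (h : ℕ)
    (e : ℤˣ) : expSum p F (j + 1) f (if e = 1 then ψ ^ h else (ψ ^ h)⁻¹) =
      ∑ P ∈ places F K with P.natDegree ∣ j + 1, (P.natDegree : ℂ) *
        ψ (((e : ℤ) : ZMod p) * h * (((j + 1) / P.natDegree : ℕ) * resTrace p P f)) := by
  rw [expSum_eq_sum_places p hj]
  refine Finset.sum_congr rfl fun P _ => ?_
  congr 1
  rcases Int.units_eq_one_or e with rfl | rfl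
  · rw [if_pos rfl, AddChar.pow_apply, ← AddChar.map_nsmul_eq_pow, nsmul_eq_mul]
    simp
  · rw [if_neg (by decide), AddChar.inv_apply, AddChar.pow_apply, ← AddChar.map_nsmul_eq_pow,
      nsmul_eq_mul]
    simp

/-- The coefficients at `k` and `-k` agree, so the conjugate character can be recorded as the sign
`e = -1` in front of `h`. These are the signs counted in `pairingCount`. -/
theorem selbergSum_eq (s : ℤˣ) (K : ℕ) (β : ℝ) (f : F[X]) (ψ : AddChar (ZMod p) ℂ) (h : ℕ) :
    selbergSum p F s K β f (ψ ^ h) = ∑ e : ℤˣ, ∑ P : places F K,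
      placeVar ψ K (selbergWeight s K β) (sqrtInv F) P.1.natDegree (((e : ℤ) : ZMod p) * h)
        (resTrace p P.1 f) := by
  have hq : (0 : ℝ) < Nat.card F := by exact_mod_cast Nat.card_pos
  have hstep (e : ℤˣ) : ∑ P : places F K,
      placeVar ψ K (selbergWeight s K β) (sqrtInv F) P.1.natDegree (((e : ℤ) : ZMod p) * h)
        (resTrace p P.1 f) = ∑ j ∈ Finset.range K,
      ((selbergWeight s K β (j + 1) * sqrtInv F ^ (j + 1) : ℝ) : ℂ) *
        expSum p F (j + 1) f (if e = 1 then ψ ^ h else (ψ ^ h)⁻¹) := by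
    rw [Finset.sum_coe_sort (places F K) (fun P => placeVar ψ K (selbergWeight s K β) (sqrtInv F)
      P.natDegree (((e : ℤ) : ZMod p) * h) (resTrace p P f))]
    unfold placeVar
    simp only [Finset.sum_filter]
    rw [Finset.sum_comm]
    let Φ : ℕ → ℂ := fun k => ∑ P ∈ places F K, if P.natDegree ∣ k then
      ((P.natDegree * (selbergWeight s K β k * sqrtInv F ^ k) : ℝ) : ℂ) *
        ψ (((e : ℤ) : ZMod p) * h * ((k / P.natDegree : ℕ) * resTrace p P f)) else 0
    have hΦ (j : ℕ) (hj : j ∈ Finset.range K) :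
        ((selbergWeight s K β (j + 1) * sqrtInv F ^ (j + 1) : ℝ) : ℂ) *
          expSum p F (j + 1) f (if e = 1 then ψ ^ h else (ψ ^ h)⁻¹) = Φ (j + 1) := by
      rw [expSum_pow_eq (K := K) (by have := Finset.mem_range.1 hj; omega), Finset.mul_sum,
        Finset.sum_filter]
      refine Finset.sum_congr rfl fun P _ => ?_
      split_ifs
      · push_cast
        ring
      · rfl
    rw [Finset.sum_congr rfl hΦ, Finset.range_eq_Ico, Finset.sum_Ico_add' Φ 0 K 1]
    rfl
  have hpow (j : ℕ) : (((Nat.card F : ℝ) ^ (((j + 1 : ℕ) : ℝ) / 2) : ℝ) : ℂ)⁻¹ =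
      ((sqrtInv F ^ (j + 1) : ℝ) : ℂ) := by
    rw [← Complex.ofReal_inv, sqrtInv, Real.sqrt_eq_rpow, inv_pow, ← Real.rpow_natCast,
      ← Real.rpow_mul hq.le]
    congr 3
    ring
  rw [sum_units_int, hstep, hstep, ← Finset.sum_add_distrib]
  unfold selbergSum
  refine Finset.sum_congr rfl fun j hj => ?_
  have hjK : j + 1 ∈ Finset.Icc 1 K := by
    have := Finset.mem_range.1 hj
    exact Finset.mem_Icc.2 (by omega)
  rw [selbergCoeff_eq s β hjK (Or.inl rfl), selbergCoeff_eq s β hjK (Or.inr rfl), if_pos rfl,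
    if_neg (by decide), div_eq_mul_inv, hpow]
  push_cast
  ring

theorem conj_placeVar (ψ : AddChar (ZMod p) ℂ) (K : ℕ) (g : ℕ → ℝ) (y : ℝ) (m : ℕ)
    (a t : ZMod p) : (starRingEnd ℂ) (placeVar ψ K g y m a t) = placeVar ψ K g y m (-a) t := by
  unfold placeVar
  rw [map_sum]
  refine Finset.sum_congr rfl fun k _ => ?_
  rw [map_mul, Complex.conj_ofReal, ← AddChar.map_neg_eq_conj, neg_mul]

/-- Conjugation swaps the two signs. Reality of the moment is needed for a real relative error. -/
theorem conj_selbergSum (s : ℤˣ) (K : ℕ) (β : ℝ) (f : F[X]) (ψ : AddChar (ZMod p) ℂ) (h : ℕ) :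
    (starRingEnd ℂ) (selbergSum p F s K β f (ψ ^ h)) = selbergSum p F s K β f (ψ ^ h) := by
  rw [selbergSum_eq, sum_units_int, map_add, map_sum, map_sum]
  simp only [conj_placeVar]
  rw [add_comm]
  simp

theorem conj_mixedMoment (s : ℤˣ) (K : ℕ) (β : ℝ) (d : ℕ) (ψ : AddChar (ZMod p) ℂ) {n : ℕ}
    (h : Fin n → ℕ) :
    (starRingEnd ℂ) (mixedMoment p F s K β d ψ h) = mixedMoment p F s K β d ψ h := by
  unfold mixedMoment average
  rw [map_div₀, map_sum, map_natCast]
  simp only [map_prod, conj_selbergSum]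

open Classical in
theorem mixedMoment_eq (s : ℤˣ) {K : ℕ} (β : ℝ) {d : ℕ} (ψ : AddChar (ZMod p) ℂ) {n : ℕ}
    (h : Fin n → ℕ) (hd : ¬ p ∣ d) (hK : n * K ≤ d) :
    mixedMoment p F s K β d ψ h = ∑ e : Fin n → ℤˣ, 𝔼 ω : places F K → ZMod p,
      ∏ i, ∑ P, placeVar ψ K (selbergWeight s K β) (sqrtInv F) P.1.natDegree
        (((e i : ℤ) : ZMod p) * h i) (ω P) := by
  rw [← Finset.expect_sum_comm]
  unfold mixedMoment
  have h1 := average_prod_sum_places p (F := F) (ι := Fin n) (K := K) hd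
    (by rwa [Fintype.card_fin])
    (fun i P t => ∑ e : ℤˣ, placeVar ψ K (selbergWeight s K β) (sqrtInv F) P.1.natDegree
        (((e : ℤ) : ZMod p) * h i) t)
  simp only [selbergSum_eq]
  simp only [Finset.sum_comm (s := (Finset.univ : Finset (places F K)))] at h1
  rw [h1]
  refine Finset.expect_congr rfl fun ω _ => ?_
  rw [Finset.prod_univ_sum, Fintype.piFinset_univ]

theorem pairingCount_eq (p : ℕ) [Fact p.Prime] {n : ℕ} (hn : 0 < n) (h : Fin n → ℕ) :
    pairingCount p h = ∑ e : Fin n → ℤˣ,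
      ((matchings (fun B : Finset (Fin n) => ∑ i ∈ B, ((e i : ℤ) : ZMod p) * h i = 0)
          Finset.univ).card +
        ∑ j, (matchings (fun B : Finset (Fin n) => ∑ i ∈ B, ((e i : ℤ) : ZMod p) * h i = 0)
          (Finset.univ.erase j)).card) := by
  classical
  have : Nonempty (Fin n) := ⟨⟨0, hn⟩⟩
  unfold pairingCount
  rw [Nat.card_eq_fintype_card, Fintype.card_subtype, Finset.card_filter, Fintype.sum_prod_type]
  refine Finset.sum_congr rfl fun e _ => ?_
  rw [← card_maximal_matchings, ← Finset.card_filter]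
  congr 1
  ext M
  simp only [Finset.mem_filter, Finset.mem_univ, true_and, Fintype.card_fin,
    ← ZMod.intCast_zmod_eq_zero_iff_dvd]
  push_cast
  rfl

/-- For each parity of `n` one of the two matching counts vanishes, which lets a single expression
absorb the case distinction in `deltaC`. -/
theorem mainTerm_eq (p : ℕ) [Fact p.Prime] (q K : ℕ) (β : ℝ) {n : ℕ} (hn : 0 < n)
    (h : Fin n → ℕ) : (mainTerm p q K β h : ℂ) = ∑ e : Fin n → ℤˣ,
      (((matchings (fun B : Finset (Fin n) => ∑ i ∈ B, ((e i : ℤ) : ZMod p) * h i = 0)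
          Finset.univ).card : ℂ) + (constC p q β : ℂ) *
        ∑ j, ((matchings (fun B : Finset (Fin n) => ∑ i ∈ B, ((e i : ℤ) : ZMod p) * h i = 0)
          (Finset.univ.erase j)).card : ℂ)) *
        ((Real.log (K * β) / (2 * Real.pi ^ 2) : ℝ) : ℂ) ^ (n / 2) := by
  have hmain : (mainTerm p q K β h : ℂ) = (deltaC n (constC p q β) : ℂ) * (pairingCount p h : ℂ) *
      ((Real.log (K * β) / (2 * Real.pi ^ 2) : ℝ) : ℂ) ^ (n / 2) := by
    unfold mainTerm
    push_cast
    rw [div_pow]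
    ring
  rw [hmain, pairingCount_eq p hn, ← Finset.sum_mul, Nat.cast_sum, Finset.mul_sum]
  congr 1
  refine Finset.sum_congr rfl fun e _ => ?_
  rcases Nat.even_or_odd n with hpar | hpar
  · rw [deltaC, if_pos hpar, Finset.sum_eq_zero fun j _ => card_matchings_of_odd (by
        rw [Finset.card_erase_of_mem (Finset.mem_univ j), Finset.card_fin]
        obtain ⟨r, hr⟩ := hpar
        omega), Finset.sum_eq_zero fun j _ => by
        rw [card_matchings_of_odd, Nat.cast_zero]
        rw [Finset.card_erase_of_mem (Finset.mem_univ j), Finset.card_fin]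
        obtain ⟨r, hr⟩ := hpar
        omega]
    simp
  · rw [deltaC, if_neg (Nat.not_even_iff_odd.2 hpar), card_matchings_of_odd (by
      rw [Finset.card_fin]; exact Nat.odd_iff.1 hpar)]
    push_cast
    ring

theorem sign_mul_ne_zero {h : ℕ} (h0 : 0 < h) (h1 : h ≤ (p - 1) / 2) (e : ℤˣ) :
    ((e : ℤ) : ZMod p) * h ≠ 0 := by
  have hp := (Fact.out : p.Prime).two_le
  have hh : (h : ZMod p) ≠ 0 := by
    rw [Ne, ZMod.natCast_eq_zero_iff]
    intro hdvd
    have := Nat.le_of_dvd h0 hdvd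
    omega
  rcases Int.units_eq_one_or e with rfl | rfl <;> simpa using hh

variable (p F) in
theorem exists_mixedMoment_bound (hp : p ≠ 2) (n : ℕ) (hn : 0 < n) (β₀ : ℝ) (hβ₀ : β₀ < 1) :
    ∃ A : ℝ, 0 ≤ A ∧ ∀ (ψ : AddChar (ZMod p) ℂ) (h : Fin n → ℕ) (s : ℤˣ) (β : ℝ) (K d : ℕ),
      ψ ≠ 1 → (∀ i, 0 < h i ∧ h i ≤ (p - 1) / 2) → 0 < β → β ≤ β₀ → ¬ p ∣ d →
      max 1 (1 / β) < (K : ℝ) → (K : ℝ) < (d : ℝ) / n →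
      ‖mixedMoment p F s K β d ψ h - (mainTerm p (Nat.card F) K β h : ℂ)‖
        ≤ A * β ^ (n % 2) * (1 + Real.log (K * β)) ^ (n / 2) / (1 + Real.log (K * β)) := by
  classical
  obtain ⟨C, hC, hbound⟩ := exists_expect_prod_bound (Fin n) (familyConst F p β₀)
  refine ⟨Fintype.card (Fin n → ℤˣ) * C, by positivity, ?_⟩
  intro ψ h s β K d hψ hh hβ hβ0 hd hK hKd
  have hp2 : 2 < p := lt_of_le_of_ne (Fact.out : p.Prime).two_le (Ne.symm hp)
  have hq : 1 < Nat.card F := Finite.one_lt_card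
  have hKβ : 1 / β < K := (le_max_right _ _).trans_lt hK
  have hnK : n * K ≤ d := by
    have hn0 : (0 : ℝ) < n := by exact_mod_cast hn
    rw [lt_div_iff₀ hn0] at hKd
    have : ((n * K : ℕ) : ℝ) ≤ d := by push_cast; linarith
    exact_mod_cast this
  rw [mixedMoment_eq s β ψ h hd hnK, mainTerm_eq p (Nat.card F) K β hn h,
    ← Finset.sum_sub_distrib]
  -- Each sign vector is a separate independent model with its own set of admissible pairs; the
  -- bound is the same for all of them.
  refine (norm_sum_le_of_le (f := _) (n := fun _ => C * (β ^ (n % 2) *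
    ((1 + Real.log (K * β)) ^ (n / 2) / (1 + Real.log (K * β))))) _ fun e _ => ?_).trans
    (le_of_eq ?_)
  · have ha (i : Fin n) : ((e i : ℤ) : ZMod p) * h i ≠ 0 := sign_mul_ne_zero (hh i).1 (hh i).2 (e i)
    have hfam := centeredFamily_placeDev (F := F) hp2 hψ s hβ hβ0 hβ₀ hKβ ha
    have hz1 := meanRatio_lt_one hp2 hq
    have hle : 4 / (1 - meanRatio p (Nat.card F)) ≤ familyConst F p β₀ := by
      have hy1 := sqrtInv_lt_one F
      have e1 : 0 < 1 - sqrtInv F := by linarith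
      have e2 : 0 < 1 - β₀ := by linarith
      unfold familyConst
      have : 0 ≤ 1 + 8 / (1 - sqrtInv F) + 2 * (8 / (1 - sqrtInv F)) ^ 2 +
        (8 / (1 - sqrtInv F)) ^ 3 / (1 - sqrtInv F) + 128 / (1 - sqrtInv F) ^ 4 +
        32 / (1 - sqrtInv F) + (26 + 1 / (1 - β₀)) := by positivity
      linarith
    have hμ := (abs_meanSum_le (g := selbergWeight s K β) hp2 hq hβ
      fun k hk => abs_selbergWeight_le_beta s hβ hKβ hk).trans
      (mul_le_mul_of_nonneg_right hle hβ.le)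
    have hμC := abs_meanSum_sub_constC_le hp2 hq s hβ hKβ
    have hΛ := hfam.one_le_lam
    have hle3 : 3 / (1 - meanRatio p (Nat.card F)) ≤ familyConst F p β₀ := by
      refine le_trans ?_ hle
      have : 0 < 1 - meanRatio p (Nat.card F) := by linarith
      gcongr
      norm_num
    have := hbound _ _ _ _ _ _ hfam (meanSum p (Nat.card F) K (selbergWeight s K β) : ℂ)
      (constC p (Nat.card F) β) (by rwa [Complex.norm_real])
      (by
        rw [← Complex.ofReal_sub, Complex.norm_real]
        exact hμC.trans (mul_le_mul_of_nonneg_right hle3 (by positivity)))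
    rw [Fintype.card_fin] at this
    -- Centre each factor; the total mean is the same number for every `i`, as
    -- `exists_expect_prod_bound` requires.
    have heq (ω : places F K → ZMod p) : ∏ i, ∑ P, placeVar ψ K (selbergWeight s K β) (sqrtInv F)
        P.1.natDegree (((e i : ℤ) : ZMod p) * h i) (ω P) =
        ∏ i, ((meanSum p (Nat.card F) K (selbergWeight s K β) : ℂ) + ∑ P : places F K,
          placeDev ψ K (selbergWeight s K β) (sqrtInv F) P.1.natDegree
            (((e i : ℤ) : ZMod p) * h i) (ω P)) := by
      refine Finset.prod_congr rfl fun i _ => ?_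
      rw [← sum_expect_placeVar hψ K (selbergWeight s K β) (ha i), ← Finset.sum_add_distrib]
      refine Finset.sum_congr rfl fun P _ => ?_
      unfold placeDev
      ring
    simp only [heq]
    exact this
  · rw [Finset.sum_const, nsmul_eq_mul, Finset.card_univ]
    ring

end Assembly

/-- An additive error bound for a real quantity turns into a relative one when the main term has
its expected order of magnitude. -/
theorem exists_relative_error {T M A B c L D : ℝ} {l : ℕ} (hA : 0 ≤ A) (hB : 0 < B) (hc : 0 < c)
    (hD : 0 < D) (hL : Real.log 2 ≤ L) (hT : c * B / D * L ^ l ≤ |T|)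
    (hM : |M - T| ≤ A * B * (1 + L) ^ l / (1 + L)) :
    ∃ η : ℝ, |η| ≤ (A / c * D * (1 + 1 / Real.log 2) ^ l) / L ∧ M = T * (1 + η) := by
  have hlog : 0 < Real.log 2 := Real.log_pos one_lt_two
  have hL0 : 0 < L := hlog.trans_le hL
  have hT0 : 0 < |T| := lt_of_lt_of_le (by positivity) hT
  have hTne : T ≠ 0 := abs_pos.1 hT0
  refine ⟨(M - T) / T, ?_, by field_simp; ring⟩
  rw [abs_div, div_le_iff₀ hT0]
  -- Since `L ≥ log 2`, the additive 1 is absorbed into a multiple of `L`; this is the role of `Kβ ≥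
  -- 2`.
  have h1 : 1 + L ≤ (1 + 1 / Real.log 2) * L := by
    have : 1 ≤ 1 / Real.log 2 * L := by
      rw [one_div, inv_mul_eq_div, one_le_div hlog]
      exact hL
    linarith
  have h2 : (1 + L) ^ l ≤ (1 + 1 / Real.log 2) ^ l * L ^ l := by
    rw [← mul_pow]
    exact pow_le_pow_left₀ (by positivity) h1 l
  have h3 : 1 / (1 + L) ≤ 1 / L := by
    gcongr
    linarith
  calc |M - T| ≤ A * B * (1 + L) ^ l / (1 + L) := hM
    _ = A * B * (1 + L) ^ l * (1 / (1 + L)) := by ring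
    _ ≤ A * B * ((1 + 1 / Real.log 2) ^ l * L ^ l) * (1 / L) := by gcongr
    _ = (A / c * D * (1 + 1 / Real.log 2) ^ l) / L * (c * B / D * L ^ l) := by
      field_simp
    _ ≤ _ := by gcongr

end ArtinSchreier

end

/-! ### The theorem -/

theorem mainTheorem7 (p : ℕ) [Fact p.Prime] (hp : p ≠ 2)
    (F : Type*) [Field F] [Finite F] [CharP F p]
    (n : ℕ) (hn : 0 < n) (β₀ : ℝ) (hβ₀ : β₀ < 1) :
    -- the estimate with an additive error term, uniform in the interval
    (∃ A : ℝ, ∀ (ψ : AddChar (ZMod p) ℂ) (h : Fin n → ℕ) (s : ℤˣ) (β : ℝ) (K d : ℕ),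
      ψ ≠ 1 → (∀ i, 0 < h i ∧ h i ≤ (p - 1) / 2) → 0 < β → β ≤ β₀ → ¬ p ∣ d →
      max 1 (1 / β) < (K : ℝ) → (K : ℝ) < (d : ℝ) / n →
      ‖ArtinSchreier.mixedMoment p F s K β d ψ h
          - (ArtinSchreier.mainTerm p (Nat.card F) K β h : ℂ)‖
        ≤ A * β ^ (n % 2) * (1 + Real.log (K * β)) ^ (n / 2) / (1 + Real.log (K * β))) ∧
    -- the estimate with a relative error term, where the main term has its true order of magnitude
    (∀ c : ℝ, 0 < c →
      ∃ A : ℝ, ∀ (ψ : AddChar (ZMod p) ℂ) (h : Fin n → ℕ) (s : ℤˣ) (β : ℝ) (K d : ℕ),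
      ψ ≠ 1 → (∀ i, 0 < h i ∧ h i ≤ (p - 1) / 2) → 0 < β → β ≤ β₀ → ¬ p ∣ d →
      max 1 (1 / β) < (K : ℝ) → (K : ℝ) < (d : ℝ) / n → 2 ≤ K * β →
      ArtinSchreier.pairingCount p h ≠ 0 →
      c * β ^ (n % 2) ≤ |ArtinSchreier.deltaC n (ArtinSchreier.constC p (Nat.card F) β)| →
      ∃ η : ℝ, |η| ≤ A / Real.log (K * β) ∧
        ArtinSchreier.mixedMoment p F s K β d ψ h
          = ((ArtinSchreier.mainTerm p (Nat.card F) K β h * (1 + η) : ℝ) : ℂ)) := by 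
  refine ⟨?_, fun c hc => ?_⟩
  · obtain ⟨A, -, hA⟩ := ArtinSchreier.exists_mixedMoment_bound p F hp n hn β₀ hβ₀
    exact ⟨A, hA⟩
  · obtain ⟨A, hA0, hA⟩ := ArtinSchreier.exists_mixedMoment_bound p F hp n hn β₀ hβ₀
    refine ⟨A / c * (2 * Real.pi ^ 2) ^ (n / 2) * (1 + 1 / Real.log 2) ^ (n / 2), ?_⟩
    intro ψ h s β K d hψ hh hβ hβ0 hd hK hKd hKβ hpair hδ
    have hM := hA ψ h s β K d hψ hh hβ hβ0 hd hK hKd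
    obtain ⟨M, hMeq⟩ := Complex.conj_eq_iff_real.1
      (ArtinSchreier.conj_mixedMoment (p := p) (F := F) s K β d ψ h)
    rw [hMeq, ← Complex.ofReal_sub, Complex.norm_real, Real.norm_eq_abs] at hM
    have hL : Real.log 2 ≤ Real.log (K * β) := Real.log_le_log two_pos hKβ
    have hL0 : 0 < Real.log (K * β) := (Real.log_pos one_lt_two).trans_le hL
    -- A non-zero pairing count is at least 1, so the lower bound on `deltaC` gives the main term
    -- its full order of magnitude.
    have hT : c * β ^ (n % 2) / (2 * Real.pi ^ 2) ^ (n / 2) * Real.log (K * β) ^ (n / 2) ≤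
        |ArtinSchreier.mainTerm p (Nat.card F) K β h| := by
      have hone : (1 : ℝ) ≤ ArtinSchreier.pairingCount p h := by
        exact_mod_cast Nat.one_le_iff_ne_zero.2 hpair
      have hpi := Real.pi_pos
      unfold ArtinSchreier.mainTerm
      rw [abs_mul, abs_div, abs_mul, abs_of_pos (pow_pos hL0 _),
        abs_of_pos (by positivity : 0 < (2 * Real.pi ^ 2) ^ (n / 2)), Nat.abs_cast]
      have hnum : c * β ^ (n % 2) ≤ |ArtinSchreier.deltaC n (ArtinSchreier.constC p (Nat.card F) β)| *
          ArtinSchreier.pairingCount p h := by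
        calc c * β ^ (n % 2) = c * β ^ (n % 2) * 1 := (mul_one _).symm
          _ ≤ _ := mul_le_mul hδ hone zero_le_one (abs_nonneg _)
      exact mul_le_mul_of_nonneg_right (div_le_div_of_nonneg_right hnum (by positivity))
        (by positivity)
    obtain ⟨η, hη, hMη⟩ := ArtinSchreier.exists_relative_error hA0 (pow_pos hβ (n % 2)) hc
      (by positivity) hL hT hM
    exact ⟨η, hη, by rw [hMeq, hMη]⟩
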